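/- **Setting.** Let a power network be given by a finite connected graph with buses $i\in\mathcal I$ and oriented lines $l$, incidence matrix $D$, inertias $M_i\ge 0$ (at least one positive), dampings $E_i>0$, line susceptances $b_l>0$, $Y_b=\mathrm{diag}(b_l)$. Let $\mathcal I^\omega\subseteq\mathcal I^u\subseteq\mathcal I$ be the buses with a frequency requirement and the controlled buses. The dynamics are $$\dot\lambda=D\omega,\qquad M\dot\omega=-E\omega-D^TY_b\sin\lambda+p(t)+u(t),\qquad u_i=0\ \ (i\notin\mathcal I^u),$$ with $\lambda(0)\in\mathrm{range}(D)$; solutions are on $[0,\infty)$ in the integrated (Carathéodory) sense, and the algebraic equations at buses with $M_i=0$ hold at all times. Put $v_i(s,\omega,q)=-E_i\omega_i-[D^TY_bs]_i+q_i$. **Data.** Thresholds $\underline\omega_i^{thr}<0<\bar\omega_i^{thr}$ ($i\in\mathcal I^u$); safe bounds $\underline\omega_i<\underline\omega_i^{thr}$, $\bar\omega_i^{thr}<\bar\omega_i$ and $0<\delta_i<\bar\omega_i-\underline\omega_i$ ($i\in\mathcal I^\omega$); types $\xi_i\in\{0,1\}$ and magnitude bounds $u_i^{\min},u_i^{\max}$,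 with $u_i^{\min}\le 0\le u_i^{\max}$ if $\xi_i=0$ (hard constraint); weights $c_i,d_i>0$ ($i\in\mathcal I^u$), $e_i>0$ ($i\in\mathcal I^\omega$); gains $\underline\gamma_i,\bar\gamma_i>0$ ($i\in\mathcal I^\omega$); horizon $\tilde t>0$, sampling length $T>0$, $N=\lceil\tilde t/T\rceil$; for each $t\ge0$ a forecast $p^{fcst}_t:[t,t+\tilde t]\to\mathbb R^{\mathcal I}$ with $p_t^{fcst}(t)=p(t)$. **Optimization problem.** For a network as above, a discrete forecast $\hat p(k)$ and a state $(\lambda_0,\omega_0)$, consider for $0\le k\le N-1$ the constraints $\hat\lambda(k+1)=\hat\lambda(k)+TD\hat\omega(k)$; $M_i(\hat\omega_i(k+1)-\hat\omega_i(k))/T=v_i(\hat\lambda(k),\hat\omega(k),\hat p(k))+\hat u_i(k)$; $\hat\lambda(0)=\sin\lambda_0$, $\hat\omega(0)=\omega_0$; $\hat u_i(k)=0$ for $i\notin\mathcal I^u$; $u_i^{\min}-\xi_i\beta_i(k)\le\hat u_i(k)\le u_i^{\max}+\xi_i\beta_i(k)$, $\beta_i(k)\ge0$ for $i\in\mathcal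 I^u$; and, for $i\in\mathcal I^\omega$, $1\le k\le N$, $\underline\omega_i-\kappa_i(\gamma_i(k)-\delta_i)\le\hat\omega_i(k)\le\bar\omega_i+\kappa_i(\gamma_i(k)-\delta_i)$, $\gamma_i(k)\ge0$, where $\kappa_i=0$ if $\omega_{0,i}\in[\underline\omega_i,\bar\omega_i]$ and $\xi_i=1$, and $\kappa_i=1$ otherwise. A *reference trajectory* satisfies these constraints and, for $i\in\mathcal I^u$, $k\le N-1$: $\hat\omega_i(k)\hat u_i(k)\le0$ if $\hat\omega_i(k)\notin(\underline\omega_i^{thr},\bar\omega_i^{thr})$, $\hat u_i(k)=0$ otherwise. The reference trajectory $(\hat\Lambda^{ref},\hat\Omega^{ref},\hat U^{ref})$ used here is the one generated by the feedback $\hat u_i^{ref}=0$ for $i\notin\mathcal I^\omega$ and, for $i\in\mathcal I^\omega$, $\hat u^{ref}_i=\mathrm{sat}(\hat u^a_i)$ (clipping to $[u_i^{\min},u_i^{\max}]$ if $\xi_i=0$, identity if $\xi_i=1$), where $$\hat u_i^a=\begin{cases}\min\{0,\ \bar\gamma_i(\bar\omega_i-\hat\omega_i)/(\hat\omega_i-\bar\omega_i^{thr})-v_i\}&\hat\omega_i>\bar\omega_i^{thr},\\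 \max\{0,\ \underline\gamma_i(\underline\omega_i-\hat\omega_i)/(\underline\omega_i^{thr}-\hat\omega_i)-v_i\}&\hat\omega_i<\underline\omega_i^{thr},\\0&\text{otherwise.}\end{cases}$$ $Q_{cvx}$ minimizes $\sum_{i\in\mathcal I^u}\sum_{k=0}^{N-1}(c_i\hat u_i(k)^2+d_i\beta_i(k)^2)+\sum_{i\in\mathcal I^\omega}\sum_{k=1}^Ne_i\gamma_i(k)^2$ subject to the displayed constraints and, for $i\in\mathcal I^u$, $k\le N-1$: $\hat\omega_i(k)\ge\bar\omega_i^{thr}$, $\hat u_i(k)\le0$ if $\hat\omega_i^{ref}(k)\ge\bar\omega_i^{thr}$; $\hat\omega_i(k)\le\underline\omega_i^{thr}$, $\hat u_i(k)\ge0$ if $\hat\omega_i^{ref}(k)\le\underline\omega_i^{thr}$; $\hat u_i(k)=0$ otherwise. **Distributed controller.** Let $\mathcal G_1,\dots,\mathcal G_d$ be induced subgraphs (regions) such that each $i\in\mathcal I^u$ lies in exactly one of them. At time $t$, region $\beta$ solves $Q_{cvx}$ for $\mathcal G_\beta$, with $\mathcal I^u\cap\mathcal I_\beta$, $\mathcal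 I^\omega\cap\mathcal I_\beta$, its own part of the state $(\lambda(t),\omega(t))$, and the forecast $\hat p_i(k)=p^{fcst}_{t,i}(t+kT)+f_{\beta,i}(t)$, where $f_{\beta,i}(t)$ is the current net power flow $\pm b_l\sin\lambda_l(t)$ into $i$ through the lines joining $\mathcal G_\beta$ to its complement. Then $u_i(t)$, $i\in\mathcal I^u$, is the $i$-th entry of the first column $\hat u^*(0)$ of the optimal input of the region containing $i$. **Claim.** For every $\rho$ there is $\bar T>0$ such that for all $0<T\le\bar T$: (0) The controller is well defined: at each $t\ge0$ with $|p^{fcst}_{t,i}(\tau)|\le\rho$ on $[t,t+\tilde t]$, and each state $(\lambda,\omega)$ with $|\omega_i|\le\rho$ that satisfies $v_i(\sin\lambda,\omega,p(t))+\hat u_i^{ref}(\sin\lambda,\omega,p(t))=0$ at all buses with $M_i=0$, in every region the generated reference trajectory exists, $Q_{cvx}$ has an optimal solution, and $\hat u^*(0)$ is unique. For every solution of the closed-loop system: (i) for $i\in\mathcal I^u$ and $t\ge0$, $u_i(t)=0$ if $\omega_i(t)\in(\underline\omega_i^{thr},\bar\omega_i^{thr})$; (ii) for $i\in\mathcal I^\omega$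 with $\xi_i=1$, if $\omega_i(0)\in[\underline\omega_i,\bar\omega_i]$, then $\omega_i(t)\in[\underline\omega_i,\bar\omega_i]$ for all $t\ge0$; here, if $\omega_i(0)$ is one of the two endpoints, the solution is assumed to be a pointwise limit on $[0,\infty)$ of closed-loop solutions whose $i$-th initial frequency lies in $(\underline\omega_i,\bar\omega_i)$ (as is the case when closed-loop solutions depend continuously on the initial state). Suppose moreover that $p(t)=p^*$ is constant; put $\omega^\infty=\sum_ip_i^*/\sum_iE_i$, $\tilde p=p^*-\omega^\infty E\mathbf 1$, $L=D^TY_bD$. Assume $\underline\omega_i^{thr}<\omega^\infty<\bar\omega_i^{thr}$ for $i\in\mathcal I^u$ and $\max_{(i,j)\in\mathcal E}|(L^\dagger\tilde p)_i-(L^\dagger\tilde p)_j|<1$, and let $(\lambda^\infty,\omega^\infty\mathbf 1)$, with $\lambda^\infty\in\mathrm{range}(D)$ and $|\lambda_l^\infty|<\pi/2$ for all $l$, be an equilibrium for $u\equiv0$. Let $$V(\lambda,\omega)=\tfrac12\sum_{M_i>0}M_i(\omega_i-\omega^\infty)^2+\sum_lb_l\big(\cos\lambda_l^\infty-\cos\lambda_l-\lambda_l\sin\lambda_l^\infty+\lambda_l^\infty\sin\lambda_l^\infty\big),$$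 $\Upsilon_{cl}=[-\pi/2,\pi/2]^m$ ($m$ the number of lines), $\Phi(r)=\{(\lambda,\omega):\lambda\in\Upsilon_{cl},\ V\le r\}$, and $\bar r=\min_{\partial\Upsilon_{cl}}V(\cdot,\omega^\infty\mathbf 1)$ ($+\infty$ if there are no lines). Then: (iii) $(\lambda^\infty,\omega^\infty\mathbf 1)$ is locally asymptotically stable for the closed-loop system; and for each closed-loop solution with $(\lambda(0),\omega(0))\in\Phi(r)$, $0\le r<\bar r$: $(\lambda(t),\omega(t))\in\Phi(r)$ for all $t\ge0$ and $(\lambda(t),\omega(t))\to(\lambda^\infty,\omega^\infty\mathbf 1)$; (iv) for these solutions and $i\in\mathcal I^u$ there is $t_1\ge 0$ with $u_i(t)=0$ for all $t\ge t_1$; (v) for these solutions and $i\in\mathcal I^\omega$ with $\xi_i=1$, if $\omega_i(0)\notin[\underline\omega_i,\bar\omega_i]$, there is a finite $t_1\ge0$ with $\omega_i(t)\in[\underline\omega_i,\bar\omega_i]$ for all $t\ge t_1$. -/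

import Mathlib

open Set Filter Topology MeasureTheory

noncomputable section

namespace PowerControl

/-- A power network: buses `V`, transmission lines `L`, each line with a positive end and a negative
end, inertia `M`, damping `E`, line susceptance `b`. Zero inertia is allowed. -/
structure PowerNetwork (V L : Type*) where
  pos : L → V
  neg : L → V
  pos_ne_neg : ∀ l, pos l ≠ neg l
  M : V → ℝ
  E : V → ℝ
  b : L → ℝ
  M_nonneg : ∀ i, 0 ≤ M i
  E_pos : ∀ i, 0 < E i
  b_pos : ∀ l, 0 < b l

/-- Controlled buses `Iu`, buses with a transient frequency requirement `Iω`, and all the design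
parameters of the controller: safe bounds, thresholds, type of the magnitude constraint (`ξ i = true`
is "soft", `ξ i = false` is "hard"), magnitude bounds, weights, and the gains `γlo`, `γhi`
of the controller that generates the reference trajectory. -/
structure ControlSpec (V : Type*) where
  Iu : Finset V
  Iω : Finset V
  ωlo : V → ℝ
  ωhi : V → ℝ
  thrLo : V → ℝ
  thrHi : V → ℝ
  ξ : V → Bool
  uMin : V → ℝ
  uMax : V → ℝ
  c : V → ℝ
  d : V → ℝ
  e : V → ℝ
  δ : V → ℝ
  γlo : V → ℝ
  γhi : V → ℝ
  Iω_subset : Iω ⊆ Iu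
  thr_sign : ∀ i ∈ Iu, thrLo i < 0 ∧ 0 < thrHi i
  safe_thr : ∀ i ∈ Iω, ωlo i < thrLo i ∧ thrHi i < ωhi i
  hard_bounds : ∀ i ∈ Iu, ξ i = false → uMin i ≤ 0 ∧ 0 ≤ uMax i
  weights_pos : ∀ i ∈ Iu, 0 < c i ∧ 0 < d i
  freq_weights_pos : ∀ i ∈ Iω, 0 < e i
  δ_bounds : ∀ i ∈ Iω, 0 < δ i ∧ δ i < ωhi i - ωlo i
  gains_pos : ∀ i ∈ Iω, 0 < γlo i ∧ 0 < γhi i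

/-- A discrete trajectory of states, inputs and slack variables. -/
structure Plan (V L : Type*) where
  Λ : ℕ → L → ℝ
  Ω : ℕ → V → ℝ
  U : ℕ → V → ℝ
  B : ℕ → V → ℝ
  Γ : ℕ → V → ℝ

section Network

variable {V L : Type*} [Fintype V] [DecidableEq V] [Fintype L] [DecidableEq L]

/-- The underlying undirected graph. -/
def PowerNetwork.graph (net : PowerNetwork V L) : SimpleGraph V :=
  SimpleGraph.fromRel (fun i j => ∃ l, net.pos l = i ∧ net.neg l = j)

/-- The incidence matrix. -/
def PowerNetwork.D (net : PowerNetwork V L) : Matrix L V ℝ :=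
  Matrix.of (fun l i => if i = net.pos l then 1 else if i = net.neg l then -1 else 0)

/-- The diagonal matrix of susceptances. -/
def PowerNetwork.Yb (net : PowerNetwork V L) : Matrix L L ℝ :=
  Matrix.diagonal net.b

/-- The Laplacian matrix of the network graph. -/
def PowerNetwork.laplacian (net : PowerNetwork V L) : Matrix V V ℝ :=
  net.D.transpose * net.Yb * net.D

/-- `-E ω - Dᵀ Y_b s + q`: right-hand side of the frequency dynamics without control, for `s` in the
place of `sin λ` and power injection `q`. -/
def PowerNetwork.residual (net : PowerNetwork V L) (s : L → ℝ) (w q : V → ℝ) (i : V) : ℝ :=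
  -(net.E i * w i) - (net.D.transpose.mulVec (net.Yb.mulVec s)) i + q i

/-- Componentwise sine. -/
def sinVec {L : Type*} (lam : L → ℝ) : L → ℝ := fun l => Real.sin (lam l)

/-- The vectors of angle differences, i.e. the column space of `D`. -/
def PowerNetwork.IsAngleDifference (net : PowerNetwork V L) (lam : L → ℝ) : Prop :=
  ∃ θ : V → ℝ, lam = net.D.mulVec θ

/-! The finite-horizon optimization problem -/

/-- The switch of the frequency constraint. -/
def ControlSpec.kappa (spec : ControlSpec V) (ω₀ : V → ℝ) (i : V) : ℝ :=
  if ω₀ i ∈ Icc (spec.ωlo i) (spec.ωhi i) ∧ spec.ξ i = true then 0 else 1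

/-- `ξ` as a number in `{0, 1}`. -/
def ControlSpec.xi (spec : ControlSpec V) (i : V) : ℝ := if spec.ξ i = true then 1 else 0

/-- The constraints shared by the non-convex and the convexified discrete problem: dynamics
(`N` steps of length `T`, forecast `P`, linear in `λ`), initial condition `(sin λ₀, ω₀)`,
availability of control, magnitude constraints, and frequency constraints. -/
structure Admissible (net : PowerNetwork V L) (spec : ControlSpec V) (T : ℝ) (N : ℕ)
    (P : ℕ → V → ℝ) (lam₀ : L → ℝ) (ω₀ : V → ℝ) (z : Plan V L) : Prop where
  angle : ∀ k < N, z.Λ (k + 1) = z.Λ k + T • net.D.mulVec (z.Ω k)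
  freq : ∀ k < N, ∀ i, net.M i * (z.Ω (k + 1) i - z.Ω k i) / T
    = net.residual (z.Λ k) (z.Ω k) (P k) i + z.U k i
  init_angle : z.Λ 0 = sinVec lam₀
  init_freq : z.Ω 0 = ω₀
  available : ∀ k < N, ∀ i ∉ spec.Iu, z.U k i = 0
  magnitude : ∀ i ∈ spec.Iu, ∀ k < N,
    spec.uMin i - spec.xi i * z.B k i ≤ z.U k i ∧ z.U k i ≤ spec.uMax i + spec.xi i * z.B k i
  slack_B : ∀ i ∈ spec.Iu, ∀ k < N, 0 ≤ z.B k i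
  safe : ∀ i ∈ spec.Iω, ∀ k ∈ Finset.Icc 1 N,
    spec.ωlo i - spec.kappa ω₀ i * (z.Γ k i - spec.δ i) ≤ z.Ω k i ∧
      z.Ω k i ≤ spec.ωhi i + spec.kappa ω₀ i * (z.Γ k i - spec.δ i)
  slack_Γ : ∀ i ∈ spec.Iω, ∀ k ∈ Finset.Icc 1 N, 0 ≤ z.Γ k i

/-- The non-convex stability constraint. -/
def PhiDisc (spec : ControlSpec V) (N : ℕ) (Ω U : ℕ → V → ℝ) : Prop :=
  ∀ i ∈ spec.Iu, ∀ k < N,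
    (Ω k i ∉ Ioo (spec.thrLo i) (spec.thrHi i) → Ω k i * U k i ≤ 0) ∧
    (Ω k i ∈ Ioo (spec.thrLo i) (spec.thrHi i) → U k i = 0)

/-- The convexified stability constraint, relative to the reference frequencies `Ωr`. -/
def PhiCvx (spec : ControlSpec V) (N : ℕ) (Ωr Ω U : ℕ → V → ℝ) : Prop :=
  ∀ i ∈ spec.Iu, ∀ k < N,
    (spec.thrHi i ≤ Ωr k i → spec.thrHi i ≤ Ω k i ∧ U k i ≤ 0) ∧
    (Ωr k i ≤ spec.thrLo i → Ω k i ≤ spec.thrLo i ∧ 0 ≤ U k i) ∧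
    (spec.thrLo i < Ωr k i ∧ Ωr k i < spec.thrHi i → U k i = 0)

/-- The objective function. -/
def cost (spec : ControlSpec V) (N : ℕ) (z : Plan V L) : ℝ :=
  (∑ i ∈ spec.Iu, ∑ k ∈ Finset.range N, (spec.c i * z.U k i ^ 2 + spec.d i * z.B k i ^ 2))
    + ∑ i ∈ spec.Iω, ∑ k ∈ Finset.Icc 1 N, spec.e i * z.Γ k i ^ 2

/-- A reference trajectory: it satisfies, with some slack variables, all the constraints of the
non-convex discrete problem. -/
def IsReferenceTrajectory (net : PowerNetwork V L) (spec : ControlSpec V) (T : ℝ) (N : ℕ)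
    (P : ℕ → V → ℝ) (lam₀ : L → ℝ) (ω₀ : V → ℝ) (Λr : ℕ → L → ℝ) (Ωr Ur : ℕ → V → ℝ) : Prop :=
  ∃ B Γ : ℕ → V → ℝ, Admissible net spec T N P lam₀ ω₀ ⟨Λr, Ωr, Ur, B, Γ⟩ ∧ PhiDisc spec N Ωr Ur

/-- Saturation; active for hard magnitude constraints only. -/
def sat (a : ℝ) (soft : Bool) (aMin aMax : ℝ) : ℝ :=
  if soft = false ∧ a ≤ aMin then aMin else if soft = false ∧ aMax ≤ a then aMax else a

/-- The feedback that generates the reference trajectory, before saturation, as a function of the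
frequency `w` and of the uncontrolled right-hand side `v` at bus `i`. -/
def ControlSpec.rawRef (spec : ControlSpec V) (i : V) (w v : ℝ) : ℝ :=
  if spec.thrHi i < w then
    min 0 (spec.γhi i * (spec.ωhi i - w) / (w - spec.thrHi i) - v)
  else if w < spec.thrLo i then
    max 0 (spec.γlo i * (spec.ωlo i - w) / (spec.thrLo i - w) - v)
  else 0

/-- The reference input at state `(s, w)` with power injection `q`. -/
def refInput (net : PowerNetwork V L) (spec : ControlSpec V) (s : L → ℝ) (w q : V → ℝ) (i : V) : ℝ :=
  if i ∈ spec.Iω then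
    sat (spec.rawRef i (w i) (net.residual s w q i)) (spec.ξ i) (spec.uMin i) (spec.uMax i)
  else 0

/-- `(Λr, Ωr, Ur)` is a reference trajectory whose input is generated by `refInput`. -/
def IsGeneratedReference (net : PowerNetwork V L) (spec : ControlSpec V) (T : ℝ) (N : ℕ)
    (P : ℕ → V → ℝ) (lam₀ : L → ℝ) (ω₀ : V → ℝ) (Λr : ℕ → L → ℝ) (Ωr Ur : ℕ → V → ℝ) : Prop :=
  IsReferenceTrajectory net spec T N P lam₀ ω₀ Λr Ωr Ur ∧
    ∀ k < N, Ur k = refInput net spec (Λr k) (Ωr k) (P k)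

/-- `z` is feasible for the convexified problem `Q_cvx` with reference frequencies `Ωr`. -/
def FeasibleCvx (net : PowerNetwork V L) (spec : ControlSpec V) (T : ℝ) (N : ℕ)
    (P : ℕ → V → ℝ) (lam₀ : L → ℝ) (ω₀ : V → ℝ) (Ωr : ℕ → V → ℝ) (z : Plan V L) : Prop :=
  Admissible net spec T N P lam₀ ω₀ z ∧ PhiCvx spec N Ωr z.Ω z.U

/-- `z` is an optimal solution of the convexified problem `Q_cvx`. -/
def OptimalCvx (net : PowerNetwork V L) (spec : ControlSpec V) (T : ℝ) (N : ℕ)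
    (P : ℕ → V → ℝ) (lam₀ : L → ℝ) (ω₀ : V → ℝ) (Ωr : ℕ → V → ℝ) (z : Plan V L) : Prop :=
  FeasibleCvx net spec T N P lam₀ ω₀ Ωr z ∧
    ∀ z', FeasibleCvx net spec T N P lam₀ ω₀ Ωr z' → cost spec N z ≤ cost spec N z'

/-- `u₀` is the first column of the optimal input of `Q_cvx`, convexified along the generated
reference trajectory. -/
def IsFirstInput (net : PowerNetwork V L) (spec : ControlSpec V) (T : ℝ) (N : ℕ)
    (P : ℕ → V → ℝ) (lam₀ : L → ℝ) (ω₀ : V → ℝ) (u₀ : V → ℝ) : Prop :=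
  ∃ (Λr : ℕ → L → ℝ) (Ωr Ur : ℕ → V → ℝ), IsGeneratedReference net spec T N P lam₀ ω₀ Λr Ωr Ur ∧
    ∃ z : Plan V L, OptimalCvx net spec T N P lam₀ ω₀ Ωr z ∧ u₀ = z.U 0

/-! Regions -/

/-- The subnetwork induced by a set of buses. -/
def PowerNetwork.induce (net : PowerNetwork V L) (S : Finset V) :
    PowerNetwork {i // i ∈ S} {l // net.pos l ∈ S ∧ net.neg l ∈ S} where
  pos l := ⟨net.pos l.1, l.2.1⟩
  neg l := ⟨net.neg l.1, l.2.2⟩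
  pos_ne_neg l h := net.pos_ne_neg l.1 (congrArg Subtype.val h)
  M i := net.M i.1
  E i := net.E i.1
  b l := net.b l.1
  M_nonneg i := net.M_nonneg i.1
  E_pos i := net.E_pos i.1
  b_pos l := net.b_pos l.1

/-- The restriction of the control data to a set of buses. -/
def ControlSpec.restrict (spec : ControlSpec V) (S : Finset V) : ControlSpec {i // i ∈ S} where
  Iu := spec.Iu.subtype (fun i => i ∈ S)
  Iω := spec.Iω.subtype (fun i => i ∈ S)
  ωlo i := spec.ωlo i.1
  ωhi i := spec.ωhi i.1
  thrLo i := spec.thrLo i.1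
  thrHi i := spec.thrHi i.1
  ξ i := spec.ξ i.1
  uMin i := spec.uMin i.1
  uMax i := spec.uMax i.1
  c i := spec.c i.1
  d i := spec.d i.1
  e i := spec.e i.1
  δ i := spec.δ i.1
  γlo i := spec.γlo i.1
  γhi i := spec.γhi i.1
  Iω_subset _ hi := Finset.mem_subtype.2 (spec.Iω_subset (Finset.mem_subtype.1 hi))
  thr_sign i hi := spec.thr_sign i.1 (Finset.mem_subtype.1 hi)
  safe_thr i hi := spec.safe_thr i.1 (Finset.mem_subtype.1 hi)
  hard_bounds i hi := spec.hard_bounds i.1 (Finset.mem_subtype.1 hi)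
  weights_pos i hi := spec.weights_pos i.1 (Finset.mem_subtype.1 hi)
  freq_weights_pos i hi := spec.freq_weights_pos i.1 (Finset.mem_subtype.1 hi)
  δ_bounds i hi := spec.δ_bounds i.1 (Finset.mem_subtype.1 hi)
  gains_pos i hi := spec.gains_pos i.1 (Finset.mem_subtype.1 hi)

/-- The power flowing into bus `i` of the region `S` through the lines that connect `S` with the
rest of the network. -/
def PowerNetwork.boundaryFlow (net : PowerNetwork V L) (S : Finset V) (lam : L → ℝ) (i : V) : ℝ :=
  (∑ l with net.neg l = i ∧ net.pos l ∉ S, net.b l * Real.sin (lam l))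
    - ∑ l with net.pos l = i ∧ net.neg l ∉ S, net.b l * Real.sin (lam l)

/-- The discretized overall forecast of a region at time `t`: the boundary flows are frozen at their
current value. Here `fc t τ i` is the injection at bus `i` at time `τ` as forecast at time `t`. -/
def regionForecast (net : PowerNetwork V L) (S : Finset V) (fc : ℝ → ℝ → V → ℝ) (T t : ℝ)
    (lam : L → ℝ) : ℕ → {i // i ∈ S} → ℝ :=
  fun k i => net.boundaryFlow S lam i.1 + fc t (t + k * T) i.1

/-- `u₀` is the input computed by the region `S` at time `t` in the state `(lam, w)`, with
prediction horizon `h` and sampling length `T`. -/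
def IsRegionInput (net : PowerNetwork V L) (spec : ControlSpec V) (fc : ℝ → ℝ → V → ℝ) (h T : ℝ)
    (S : Finset V) (t : ℝ) (lam : L → ℝ) (w : V → ℝ) (u₀ : {i // i ∈ S} → ℝ) : Prop :=
  IsFirstInput (net.induce S) (spec.restrict S) T ⌈h / T⌉₊ (regionForecast net S fc T t lam)
    (fun l => lam l.1) (fun i => w i.1) u₀

/-- The state satisfies the algebraic equations at the buses without inertia. -/
def IsConsistent (net : PowerNetwork V L) (spec : ControlSpec V) (q : V → ℝ)
    (lam : L → ℝ) (w : V → ℝ) : Prop :=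
  ∀ i, net.M i = 0 →
    net.residual (sinVec lam) w q i + refInput net spec (sinVec lam) w q i = 0

/-- `(lam, om, u)` is a solution on `[0, ∞)` of the swing equations in closed loop with the
distributed controller of the regions `R`. The differential equations hold in integrated form, the
algebraic equations at buses without inertia hold at all times. -/
structure IsClosedLoop (net : PowerNetwork V L) (spec : ControlSpec V) {d : ℕ}
    (R : Fin d → Finset V) (p : ℝ → V → ℝ) (fc : ℝ → ℝ → V → ℝ) (h T : ℝ)
    (lam : ℝ → L → ℝ) (om u : ℝ → V → ℝ) : Prop where
  init : net.IsAngleDifference (lam 0)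
  angle : ∀ l, ∀ t, 0 ≤ t →
    IntervalIntegrable (fun s => (net.D.mulVec (om s)) l) volume 0 t ∧
      lam t l = lam 0 l + ∫ s in (0 : ℝ)..t, (net.D.mulVec (om s)) l
  freq : ∀ i, 0 < net.M i → ∀ t, 0 ≤ t →
    IntervalIntegrable (fun s => net.residual (sinVec (lam s)) (om s) (p s) i + u s i) volume 0 t ∧
      net.M i * om t i = net.M i * om 0 i
        + ∫ s in (0 : ℝ)..t, (net.residual (sinVec (lam s)) (om s) (p s) i + u s i)
  algebraic : ∀ i, net.M i = 0 → ∀ t, 0 ≤ t →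
    net.residual (sinVec (lam t)) (om t) (p t) i + u t i = 0
  uncontrolled : ∀ t, 0 ≤ t → ∀ i ∉ spec.Iu, u t i = 0
  feedback : ∀ t, 0 ≤ t → ∀ β, ∃ u₀, IsRegionInput net spec fc h T (R β) t (lam t) (om t) u₀ ∧
    ∀ i (hi : i ∈ R β), i ∈ spec.Iu → u t i = u₀ ⟨i, hi⟩

/-! Equilibrium, energy function, stability -/

/-- The synchronous frequency for the constant injection `q`. -/
def PowerNetwork.syncFreq (net : PowerNetwork V L) (q : V → ℝ) : ℝ :=
  (∑ i, q i) / ∑ i, net.E i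

/-- The four Penrose equations: `X` is the Moore-Penrose pseudoinverse of `A`. -/
def IsMoorePenrose (A X : Matrix V V ℝ) : Prop :=
  A * X * A = A ∧ X * A * X = X ∧ (A * X).transpose = A * X ∧ (X * A).transpose = X * A

/-- Largest difference of the entries of `z` across a line. -/
def PowerNetwork.edgeNorm (net : PowerNetwork V L) (z : V → ℝ) : ℝ :=
  ⨆ l : L, |z (net.pos l) - z (net.neg l)|

/-- The open cube of angle differences below `π / 2`. -/
def Upsilon (L : Type*) : Set (L → ℝ) := {lam | ∀ l, |lam l| < Real.pi / 2}

/-- `(laminf, ω^∞ 1)` with `laminf` in the open cube is an equilibrium of the uncontrolled swing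
equations with constant injection `q`. -/
def PowerNetwork.IsEquilibrium (net : PowerNetwork V L) (q : V → ℝ) (laminf : L → ℝ) : Prop :=
  net.IsAngleDifference laminf ∧ laminf ∈ Upsilon L ∧
    ∀ i, net.residual (sinVec laminf) (fun _ => net.syncFreq q) q i = 0

/-- The energy function; it depends on `w` only through the buses with positive inertia. -/
def PowerNetwork.energy (net : PowerNetwork V L) (q : V → ℝ) (laminf : L → ℝ)
    (lam : L → ℝ) (w : V → ℝ) : ℝ :=
  (1 / 2) * (∑ i with 0 < net.M i, net.M i * (w i - net.syncFreq q) ^ 2)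
    + ∑ l, net.b l * (Real.cos (laminf l) - Real.cos (lam l) - lam l * Real.sin (laminf l)
        + laminf l * Real.sin (laminf l))

/-- The minimum of the energy over the boundary of the cube (`⊤` if there are no lines). -/
def PowerNetwork.rbar (net : PowerNetwork V L) (q : V → ℝ) (laminf : L → ℝ) : EReal :=
  ⨅ lam ∈ frontier (closure (Upsilon L)),
    ((net.energy q laminf lam (fun _ => net.syncFreq q) : ℝ) : EReal)

/-- The sublevel region `Φ(r)`. -/
def PowerNetwork.Phi (net : PowerNetwork V L) (q : V → ℝ) (laminf : L → ℝ) (r : ℝ) :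
    Set ((L → ℝ) × (V → ℝ)) :=
  {x | x.1 ∈ closure (Upsilon L) ∧ net.energy q laminf x.1 x.2 ≤ r}

/-- Local asymptotic stability (stability and local attractivity) of the point `x` for a family of
trajectories `traj`. -/
def IsLocallyAsymptoticallyStable {X : Type*} [PseudoMetricSpace X] (traj : (ℝ → X) → Prop)
    (x : X) : Prop :=
  (∀ ε > 0, ∃ η > 0, ∀ y, traj y → dist (y 0) x < η → ∀ t, 0 ≤ t → dist (y t) x < ε) ∧
    ∃ η > 0, ∀ y, traj y → dist (y 0) x < η → Tendsto y atTop (𝓝 x)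

/-- The state trajectory `y` is a pointwise limit of closed-loop state trajectories whose
frequency at bus `i` starts in the open safe interval. -/
def IsLimitFromInside (spec : ControlSpec V) (traj : (ℝ → (L → ℝ) × (V → ℝ)) → Prop) (i : V)
    (y : ℝ → (L → ℝ) × (V → ℝ)) : Prop :=
  ∃ Y : ℕ → ℝ → (L → ℝ) × (V → ℝ),
    (∀ n, traj (Y n) ∧ (Y n 0).2 i ∈ Ioo (spec.ωlo i) (spec.ωhi i)) ∧
      ∀ t, 0 ≤ t → Tendsto (fun n => Y n t) atTop (𝓝 (y t))

/-- The state trajectories of the closed loop. -/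
def closedLoopStates (net : PowerNetwork V L) (spec : ControlSpec V) {d : ℕ}
    (R : Fin d → Finset V) (p : ℝ → V → ℝ) (fc : ℝ → ℝ → V → ℝ) (h T : ℝ)
    (y : ℝ → (L → ℝ) × (V → ℝ)) : Prop :=
  ∃ u : ℝ → V → ℝ, IsClosedLoop net spec R p fc h T (fun t => (y t).1) (fun t => (y t).2) u

end Network

end PowerControl

end

/-! Well-posedness. Write the power balance at a bus as `-(E w) + a + u`, with `u` the reference
feedback. It is strictly decreasing in the frequency `w`, so at a bus without inertia it has exactly
one root, given in closed form by `balance` as a clamped version of `a / E`. The reference feedback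
can therefore be stepped forward in time although the network is differential-algebraic. Its rates
grow at most linearly in the state, so a discrete Gronwall estimate bounds them on the whole horizon
by a constant that does not depend on the sampling length. Once `T` is small against this constant
and the gains, an Euler step from the safe interval of a soft bus cannot leave it. The feedback then
generates a reference trajectory (`eventually_isGeneratedReference`), which is itself feasible for
the problem convexified around it. That problem has affine constraints and a cost that is coercive
in inputs and slacks and strictly convex in the inputs; this gives existence and uniqueness of the
first input (`existsUnique_isFirstInput`). Freezing the boundary flows of a region makes its power
balance at the current instant equal to that of the full network, so everything transfers to
regions.

Safety. Inside the safe interval of a soft bus the frequency constraint at the first predicted step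
has no slack. It says that the rate of `ω` is at most `(ωhi - ω) / T`, and symmetrically below.
Hence the distance to either endpoint decays at most exponentially and never vanishes
(`IsClosedLoop.mem_Ioo`); endpoint data are reached by limits. At buses without inertia the closed
loop forces the frequency to be the value of `balance`, which is safe by construction.

Stability. The sign constraints and the position of `ω^∞` inside the threshold bands make `u_i (ω_i
- ω^∞)` nonpositive, so the energy decreases at least at the rate `∑ E_i (ω_i - ω^∞)²`
(`energy_add_le`). A trajectory of energy below `rbar` cannot cross the boundary of the cube
(`mem_Phi`). Convergence needs no regularity of `u`: the squared deviations are integrable and have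
one-sided linear growth, since the input term can be dropped, so the frequencies synchronize
(`tendsto_om`). Then the inputs vanish, a perturbed Barbalat argument shows that the flow mismatch
tends to zero, and strict monotonicity of the sine on the cube identifies the equilibrium as the
only cluster point of the angles (`tendsto_lam`). -/

set_option linter.unusedSectionVars false

noncomputable section

namespace PowerControl

/-! ### The reference feedback and the power balance at a single bus. -/

section Scalar

variable {V : Type*}

/-- The reference input at a single bus, as a function of its frequency `w` and of the uncontrolled
right-hand side `v`. -/
def ControlSpec.localRef (spec : ControlSpec V) [DecidableEq V] (i : V) (w v : ℝ) : ℝ :=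
  if i ∈ spec.Iω then sat (spec.rawRef i w v) (spec.ξ i) (spec.uMin i) (spec.uMax i) else 0

/-- The frequency at which the reference input balances the power mismatch `a - E w`. -/
def ControlSpec.balance (spec : ControlSpec V) [DecidableEq V] (E : ℝ) (i : V) (a : ℝ) : ℝ :=
  if i ∈ spec.Iω then
    if spec.ξ i = true then max (spec.ωlo i) (min (spec.ωhi i) (a / E))
    else max ((a + spec.uMin i) / E)
      (min ((a + spec.uMax i) / E) (max (spec.ωlo i) (min (spec.ωhi i) (a / E))))
  else a / E

lemma sat_soft (a m M : ℝ) : sat a true m M = a := by simp [sat]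

lemma sat_hard {a m M : ℝ} (h : m ≤ 0 ∧ 0 ≤ M) : sat a false m M = max m (min M a) := by
  unfold sat
  simp only [true_and]
  split_ifs with h1 h2
  · rw [max_eq_left]; exact (min_le_right _ _).trans h1
  · rw [min_eq_left h2, max_eq_right]; linarith
  · push Not at h1 h2
    rw [min_eq_right h2.le, max_eq_right h1.le]

variable (spec : ControlSpec V) {i : V}

lemma rawRef_upper {w : ℝ} (h : spec.thrHi i < w) (v : ℝ) :
    spec.rawRef i w v = min 0 (spec.γhi i * (spec.ωhi i - w) / (w - spec.thrHi i) - v) := by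
  simp [ControlSpec.rawRef, h]

lemma rawRef_lower (hi : i ∈ spec.Iu) {w : ℝ} (h : w < spec.thrLo i) (v : ℝ) :
    spec.rawRef i w v = max 0 (spec.γlo i * (spec.ωlo i - w) / (spec.thrLo i - w) - v) := by
  have := spec.thr_sign i hi
  simp [ControlSpec.rawRef, h, not_lt.2 (show w ≤ spec.thrHi i by linarith)]

lemma rawRef_middle {w : ℝ} (h : spec.thrLo i ≤ w) (h' : w ≤ spec.thrHi i) (v : ℝ) :
    spec.rawRef i w v = 0 := by
  simp [ControlSpec.rawRef, not_lt.2 h, not_lt.2 h']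

/-- The quotient equals `-1 + (ωhi - thrHi) / (w - thrHi)`: the barrier term blows up at the
threshold, but stays above `-γhi` however far the frequency overshoots. This bounds the pull of the
feedback at arbitrary frequencies. -/
lemma upper_gain (hi : i ∈ spec.Iω) {w : ℝ} (h : spec.thrHi i < w) :
    -spec.γhi i ≤ spec.γhi i * (spec.ωhi i - w) / (w - spec.thrHi i) := by
  have := spec.safe_thr i hi
  have := spec.gains_pos i hi
  rw [le_div_iff₀ (by linarith)]
  nlinarith

lemma lower_gain (hi : i ∈ spec.Iω) {w : ℝ} (h : w < spec.thrLo i) :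
    spec.γlo i * (spec.ωlo i - w) / (spec.thrLo i - w) ≤ spec.γlo i := by
  have := spec.safe_thr i hi
  have := spec.gains_pos i hi
  rw [div_le_iff₀ (by linarith)]
  nlinarith

variable [DecidableEq V]

lemma localRef_of_notMem (hi : i ∉ spec.Iω) (w v : ℝ) : spec.localRef i w v = 0 := by
  simp [ControlSpec.localRef, hi]

lemma localRef_soft (hi : i ∈ spec.Iω) (hs : spec.ξ i = true) (w v : ℝ) :
    spec.localRef i w v = spec.rawRef i w v := by
  simp [ControlSpec.localRef, hi, hs, sat_soft]

lemma localRef_hard (hi : i ∈ spec.Iω) (hs : spec.ξ i = false) (w v : ℝ) :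
    spec.localRef i w v = max (spec.uMin i) (min (spec.uMax i) (spec.rawRef i w v)) := by
  simp [ControlSpec.localRef, hi, hs, sat_hard (spec.hard_bounds i (spec.Iω_subset hi) hs)]

lemma localRef_middle (hi : i ∈ spec.Iu) {w : ℝ} (h : spec.thrLo i ≤ w) (h' : w ≤ spec.thrHi i)
    (v : ℝ) : spec.localRef i w v = 0 := by
  by_cases hω : i ∈ spec.Iω
  · cases hs : spec.ξ i
    · have := spec.hard_bounds i hi hs
      rw [localRef_hard spec hω hs, rawRef_middle spec h h', min_eq_right this.2,
        max_eq_right this.1]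
    · rw [localRef_soft spec hω hs, rawRef_middle spec h h']
  · exact localRef_of_notMem spec hω w v

lemma localRef_nonpos (hi : i ∈ spec.Iu) {w : ℝ} (h : spec.thrLo i ≤ w) (v : ℝ) :
    spec.localRef i w v ≤ 0 := by
  rcases le_or_gt w (spec.thrHi i) with h' | h'
  · exact (localRef_middle spec hi h h' v).le
  by_cases hω : i ∈ spec.Iω
  · cases hs : spec.ξ i
    · have := spec.hard_bounds i hi hs
      rw [localRef_hard spec hω hs, rawRef_upper spec h']
      exact max_le this.1 ((min_le_right _ _).trans (min_le_left _ _))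
    · rw [localRef_soft spec hω hs, rawRef_upper spec h']
      exact min_le_left _ _
  · exact (localRef_of_notMem spec hω w v).le

lemma localRef_nonneg (hi : i ∈ spec.Iu) {w : ℝ} (h : w ≤ spec.thrHi i) (v : ℝ) :
    0 ≤ spec.localRef i w v := by
  rcases le_or_gt (spec.thrLo i) w with h' | h'
  · exact (localRef_middle spec hi h' h v).ge
  by_cases hω : i ∈ spec.Iω
  · cases hs : spec.ξ i
    · have := spec.hard_bounds i hi hs
      rw [localRef_hard spec hω hs, rawRef_lower spec hi h']
      exact le_max_of_le_right (le_min this.2 (le_max_left _ _))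
    · rw [localRef_soft spec hω hs, rawRef_lower spec hi h']
      exact le_max_left _ _
  · exact (localRef_of_notMem spec hω w v).ge

lemma localRef_mem_hard (hi : i ∈ spec.Iu) (hs : spec.ξ i = false) (w v : ℝ) :
    spec.uMin i ≤ spec.localRef i w v ∧ spec.localRef i w v ≤ spec.uMax i := by
  have := spec.hard_bounds i hi hs
  by_cases hω : i ∈ spec.Iω
  · rw [localRef_hard spec hω hs]
    exact ⟨le_max_left _ _, max_le (this.1.trans this.2) (min_le_left _ _)⟩
  · rw [localRef_of_notMem spec hω w v]
    exact this

/-- The reference input never more than cancels the mismatch, up to the gains. -/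
lemma abs_add_localRef_le (w v : ℝ) :
    |v + spec.localRef i w v| ≤ |v| + (|spec.γlo i| + |spec.γhi i|) := by
  by_cases hω : i ∈ spec.Iω
  swap
  · rw [localRef_of_notMem spec hω]
    have := abs_nonneg (spec.γlo i)
    have := abs_nonneg (spec.γhi i)
    rw [add_zero]; linarith
  have hu := spec.Iω_subset hω
  have hg := spec.gains_pos i hω
  rw [abs_of_pos hg.1, abs_of_pos hg.2]
  have h1 := neg_abs_le v
  have h2 := le_abs_self v
  rcases lt_or_ge (spec.thrHi i) w with h | h
  · have hle := localRef_nonpos spec hu (w := w) (by have := spec.thr_sign i hu; linarith) v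
    have hge : -|v| - spec.γhi i ≤ v + spec.localRef i w v := by
      have hφ := upper_gain spec hω h
      have hr : -|v| - spec.γhi i - v ≤ spec.rawRef i w v := by
        rw [rawRef_upper spec h]
        exact le_min (by linarith) (by linarith [abs_nonneg v])
      cases hs : spec.ξ i
      · have hb := spec.hard_bounds i hu hs
        rw [localRef_hard spec hω hs]
        have := le_max_right (spec.uMin i) (min (spec.uMax i) (spec.rawRef i w v))
        -- The lower bound is nonpositive, hence below `uMax`: clipping from above respects it, and
        -- clipping from below only raises the input.
        have := le_min (a := spec.uMax i) (c := -|v| - spec.γhi i - v) (by linarith) hr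
        linarith
      · rw [localRef_soft spec hω hs]; linarith
    rw [abs_le]; constructor <;> linarith
  rcases lt_or_ge w (spec.thrLo i) with h' | h'
  · have hle := localRef_nonneg spec hu h v
    have hge : v + spec.localRef i w v ≤ |v| + spec.γlo i := by
      have hφ := lower_gain spec hω h'
      have hr : spec.rawRef i w v ≤ |v| + spec.γlo i - v := by
        rw [rawRef_lower spec hu h']
        exact max_le (by linarith) (by linarith [abs_nonneg v])
      cases hs : spec.ξ i
      · have hb := spec.hard_bounds i hu hs
        rw [localRef_hard spec hω hs]
        have := min_le_right (spec.uMax i) (spec.rawRef i w v)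
        have := max_le (a := spec.uMin i) (c := |v| + spec.γlo i - v) (by linarith)
          (this.trans hr)
        linarith
      · rw [localRef_soft spec hω hs]; linarith
    rw [abs_le]; constructor <;> linarith
  · rw [localRef_middle spec hu h' h, add_zero]; linarith

/-- With a soft magnitude constraint and a short step, an explicit Euler step of the reference
feedback stays below the safe upper bound. -/
lemma step_le_ωhi (hi : i ∈ spec.Iω) (hs : spec.ξ i = true) {w v K τ : ℝ} (hτ : 0 ≤ τ)
    (hw : spec.ωlo i ≤ w) (hw' : w ≤ spec.ωhi i) (hv : |v| ≤ K)
    (h1 : 2 * (τ * K) ≤ spec.ωhi i - spec.thrHi i)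
    (h2 : 2 * (τ * spec.γhi i) ≤ spec.ωhi i - spec.thrHi i) :
    w + τ * (v + spec.localRef i w v) ≤ spec.ωhi i := by
  have hu := spec.Iω_subset hi
  have hg := spec.gains_pos i hi
  have hst := spec.safe_thr i hi
  have hts := spec.thr_sign i hu
  have h3 := (le_abs_self v).trans hv
  have hK : 0 ≤ K := (abs_nonneg v).trans hv
  have h4 : τ * v ≤ τ * K := mul_le_mul_of_nonneg_left h3 hτ
  rw [localRef_soft spec hi hs]
  rcases lt_or_ge (spec.thrHi i) w with h | h
  · rw [rawRef_upper spec h]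
    set φ := spec.γhi i * (spec.ωhi i - w) / (w - spec.thrHi i) with hφ
    have e1 := min_le_left 0 (φ - v)
    have e2 := min_le_right 0 (φ - v)
    -- Split at the midpoint between threshold and safe bound. Below it, a step of size at most `τ
    -- K`, half the gap, cannot reach `ωhi`. Above it, `w - thrHi` is at least half the gap, hence
    -- at least `τ γhi`, and the barrier term limits the step to the remaining distance `ωhi - w`.
    rcases le_or_gt (2 * w) (spec.ωhi i + spec.thrHi i) with hm | hm
    · have : τ * (v + min 0 (φ - v)) ≤ τ * v := mul_le_mul_of_nonneg_left (by linarith) hτ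
      linarith
    · have : τ * (v + min 0 (φ - v)) ≤ τ * φ := mul_le_mul_of_nonneg_left (by linarith) hτ
      have : τ * φ ≤ spec.ωhi i - w := by
        rw [hφ, ← mul_div_assoc, div_le_iff₀ (by linarith)]
        nlinarith [mul_le_mul_of_nonneg_right (show τ * spec.γhi i ≤ w - spec.thrHi i by linarith)
          (show 0 ≤ spec.ωhi i - w by linarith)]
      linarith
  · rcases lt_or_ge w (spec.thrLo i) with h' | h'
    · rw [rawRef_lower spec hu h']
      have hφ : spec.γlo i * (spec.ωlo i - w) / (spec.thrLo i - w) ≤ 0 :=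
        div_nonpos_of_nonpos_of_nonneg (mul_nonpos_of_nonneg_of_nonpos hg.1.le (by linarith))
          (by linarith)
      have : v + max 0 (spec.γlo i * (spec.ωlo i - w) / (spec.thrLo i - w) - v) ≤ K := by
        have := neg_abs_le v
        rcases max_cases 0 (spec.γlo i * (spec.ωlo i - w) / (spec.thrLo i - w) - v) with h | h <;>
          linarith
      have := mul_le_mul_of_nonneg_left this hτ
      linarith
    · rw [rawRef_middle spec h' h, add_zero]
      linarith

lemma ωlo_le_step (hi : i ∈ spec.Iω) (hs : spec.ξ i = true) {w v K τ : ℝ} (hτ : 0 ≤ τ)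
    (hw : spec.ωlo i ≤ w) (hw' : w ≤ spec.ωhi i) (hv : |v| ≤ K)
    (h1 : 2 * (τ * K) ≤ spec.thrLo i - spec.ωlo i)
    (h2 : 2 * (τ * spec.γlo i) ≤ spec.thrLo i - spec.ωlo i) :
    spec.ωlo i ≤ w + τ * (v + spec.localRef i w v) := by
  have hu := spec.Iω_subset hi
  have hg := spec.gains_pos i hi
  have hst := spec.safe_thr i hi
  have hts := spec.thr_sign i hu
  have h3 : -K ≤ v := (abs_le.1 hv).1
  have hK : 0 ≤ K := (abs_nonneg v).trans hv
  have h4 : τ * -K ≤ τ * v := mul_le_mul_of_nonneg_left h3 hτ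
  rw [localRef_soft spec hi hs]
  rcases lt_or_ge w (spec.thrLo i) with h | h
  · rw [rawRef_lower spec hu h]
    set φ := spec.γlo i * (spec.ωlo i - w) / (spec.thrLo i - w) with hφ
    have e1 := le_max_left 0 (φ - v)
    have e2 := le_max_right 0 (φ - v)
    rcases le_or_gt (spec.ωlo i + spec.thrLo i) (2 * w) with hm | hm
    · have : τ * v ≤ τ * (v + max 0 (φ - v)) := mul_le_mul_of_nonneg_left (by linarith) hτ
      linarith
    · have : τ * φ ≤ τ * (v + max 0 (φ - v)) := mul_le_mul_of_nonneg_left (by linarith) hτ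
      have : spec.ωlo i - w ≤ τ * φ := by
        rw [hφ, ← mul_div_assoc, le_div_iff₀ (by linarith)]
        nlinarith [mul_le_mul_of_nonneg_right (show τ * spec.γlo i ≤ spec.thrLo i - w by linarith)
          (show 0 ≤ w - spec.ωlo i by linarith)]
      linarith
  · rcases lt_or_ge (spec.thrHi i) w with h' | h'
    · rw [rawRef_upper spec h']
      have hφ : 0 ≤ spec.γhi i * (spec.ωhi i - w) / (w - spec.thrHi i) :=
        div_nonneg (mul_nonneg hg.2.le (by linarith)) (by linarith)
      have : -K ≤ v + min 0 (spec.γhi i * (spec.ωhi i - w) / (w - spec.thrHi i) - v) := by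
        rcases min_cases 0 (spec.γhi i * (spec.ωhi i - w) / (w - spec.thrHi i) - v) with h | h <;>
          linarith
      have := mul_le_mul_of_nonneg_left this hτ
      linarith
    · rw [rawRef_middle spec h h', add_zero]
      linarith

lemma abs_clamp_le {lo hi x : ℝ} (hlo : lo ≤ 0) (hhi : 0 ≤ hi) : |max lo (min hi x)| ≤ |x| := by
  rcases max_cases lo (min hi x) with h | h <;> rcases min_cases hi x with h' | h' <;>
    rw [h.1] <;> rw [h'.1] at h <;> try rw [h'.1]
  all_goals cases abs_cases x <;> rw [abs_le] <;> constructor <;> linarith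

lemma balance_hard_le {E a m M c : ℝ} (hE : 0 < E) (hm : m ≤ 0) (hM : 0 ≤ M) (hc : |c| ≤ |a / E|) :
    |max ((a + m) / E) (min ((a + M) / E) c)| ≤ |a / E| := by
  have e1 : (a + m) / E ≤ a / E := by gcongr; linarith
  have e2 : a / E ≤ (a + M) / E := by gcongr; linarith
  have e3 := neg_abs_le c
  have e4 := le_abs_self c
  rw [abs_le]
  rcases le_total 0 a with ha | ha
  · have : 0 ≤ a / E := by positivity
    rw [abs_of_nonneg this] at hc ⊢
    exact ⟨le_max_of_le_right (le_min (by linarith) (by linarith)),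
      max_le e1 (min_le_of_right_le (by linarith))⟩
  · have : a / E ≤ 0 := div_nonpos_of_nonpos_of_nonneg ha hE.le
    rw [abs_of_nonpos this] at hc ⊢
    exact ⟨le_max_of_le_right (le_min (by linarith) (by linarith)),
      max_le (by linarith) (min_le_of_right_le (by linarith))⟩

/-- The safe interval contains `0` and the window of a hard bus contains `a / E`, so no clamp can
push the value farther from zero than `a / E`. -/
lemma abs_balance_le {E : ℝ} (hE : 0 < E) (a : ℝ) : |spec.balance E i a| ≤ |a| / E := by
  rw [← abs_of_pos hE, ← abs_div, abs_of_pos hE]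
  unfold ControlSpec.balance
  split_ifs with hi hs
  · have := spec.safe_thr i hi
    have := spec.thr_sign i (spec.Iω_subset hi)
    exact abs_clamp_le (by linarith) (by linarith)
  · have := spec.safe_thr i hi
    have := spec.thr_sign i (spec.Iω_subset hi)
    have hb := spec.hard_bounds i (spec.Iω_subset hi) (by simpa using hs)
    exact balance_hard_le hE hb.1 hb.2 (abs_clamp_le (by linarith) (by linarith))
  · exact le_rfl

lemma balance_mem_safe (hi : i ∈ spec.Iω) (hs : spec.ξ i = true) (E a : ℝ) :
    spec.balance E i a ∈ Icc (spec.ωlo i) (spec.ωhi i) := by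
  have := spec.safe_thr i hi
  have := spec.thr_sign i (spec.Iω_subset hi)
  rw [ControlSpec.balance, if_pos hi, if_pos hs]
  exact ⟨le_max_left _ _, max_le (by linarith) (min_le_left _ _)⟩

lemma abs_max_sub_max_le_of_le {a b c d r : ℝ} (h1 : |a - c| ≤ r) (h2 : |b - d| ≤ r) :
    |max a b - max c d| ≤ r :=
  (abs_max_sub_max_le_max a b c d).trans (max_le h1 h2)

lemma abs_min_sub_min_le_of_le {a b c d r : ℝ} (h1 : |a - c| ≤ r) (h2 : |b - d| ≤ r) :
    |min a b - min c d| ≤ r :=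
  (abs_min_sub_min_le_max a b c d).trans (max_le h1 h2)

/-- `max` and `min` are nonexpansive, and every argument is either constant in `a` or a translate of
`a / E`. Through this bound frequencies without inertia inherit continuity and Lipschitz estimates
from the angles. -/
lemma abs_balance_sub_le {E : ℝ} (hE : 0 < E) (a a' : ℝ) :
    |spec.balance E i a - spec.balance E i a'| ≤ |a - a'| / E := by
  have h0 : |a / E - a' / E| ≤ |a - a'| / E := by
    rw [← sub_div, abs_div, abs_of_pos hE]
  have h1 : ∀ x : ℝ, |(a + x) / E - (a' + x) / E| ≤ |a - a'| / E := by
    intro x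
    rw [← sub_div, abs_div, abs_of_pos hE]
    rw [add_sub_add_right_eq_sub]
  have h2 : ∀ x : ℝ, |x - x| ≤ |a - a'| / E := by
    intro x; rw [sub_self, abs_zero]; positivity
  unfold ControlSpec.balance
  split_ifs with hi hs
  · exact abs_max_sub_max_le_of_le (h2 _) (abs_min_sub_min_le_of_le (h2 _) h0)
  · exact abs_max_sub_max_le_of_le (h1 _) (abs_min_sub_min_le_of_le (h1 _)
      (abs_max_sub_max_le_of_le (h2 _) (abs_min_sub_min_le_of_le (h2 _) h0)))
  · exact h0

lemma balance_eq_div {E a : ℝ} (hE : 0 < E)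
    (h : i ∈ spec.Iω → spec.ωlo i ≤ a / E ∧ a / E ≤ spec.ωhi i) :
    spec.balance E i a = a / E := by
  unfold ControlSpec.balance
  split_ifs with hi hs
  · rw [min_eq_right (h hi).2, max_eq_right (h hi).1]
  · have hb := spec.hard_bounds i (spec.Iω_subset hi) (by simpa using hs)
    have e1 : (a + spec.uMin i) / E ≤ a / E := by gcongr; linarith
    have e2 : a / E ≤ (a + spec.uMax i) / E := by gcongr; linarith
    rw [min_eq_right (h hi).2, max_eq_right (h hi).1, min_eq_right e2, max_eq_right e1]
  · rfl

/-- Three regimes. If `a / E` is safe, no mismatch is left there and the input is zero. Otherwise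
the root is `ωhi`, where the barrier term vanishes and the raw input cancels the mismatch exactly,
as long as the input is not clipped. If a hard bus is too weak for that, it settles beyond `ωhi`
with the input saturated at `uMin`. -/
lemma localRef_balance_upper (hi : i ∈ spec.Iω) {E a : ℝ} (hE : 0 < E) (hc : spec.thrHi i < a / E) :
    -(E * spec.balance E i a) + a
      + spec.localRef i (spec.balance E i a) (-(E * spec.balance E i a) + a) = 0 := by
  have hu := spec.Iω_subset hi
  have hst := spec.safe_thr i hi
  have hts := spec.thr_sign i hu
  have hg := spec.gains_pos i hi
  have ha : E * (a / E) = a := by field_simp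
  rcases le_or_gt (a / E) (spec.ωhi i) with h | h
  · rw [balance_eq_div spec hE fun _ => ⟨by linarith, h⟩, ha, neg_add_cancel, zero_add]
    have h0 : spec.rawRef i (a / E) 0 = 0 := by
      rw [rawRef_upper spec hc, sub_zero, min_eq_left]
      exact div_nonneg (mul_nonneg hg.2.le (by linarith)) (by linarith)
    cases hs : spec.ξ i
    · have hb := spec.hard_bounds i hu hs
      rw [localRef_hard spec hi hs, h0, min_eq_right hb.2, max_eq_right hb.1]
    · rw [localRef_soft spec hi hs, h0]
  · have hclamp : max (spec.ωlo i) (min (spec.ωhi i) (a / E)) = spec.ωhi i := by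
      rw [min_eq_left h.le, max_eq_right (by linarith)]
    have h0 : ∀ v, 0 ≤ v → spec.rawRef i (spec.ωhi i) v = -v := by
      intro v hv
      rw [rawRef_upper spec hst.2, sub_self, mul_zero, zero_div, zero_sub, min_eq_right]
      linarith
    have hpos : 0 ≤ -(E * spec.ωhi i) + a := by nlinarith
    cases hs : spec.ξ i
    · have hb := spec.hard_bounds i hu hs
      have e2 : spec.ωhi i ≤ (a + spec.uMax i) / E := by
        rw [le_div_iff₀ hE]; nlinarith
      have hbal : spec.balance E i a = max ((a + spec.uMin i) / E) (spec.ωhi i) := by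
        rw [ControlSpec.balance, if_pos hi, if_neg (by simp [hs]), hclamp, min_eq_right e2]
      rcases le_or_gt ((a + spec.uMin i) / E) (spec.ωhi i) with h3 | h3
      · rw [hbal, max_eq_right h3, localRef_hard spec hi hs, h0 _ hpos]
        rw [div_le_iff₀ hE] at h3
        rw [min_eq_right (by linarith), max_eq_right (by linarith), add_neg_cancel]
      · rw [hbal, max_eq_left h3.le, localRef_hard spec hi hs]
        have e3 : -(E * ((a + spec.uMin i) / E)) + a = -spec.uMin i := by field_simp; ring
        rw [e3, rawRef_upper spec (by linarith)]
        have e4 : spec.γhi i * (spec.ωhi i - (a + spec.uMin i) / E)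
            / ((a + spec.uMin i) / E - spec.thrHi i) ≤ 0 :=
          div_nonpos_of_nonpos_of_nonneg (mul_nonpos_of_nonneg_of_nonpos hg.2.le (by linarith))
            (by linarith)
        rw [max_eq_left (min_le_of_right_le (min_le_of_right_le (by linarith))), neg_add_cancel]
    · rw [ControlSpec.balance, if_pos hi, if_pos hs, hclamp, localRef_soft spec hi hs, h0 _ hpos,
        add_neg_cancel]

lemma localRef_balance_lower (hi : i ∈ spec.Iω) {E a : ℝ} (hE : 0 < E) (hc : a / E < spec.thrLo i) :
    -(E * spec.balance E i a) + a
      + spec.localRef i (spec.balance E i a) (-(E * spec.balance E i a) + a) = 0 := by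
  have hu := spec.Iω_subset hi
  have hst := spec.safe_thr i hi
  have hts := spec.thr_sign i hu
  have hg := spec.gains_pos i hi
  have ha : E * (a / E) = a := by field_simp
  rcases le_or_gt (spec.ωlo i) (a / E) with h | h
  · rw [balance_eq_div spec hE fun _ => ⟨h, by linarith⟩, ha, neg_add_cancel, zero_add]
    have h0 : spec.rawRef i (a / E) 0 = 0 := by
      rw [rawRef_lower spec hu hc, sub_zero, max_eq_left]
      exact div_nonpos_of_nonpos_of_nonneg (mul_nonpos_of_nonneg_of_nonpos hg.1.le (by linarith))
        (by linarith)
    cases hs : spec.ξ i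
    · have hb := spec.hard_bounds i hu hs
      rw [localRef_hard spec hi hs, h0, min_eq_right hb.2, max_eq_right hb.1]
    · rw [localRef_soft spec hi hs, h0]
  · have hclamp : max (spec.ωlo i) (min (spec.ωhi i) (a / E)) = spec.ωlo i := by
      rw [min_eq_right (by linarith), max_eq_left h.le]
    have h0 : ∀ v, v ≤ 0 → spec.rawRef i (spec.ωlo i) v = -v := by
      intro v hv
      rw [rawRef_lower spec hu hst.1, sub_self, mul_zero, zero_div, zero_sub, max_eq_right]
      linarith
    have hneg : -(E * spec.ωlo i) + a ≤ 0 := by nlinarith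
    cases hs : spec.ξ i
    · have hb := spec.hard_bounds i hu hs
      have e2 : (a + spec.uMin i) / E ≤ spec.ωlo i := by
        rw [div_le_iff₀ hE]; nlinarith
      have e5 : (a + spec.uMin i) / E ≤ (a + spec.uMax i) / E := by gcongr; linarith
      have hbal : spec.balance E i a = min ((a + spec.uMax i) / E) (spec.ωlo i) := by
        rw [ControlSpec.balance, if_pos hi, if_neg (by simp [hs]), hclamp,
          max_eq_right (le_min e5 e2)]
      rcases le_or_gt (spec.ωlo i) ((a + spec.uMax i) / E) with h3 | h3
      · rw [hbal, min_eq_right h3, localRef_hard spec hi hs, h0 _ hneg]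
        rw [le_div_iff₀ hE] at h3
        rw [min_eq_right (by linarith), max_eq_right (by linarith), add_neg_cancel]
      · rw [hbal, min_eq_left h3.le, localRef_hard spec hi hs]
        have e3 : -(E * ((a + spec.uMax i) / E)) + a = -spec.uMax i := by field_simp; ring
        rw [e3, rawRef_lower spec hu (by linarith)]
        have e4 : 0 ≤ spec.γlo i * (spec.ωlo i - (a + spec.uMax i) / E)
            / (spec.thrLo i - (a + spec.uMax i) / E) :=
          div_nonneg (mul_nonneg hg.1.le (by linarith)) (by linarith)
        rw [min_eq_left (le_max_of_le_right (by linarith)), max_eq_right (by linarith),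
          neg_add_cancel]
    · rw [ControlSpec.balance, if_pos hi, if_pos hs, hclamp, localRef_soft spec hi hs, h0 _ hneg,
        add_neg_cancel]

/-- `balance` is a root of the power balance under the reference input. -/
lemma localRef_balance {E : ℝ} (hE : 0 < E) (a : ℝ) :
    -(E * spec.balance E i a) + a
      + spec.localRef i (spec.balance E i a) (-(E * spec.balance E i a) + a) = 0 := by
  by_cases hi : i ∈ spec.Iω
  · have hst := spec.safe_thr i hi
    rcases lt_or_ge (spec.thrHi i) (a / E) with h | h
    · exact localRef_balance_upper spec hi hE h
    rcases lt_or_ge (a / E) (spec.thrLo i) with h' | h'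
    · exact localRef_balance_lower spec hi hE h'
    rw [balance_eq_div spec hE fun _ => ⟨by linarith, by linarith⟩,
      localRef_middle spec (spec.Iω_subset hi) h' h]
    field_simp; ring
  · rw [localRef_of_notMem spec hi, ControlSpec.balance, if_neg hi]
    field_simp; ring

lemma add_max_min (v m M x : ℝ) : v + max m (min M x) = max (v + m) (min (v + M) (v + x)) := by
  rw [← max_add_add_left, ← min_add_add_left]

lemma max_min_lt_max_min {a b c a' b' c' : ℝ} (ha : a < a') (hb : b < b') (hc : c < c') :
    max a (min b c) < max a' (min b' c') :=
  max_lt_max ha (min_lt_min hb hc)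

/-- The power balance under the reference input is strictly decreasing in the frequency. -/
lemma strictAnti_add_localRef {E : ℝ} (hE : 0 < E) (a : ℝ) :
    StrictAnti fun w => -(E * w) + a + spec.localRef i w (-(E * w) + a) := by
  intro w w' hw
  have hv : -(E * w') + a < -(E * w) + a := by nlinarith
  simp only
  set v := -(E * w) + a
  set v' := -(E * w') + a
  by_cases hi : i ∈ spec.Iω
  swap
  · rw [localRef_of_notMem spec hi, localRef_of_notMem spec hi]; linarith
  have hu := spec.Iω_subset hi
  have hst := spec.safe_thr i hi
  have hts := spec.thr_sign i hu
  have hg := spec.gains_pos i hi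
  rcases le_or_gt w (spec.thrHi i) with h1 | h1
  · have p1 := localRef_nonneg spec hu h1 v
    rcases le_or_gt (spec.thrLo i) w' with h2 | h2
    · have p2 := localRef_nonpos spec hu h2 v'
      linarith
    · have hφ : spec.γlo i * (spec.ωlo i - w') / (spec.thrLo i - w')
          < spec.γlo i * (spec.ωlo i - w) / (spec.thrLo i - w) := by
        rw [div_lt_div_iff₀ (by linarith) (by linarith)]
        nlinarith [mul_pos (mul_pos hg.1 (sub_pos.2 hw)) (sub_pos.2 hst.1)]
      -- Below the lower threshold `v + rawRef` is the maximum of `v` and the barrier term, and both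
      -- strictly decrease in the frequency; above the upper threshold it is the corresponding
      -- minimum. `add_max_min` moves `v` inside the saturation, so the same entrywise argument
      -- covers hard buses.
      have hr : v' + spec.rawRef i w' v' < v + spec.rawRef i w v := by
        rw [rawRef_lower spec hu h2, rawRef_lower spec hu (hw.trans h2), ← max_add_add_left,
          ← max_add_add_left]
        exact max_lt_max (by linarith) (by linarith)
      cases hs : spec.ξ i
      · rw [localRef_hard spec hi hs, localRef_hard spec hi hs, add_max_min, add_max_min]
        exact max_min_lt_max_min (by linarith) (by linarith) hr
      · rwa [localRef_soft spec hi hs, localRef_soft spec hi hs]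
  · have hφ : spec.γhi i * (spec.ωhi i - w') / (w' - spec.thrHi i)
        < spec.γhi i * (spec.ωhi i - w) / (w - spec.thrHi i) := by
      rw [div_lt_div_iff₀ (by linarith) (by linarith)]
      nlinarith [mul_pos (mul_pos hg.2 (sub_pos.2 hw)) (sub_pos.2 hst.2)]
    have hr : v' + spec.rawRef i w' v' < v + spec.rawRef i w v := by
      rw [rawRef_upper spec h1, rawRef_upper spec (h1.trans hw), ← min_add_add_left,
        ← min_add_add_left]
      exact min_lt_min (by linarith) (by linarith)
    cases hs : spec.ξ i
    · rw [localRef_hard spec hi hs, localRef_hard spec hi hs, add_max_min, add_max_min]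
      exact max_min_lt_max_min (by linarith) (by linarith) hr
    · rwa [localRef_soft spec hi hs, localRef_soft spec hi hs]

lemma add_localRef_eq_zero_iff {E : ℝ} (hE : 0 < E) {a w : ℝ} :
    -(E * w) + a + spec.localRef i w (-(E * w) + a) = 0 ↔ w = spec.balance E i a := by
  constructor
  · intro h
    exact (strictAnti_add_localRef spec hE a).injective (h.trans (localRef_balance spec hE a).symm)
  · rintro rfl
    exact localRef_balance spec hE a

end Scalar

/-! ### Growth, safety and uniqueness of the generated reference trajectory. -/

section Reference

variable {V L : Type*} [Fintype V] [DecidableEq V] [Fintype L] [DecidableEq L]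

/-- The power `[Dᵀ Y_b s]_i` flowing out of bus `i`. -/
def PowerNetwork.outflow (net : PowerNetwork V L) (s : L → ℝ) (i : V) : ℝ :=
  (net.D.transpose.mulVec (net.Yb.mulVec s)) i

variable (net : PowerNetwork V L) (spec : ControlSpec V)

lemma D_mulVec_apply (w : V → ℝ) (l : L) :
    net.D.mulVec w l = w (net.pos l) - w (net.neg l) := by
  have hne := net.pos_ne_neg l
  have : ∀ i, net.D l i * w i
      = (if i = net.pos l then w i else 0) - (if i = net.neg l then w i else 0) := by
    intro i
    simp only [PowerNetwork.D, Matrix.of_apply]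
    split_ifs with h1 h2
    · exact absurd (h1.symm.trans h2) hne
    all_goals simp
  simp only [Matrix.mulVec, dotProduct, this, Finset.sum_sub_distrib]
  simp

lemma outflow_eq_sum (s : L → ℝ) (i : V) :
    net.outflow s i = ∑ l, net.D l i * (net.b l * s l) := by
  simp [PowerNetwork.outflow, PowerNetwork.Yb, Matrix.mulVec, dotProduct,
    Matrix.diagonal_apply]

lemma abs_D_le (l : L) (i : V) : |net.D l i| ≤ 1 := by
  simp only [PowerNetwork.D, Matrix.of_apply]
  split_ifs <;> simp

lemma abs_outflow_le {s : L → ℝ} {X : ℝ} (hs : ∀ l, |s l| ≤ X) (i : V) :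
    |net.outflow s i| ≤ (∑ l, net.b l) * X := by
  rw [outflow_eq_sum, Finset.sum_mul]
  refine (Finset.abs_sum_le_sum_abs _ _).trans (Finset.sum_le_sum fun l _ => ?_)
  have hb := net.b_pos l
  rw [abs_mul, abs_mul, abs_of_pos hb]
  have h2 : net.b l * |s l| ≤ net.b l * X := mul_le_mul_of_nonneg_left (hs l) hb.le
  have h3 : 0 ≤ net.b l * |s l| := by positivity
  nlinarith [abs_D_le net l i]

lemma sum_b_nonneg : 0 ≤ ∑ l, net.b l := Finset.sum_nonneg fun l _ => (net.b_pos l).le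

lemma residual_eq (s : L → ℝ) (w q : V → ℝ) (i : V) :
    net.residual s w q i = -(net.E i * w i) + (q i - net.outflow s i) := by
  simp only [PowerNetwork.residual, PowerNetwork.outflow]; ring

lemma refInput_eq (s : L → ℝ) (w q : V → ℝ) (i : V) :
    refInput net spec s w q i = spec.localRef i (w i) (net.residual s w q i) := rfl

lemma abs_residual_le {s : L → ℝ} {X : ℝ} (hs : ∀ l, |s l| ≤ X) (w q : V → ℝ) (i : V) :
    |net.residual s w q i| ≤ net.E i * |w i| + (∑ l, net.b l) * X + |q i| := by
  have h1 := abs_outflow_le net hs i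
  have h2 : |-(net.E i * w i)| = net.E i * |w i| := by
    rw [abs_neg, abs_mul, abs_of_pos (net.E_pos i)]
  rw [residual_eq]
  calc _ ≤ |-(net.E i * w i)| + (|q i| + |net.outflow s i|) :=
        (abs_add_le _ _).trans (add_le_add_right (abs_sub _ _) _)
    _ ≤ _ := by rw [h2]; linarith

/-- At a bus without inertia the reference input balances the power exactly at `balance`. -/
lemma residual_add_refInput_eq_zero_iff (s : L → ℝ) (w q : V → ℝ) (i : V) :
    net.residual s w q i + refInput net spec s w q i = 0 ↔
      w i = spec.balance (net.E i) i (q i - net.outflow s i) := by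
  rw [refInput_eq, residual_eq]
  exact add_localRef_eq_zero_iff spec (net.E_pos i)

/-- The discrete closed loop under the reference feedback. -/
def refState (T : ℝ) (P : ℕ → V → ℝ) (s₀ : L → ℝ) (w₀ : V → ℝ) : ℕ → (L → ℝ) × (V → ℝ)
  | 0 => (s₀, w₀)
  | k + 1 =>
    let x := refState T P s₀ w₀ k
    let s := x.1 + T • net.D.mulVec x.2
    (s, fun i => if net.M i = 0 then spec.balance (net.E i) i (P (k + 1) i - net.outflow s i)
      else x.2 i + T / net.M i *
        (net.residual x.1 x.2 (P k) i + refInput net spec x.1 x.2 (P k) i))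

/-- Growth constant: the rates along the reference feedback are linear in the state. -/
lemma exists_growth_bound (ρ : ℝ) (hρ : 0 ≤ ρ) : ∃ A, 1 ≤ A ∧ ∃ B, 0 ≤ B ∧
    (∀ i X a, 1 ≤ X → |a| ≤ ρ + (∑ l, net.b l) * X → |spec.balance (net.E i) i a| ≤ A * X) ∧
    ∀ X, 1 ≤ X → ∀ (s : L → ℝ) (w q : V → ℝ), (∀ l, |s l| ≤ X) → (∀ i, |w i| ≤ A * X) →
      (∀ i, |q i| ≤ ρ) → (∀ l, |net.D.mulVec w l| ≤ B * X) ∧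
      ∀ i, |net.residual s w q i| ≤ B * X ∧
        (0 < net.M i →
          |net.residual s w q i + refInput net spec s w q i| ≤ net.M i * (B * X)) := by
  have hb := sum_b_nonneg net
  set S := ∑ l, net.b l
  -- `X` measures angles and frequencies with inertia; the frequencies without inertia are only
  -- bounded by `A * X`. Since `1 ≤ X`, constants such as `ρ` are absorbed into multiples of `X`.
  set A := 1 + ∑ i, (ρ + S) / net.E i with hA
  have hpos : ∀ i ∈ Finset.univ, 0 ≤ (ρ + S) / net.E i := fun i _ => by
    have := net.E_pos i; positivity
  have hA1 : 1 ≤ A := by have := Finset.sum_nonneg hpos; linarith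
  set C := (∑ i, net.E i) * A + S + ρ with hC
  have hE0 : 0 ≤ ∑ i, net.E i := Finset.sum_nonneg fun i _ => (net.E_pos i).le
  have hC0 : 0 ≤ C := by positivity
  have hpos' : ∀ i ∈ Finset.univ, 0 ≤ (C + (|spec.γlo i| + |spec.γhi i|)) / net.M i := fun i _ => by
    have := net.M_nonneg i; positivity
  -- The three summands serve the angle rates, the uncontrolled right-hand side and the
  -- accelerations under feedback.
  refine ⟨A, hA1, 2 * A + C + ∑ i, (C + (|spec.γlo i| + |spec.γhi i|)) / net.M i, ?_, ?_, ?_⟩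
  · have := Finset.sum_nonneg hpos'
    linarith
  · intro i X a hX ha
    have hE := net.E_pos i
    calc _ ≤ |a| / net.E i := abs_balance_le spec hE a
      _ ≤ ((ρ + S) * X) / net.E i := by gcongr; nlinarith
      _ = (ρ + S) / net.E i * X := by ring
      _ ≤ A * X := by
        have := Finset.single_le_sum hpos (Finset.mem_univ i)
        gcongr; linarith
  · intro X hX s w q hs hw hq
    have hsum := Finset.sum_nonneg hpos'
    have hres : ∀ i, |net.residual s w q i| ≤ C * X := by
      intro i
      have h1 := abs_residual_le net hs w q i
      have h2 : net.E i * |w i| ≤ (∑ i, net.E i) * (A * X) :=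
        mul_le_mul (Finset.single_le_sum (fun i _ => (net.E_pos i).le) (Finset.mem_univ i)) (hw i)
          (abs_nonneg _) hE0
      have h3 := hq i
      have h4 : ρ ≤ ρ * X := by nlinarith
      rw [hC]; linarith
    refine ⟨fun l => ?_, fun i => ⟨(hres i).trans ?_, fun hM => ?_⟩⟩
    · rw [D_mulVec_apply]
      have h1 := hw (net.pos l)
      have h2 := hw (net.neg l)
      have h3 := abs_sub (w (net.pos l)) (w (net.neg l))
      have : 0 ≤ (C + ∑ i, (C + (|spec.γlo i| + |spec.γhi i|)) / net.M i) * X := by positivity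
      linarith
    · gcongr; linarith
    · have h1 := abs_add_localRef_le spec (i := i) (w i) (net.residual s w q i)
      rw [refInput_eq]
      have h2 := Finset.single_le_sum hpos' (Finset.mem_univ i)
      have h3 : (C + (|spec.γlo i| + |spec.γhi i|))
          = net.M i * ((C + (|spec.γlo i| + |spec.γhi i|)) / net.M i) := by field_simp
      have h4 : (C + (|spec.γlo i| + |spec.γhi i|)) ≤ net.M i *
          (2 * A + C + ∑ i, (C + (|spec.γlo i| + |spec.γhi i|)) / net.M i) := by
        rw [h3]; gcongr; linarith
      have h5 : |spec.γlo i| + |spec.γhi i| ≤ (|spec.γlo i| + |spec.γhi i|) * X :=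
        le_mul_of_one_le_right (by positivity) hX
      have h6 := hres i
      have h7 := mul_le_mul_of_nonneg_right h4 (show 0 ≤ X by linarith)
      linarith

/-- Along the reference feedback the uncontrolled right-hand side stays bounded on the horizon,
uniformly in the sampling length. -/
lemma exists_refState_residual_bound (ρ : ℝ) (hρ : 0 ≤ ρ) (h : ℝ) :
    ∃ K, ∀ T, 0 < T → ∀ (P : ℕ → V → ℝ) (s₀ : L → ℝ) (w₀ : V → ℝ),
      (∀ l, |s₀ l| ≤ 1) → (∀ i, |w₀ i| ≤ ρ) → (∀ k < ⌈h / T⌉₊, ∀ i, |P k i| ≤ ρ) →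
      ∀ k < ⌈h / T⌉₊, ∀ i, |net.residual (refState net spec T P s₀ w₀ k).1
        (refState net spec T P s₀ w₀ k).2 (P k) i| ≤ K := by
  obtain ⟨A, hA, B, hB, hbal, hrate⟩ := exists_growth_bound net spec ρ hρ
  -- Each step multiplies the bound by `1 + T * B`, and `k * T < h` on the horizon, so the growth
  -- factor stays below `exp (B * h)` for every `T`.
  refine ⟨B * ((1 + ρ) * Real.exp (B * h)), fun T hT P s₀ w₀ hs hw hP => ?_⟩
  set x := refState net spec T P s₀ w₀ with hx
  have hTB : 0 ≤ T * B := by positivity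
  have hX1 : ∀ k : ℕ, 1 ≤ (1 + ρ) * (1 + T * B) ^ k := fun k =>
    one_le_mul_of_one_le_of_one_le (by linarith) (one_le_pow₀ (by linarith))
  -- Frequencies with inertia need the bound without the factor `A`, since they are accumulated.
  -- Those without inertia are recomputed from the angles at each step, so their factor `A` does not
  -- compound.
  have key : ∀ k < ⌈h / T⌉₊, (∀ l, |(x k).1 l| ≤ (1 + ρ) * (1 + T * B) ^ k) ∧
      (∀ i, |(x k).2 i| ≤ A * ((1 + ρ) * (1 + T * B) ^ k)) ∧
      (∀ i, net.M i ≠ 0 → |(x k).2 i| ≤ (1 + ρ) * (1 + T * B) ^ k) := by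
    intro k
    induction k with
    | zero =>
      intro _
      have h1 : ∀ i, |(x 0).2 i| ≤ 1 + ρ := fun i => (hw i).trans (by linarith)
      refine ⟨fun l => (hs l).trans (by simpa using hρ), fun i => (h1 i).trans ?_,
        fun i _ => by simpa using h1 i⟩
      rw [pow_zero, mul_one]; nlinarith
    | succ k ih =>
      intro hk
      have hk' : k < ⌈h / T⌉₊ := by omega
      obtain ⟨ih1, ih2, ih3⟩ := ih hk'
      have hXk := hX1 k
      have hXk' := hX1 (k + 1)
      rw [pow_succ, ← mul_assoc] at hXk' ⊢
      set X := (1 + ρ) * (1 + T * B) ^ k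
      obtain ⟨r1, r2⟩ := hrate X hXk _ _ _ ih1 ih2 (hP k hk')
      have c1 : ∀ l, |(x (k + 1)).1 l| ≤ X * (1 + T * B) := by
        intro l
        have : (x (k + 1)).1 l = (x k).1 l + T * net.D.mulVec (x k).2 l := rfl
        rw [this]
        refine (abs_add_le _ _).trans ?_
        rw [abs_mul, abs_of_pos hT]
        nlinarith [ih1 l, r1 l]
      have c2 : ∀ i, net.M i ≠ 0 → |(x (k + 1)).2 i| ≤ X * (1 + T * B) := by
        intro i hi
        have hM := lt_of_le_of_ne (net.M_nonneg i) (Ne.symm hi)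
        have : (x (k + 1)).2 i = (x k).2 i + T / net.M i * (net.residual (x k).1 (x k).2 (P k) i
            + refInput net spec (x k).1 (x k).2 (P k) i) := by
          rw [hx]; simp only [refState, if_neg hi]
        rw [this]
        refine (abs_add_le _ _).trans ?_
        rw [abs_mul, abs_of_pos (div_pos hT hM)]
        have h1 : T / net.M i * |net.residual (x k).1 (x k).2 (P k) i
            + refInput net spec (x k).1 (x k).2 (P k) i| ≤ T / net.M i * (net.M i * (B * X)) := by
          gcongr; exact (r2 i).2 hM
        have h2 : T / net.M i * (net.M i * (B * X)) = T * (B * X) := by field_simp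
        have := ih3 i hi
        linarith
      refine ⟨c1, fun i => ?_, c2⟩
      by_cases hi : net.M i = 0
      · have : (x (k + 1)).2 i
            = spec.balance (net.E i) i (P (k + 1) i - net.outflow (x (k + 1)).1 i) := by
          rw [hx]; simp only [refState, if_pos hi]
        rw [this]
        refine hbal i _ _ hXk' ((abs_sub _ _).trans ?_)
        exact add_le_add (hP _ hk i) (abs_outflow_le net c1 i)
      · exact (c2 i hi).trans (le_mul_of_one_le_left (by linarith) hA)
  intro k hk i
  obtain ⟨k1, k2, -⟩ := key k hk
  refine ((hrate _ (hX1 k) _ _ _ k1 k2 (hP k hk)).2 i).1.trans ?_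
  gcongr
  have h1 : (k : ℝ) * T < h := by rw [← lt_div_iff₀ hT]; exact Nat.lt_ceil.1 hk
  calc (1 + T * B) ^ k ≤ Real.exp (T * B) ^ k := by
        gcongr; linarith [Real.add_one_le_exp (T * B)]
    _ = Real.exp (k * (T * B)) := by rw [← Real.exp_nat_mul]
    _ ≤ _ := Real.exp_le_exp.2 (by nlinarith)

/-- For short sampling lengths the reference feedback generates a reference trajectory. -/
lemma eventually_isGeneratedReference (ρ : ℝ) (h : ℝ) :
    ∀ᶠ T in 𝓝[>] (0 : ℝ), ∀ (P : ℕ → V → ℝ) (lam₀ : L → ℝ) (w₀ : V → ℝ),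
      (∀ i, |w₀ i| ≤ ρ) → (∀ k < ⌈h / T⌉₊, ∀ i, |P k i| ≤ ρ) →
      IsConsistent net spec (P 0) lam₀ w₀ →
      ∃ Λr Ωr Ur, IsGeneratedReference net spec T ⌈h / T⌉₊ P lam₀ w₀ Λr Ωr Ur := by
  obtain ⟨K, hK⟩ := exists_refState_residual_bound net spec |ρ| (abs_nonneg ρ) h
  have small : ∀ c g : ℝ, 0 < g → ∀ᶠ T in 𝓝[>] (0 : ℝ), T * c ≤ g := by
    intro c g hg
    have : Tendsto (fun T : ℝ => T * c) (𝓝[>] 0) (𝓝 0) := by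
      have : Tendsto (fun T : ℝ => T * c) (𝓝 0) (𝓝 (0 * c)) :=
        (continuous_id.mul continuous_const).tendsto 0
      rw [zero_mul] at this
      exact this.mono_left nhdsWithin_le_nhds
    exact this.eventually (eventually_le_nhds hg)
  -- The hypotheses of `step_le_ωhi` and `ωlo_le_step` with `τ = T / M i`. At a bus without inertia
  -- `T / 0 = 0`, and they hold trivially.
  have hT : ∀ᶠ T in 𝓝[>] (0 : ℝ), ∀ i ∈ spec.Iω,
      2 * (T / net.M i * K) ≤ spec.ωhi i - spec.thrHi i ∧
      2 * (T / net.M i * spec.γhi i) ≤ spec.ωhi i - spec.thrHi i ∧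
      2 * (T / net.M i * K) ≤ spec.thrLo i - spec.ωlo i ∧
      2 * (T / net.M i * spec.γlo i) ≤ spec.thrLo i - spec.ωlo i := by
    rw [Filter.eventually_all_finset]
    intro i hi
    have := spec.safe_thr i hi
    filter_upwards [small (2 * K / net.M i) _ (sub_pos.2 this.2),
      small (2 * spec.γhi i / net.M i) _ (sub_pos.2 this.2),
      small (2 * K / net.M i) _ (sub_pos.2 this.1),
      small (2 * spec.γlo i / net.M i) _ (sub_pos.2 this.1)] with T h1 h2 h3 h4
    refine ⟨le_of_eq_of_le ?_ h1, le_of_eq_of_le ?_ h2, le_of_eq_of_le ?_ h3,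
      le_of_eq_of_le ?_ h4⟩ <;> ring
  filter_upwards [hT, self_mem_nhdsWithin] with T hT hT0 P lam₀ w₀ hw hP hcons
  replace hT0 : 0 < T := hT0
  have hK' := hK T hT0 P (sinVec lam₀) w₀ (fun l => Real.abs_sin_le_one _)
    (fun i => (hw i).trans (le_abs_self ρ)) (fun k hk i => (hP k hk i).trans (le_abs_self ρ))
  set x := refState net spec T P (sinVec lam₀) w₀ with hx
  set U : ℕ → V → ℝ := fun k => refInput net spec (x k).1 (x k).2 (P k) with hU
  have hsucc : ∀ k i, net.M i ≠ 0 → (x (k + 1)).2 i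
      = (x k).2 i + T / net.M i * (net.residual (x k).1 (x k).2 (P k) i + U k i) := by
    intro k i hi
    rw [hU, hx]; simp only [refState, if_neg hi]
  have halg : ∀ k i, net.M i = 0 → net.residual (x k).1 (x k).2 (P k) i + U k i = 0 := by
    intro k i hi
    cases k with
    | zero => exact hcons i hi
    | succ k =>
      rw [hU, residual_add_refInput_eq_zero_iff, hx]
      simp only [refState, if_pos hi]
  -- Exactly the buses with `kappa = 0`, where no slack can help. The last index `k = N` is
  -- included, because the constraint is imposed there too.
  have hsafe : ∀ i ∈ spec.Iω, spec.ξ i = true → w₀ i ∈ Icc (spec.ωlo i) (spec.ωhi i) →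
      ∀ k ≤ ⌈h / T⌉₊, (x k).2 i ∈ Icc (spec.ωlo i) (spec.ωhi i) := by
    intro i hi hs h0 k
    induction k with
    | zero => intro _; exact h0
    | succ k ih =>
      intro hk
      by_cases hM : net.M i = 0
      · rw [hx]; simp only [refState, if_pos hM]
        exact balance_mem_safe spec hi hs _ _
      · obtain ⟨ih1, ih2⟩ := ih (by omega)
        obtain ⟨t1, t2, t3, t4⟩ := hT i hi
        have hτ : 0 ≤ T / net.M i := div_nonneg hT0.le (net.M_nonneg i)
        rw [hsucc k i hM]
        exact ⟨ωlo_le_step spec hi hs hτ ih1 ih2 (hK' k (by omega) i) t3 t4,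
          step_le_ωhi spec hi hs hτ ih1 ih2 (hK' k (by omega) i) t1 t2⟩
  -- Slack is only needed in large supply. The `δ` in the frequency slack compensates the margin
  -- subtracted in the constraint.
  refine ⟨fun k => (x k).1, fun k => (x k).2, U, ⟨fun k i => |spec.uMin i| + |spec.uMax i| + |U k i|,
    fun k i => |spec.ωlo i| + |spec.ωhi i| + |spec.δ i| + |(x k).2 i|, ?_, ?_⟩, fun _ _ => rfl⟩
  · constructor
    · exact fun k _ => rfl
    · intro k _ i
      by_cases hM : net.M i = 0
      · rw [hM, zero_mul, zero_div]; exact (halg k i hM).symm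
      · change net.M i * ((x (k + 1)).2 i - (x k).2 i) / T = _
        rw [hsucc k i hM]; field_simp; ring
    · rfl
    · rfl
    · intro k _ i hi
      exact if_neg fun hω => hi (spec.Iω_subset hω)
    · intro i hi k _
      cases hs : spec.ξ i
      · have hmem : spec.uMin i ≤ U k i ∧ U k i ≤ spec.uMax i := by
          exact localRef_mem_hard spec hi hs ((x k).2 i) _
        simpa [ControlSpec.xi, hs] using hmem
      · have h1 := neg_abs_le (U k i)
        have h2 := le_abs_self (U k i)
        have h3 := le_abs_self (spec.uMin i)
        have h4 := neg_abs_le (spec.uMax i)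
        have h5 := abs_nonneg (spec.uMin i)
        have h6 := abs_nonneg (spec.uMax i)
        simp only [ControlSpec.xi, hs, if_true, one_mul]
        constructor <;> linarith
    · intro i _ k _; positivity
    · intro i hi k hk
      have hk' := Finset.mem_Icc.1 hk
      simp only [ControlSpec.kappa]
      split_ifs with hc
      · simpa using hsafe i hi hc.2 hc.1 k hk'.2
      · have h1 := neg_abs_le ((x k).2 i)
        have h2 := le_abs_self ((x k).2 i)
        have h3 := le_abs_self (spec.ωlo i)
        have h4 := neg_abs_le (spec.ωhi i)
        have h5 := abs_nonneg (spec.ωlo i)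
        have h6 := abs_nonneg (spec.ωhi i)
        have h7 := le_abs_self (spec.δ i)
        constructor <;> linarith
    · intro i _ k _; positivity
  · intro i hi k _
    have hthr := spec.thr_sign i hi
    refine ⟨fun hnot => ?_, fun hin => localRef_middle spec hi hin.1.le hin.2.le _⟩
    rcases le_or_gt ((x k).2 i) (spec.thrLo i) with h1 | h1
    · exact mul_nonpos_of_nonpos_of_nonneg (by linarith)
        (localRef_nonneg spec hi (by linarith) _)
    · have h2 : spec.thrHi i ≤ (x k).2 i := by
        by_contra h2; exact hnot ⟨h1, not_le.1 h2⟩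
      exact mul_nonpos_of_nonneg_of_nonpos (by linarith) (localRef_nonpos spec hi h1.le _)

variable {net spec}

/-- Two generated reference trajectories agree on the sampling instants of the horizon. -/
lemma IsGeneratedReference.unique {T : ℝ} {N : ℕ} {P : ℕ → V → ℝ} {lam₀ : L → ℝ} {w₀ : V → ℝ}
    {Λ Λ' : ℕ → L → ℝ} {Ω Ω' U U' : ℕ → V → ℝ} (hT : 0 < T)
    (h : IsGeneratedReference net spec T N P lam₀ w₀ Λ Ω U)
    (h' : IsGeneratedReference net spec T N P lam₀ w₀ Λ' Ω' U') :
    ∀ k < N, Ω k = Ω' k := by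
  obtain ⟨⟨B, Γ, ha, -⟩, hU⟩ := h
  obtain ⟨⟨B', Γ', ha', -⟩, hU'⟩ := h'
  have key : ∀ k < N, Λ k = Λ' k ∧ Ω k = Ω' k := by
    intro k
    induction k with
    | zero =>
      intro _
      exact ⟨ha.init_angle.trans ha'.init_angle.symm, ha.init_freq.trans ha'.init_freq.symm⟩
    | succ k ih =>
      intro hk
      have hk' : k < N := by omega
      obtain ⟨i1, i2⟩ := ih hk'
      have hΛ : Λ (k + 1) = Λ' (k + 1) := by
        have e1 := ha.angle k hk'
        have e2 := ha'.angle k hk'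
        simp only at e1 e2
        rw [e1, e2, i1, i2]
      refine ⟨hΛ, funext fun i => ?_⟩
      -- Without inertia the Euler equation at step `k` says nothing about the next frequency; it is
      -- fixed by the algebraic equation at step `k + 1`, which is imposed only if `k + 1 < N`. The
      -- terminal frequency is therefore left out of the claim.
      by_cases hM : net.M i = 0
      · have e1 := ha.freq (k + 1) hk i
        have e2 := ha'.freq (k + 1) hk i
        simp only [hM, zero_mul, zero_div] at e1 e2
        rw [hU (k + 1) hk, eq_comm, residual_add_refInput_eq_zero_iff] at e1
        rw [hU' (k + 1) hk, eq_comm, residual_add_refInput_eq_zero_iff] at e2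
        rw [e1, e2, hΛ]
      · have e1 := ha.freq k hk' i
        have e2 := ha'.freq k hk' i
        simp only at e1 e2
        rw [hU k hk', i1, i2] at e1
        rw [hU' k hk', ← e1] at e2
        field_simp at e2
        linarith
  exact fun k hk => (key k hk).2

end Reference

/-! ### Existence and uniqueness of the optimal input. -/

section Optimization

variable {V L : Type*} [Fintype V] [DecidableEq V] [Fintype L] [DecidableEq L]

variable {net : PowerNetwork V L} {spec : ControlSpec V} {T : ℝ} {N : ℕ} {P : ℕ → V → ℝ}
  {lam₀ : L → ℝ} {ω₀ : V → ℝ} {Ωr : ℕ → V → ℝ} {z z' : Plan V L}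

/-- Beyond a threshold the sign of the frequency is known, because the thresholds enclose `0`, and
the sign of the product gives that of the input. So a reference trajectory is feasible for its own
convexification. -/
lemma PhiDisc.phiCvx {Ω U : ℕ → V → ℝ} (h : PhiDisc spec N Ω U) : PhiCvx spec N Ω Ω U := by
  intro i hi k hk
  have hthr := spec.thr_sign i hi
  obtain ⟨h1, h2⟩ := h i hi k hk
  refine ⟨fun hge => ⟨hge, ?_⟩, fun hle => ⟨hle, ?_⟩, h2⟩
  · have := h1 fun hin => (not_lt.2 hge) hin.2
    by_contra hU
    nlinarith [mul_pos (hthr.2.trans_le hge) (not_le.1 hU)]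
  · have := h1 fun hin => (not_lt.2 hle) hin.1
    by_contra hU
    nlinarith [mul_pos_of_neg_of_neg (hle.trans_lt hthr.1) (not_le.1 hU)]

lemma IsReferenceTrajectory.exists_feasibleCvx {Λ : ℕ → L → ℝ} {Ω U : ℕ → V → ℝ}
    (h : IsReferenceTrajectory net spec T N P lam₀ ω₀ Λ Ω U) :
    ∃ z, FeasibleCvx net spec T N P lam₀ ω₀ Ω z := by
  obtain ⟨B, Γ, ha, hφ⟩ := h
  exact ⟨_, ha, hφ.phiCvx⟩

/-! Uniqueness of the first input -/

/-- The midpoint of two plans. -/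
def Plan.midpoint (z z' : Plan V L) : Plan V L where
  Λ k l := (z.Λ k l + z'.Λ k l) / 2
  Ω k i := (z.Ω k i + z'.Ω k i) / 2
  U k i := (z.U k i + z'.U k i) / 2
  B k i := (z.B k i + z'.B k i) / 2
  Γ k i := (z.Γ k i + z'.Γ k i) / 2

/-- Half the difference of two plans. -/
def Plan.halfDiff (z z' : Plan V L) : Plan V L where
  Λ k l := (z.Λ k l - z'.Λ k l) / 2
  Ω k i := (z.Ω k i - z'.Ω k i) / 2
  U k i := (z.U k i - z'.U k i) / 2
  B k i := (z.B k i - z'.B k i) / 2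
  Γ k i := (z.Γ k i - z'.Γ k i) / 2

lemma residual_midpoint (s s' : L → ℝ) (w w' q : V → ℝ) (i : V) :
    net.residual (fun l => (s l + s' l) / 2) (fun i => (w i + w' i) / 2) q i
      = (net.residual s w q i + net.residual s' w' q i) / 2 := by
  have : net.outflow (fun l => (s l + s' l) / 2) i
      = (net.outflow s i + net.outflow s' i) / 2 := by
    simp only [outflow_eq_sum]
    rw [← Finset.sum_add_distrib, Finset.sum_div]
    exact Finset.sum_congr rfl fun l _ => by ring
  simp only [residual_eq, this]
  ring

/-- Once the data `ω₀` and `Ωr` are fixed, `kappa` is constant and the case distinctions are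
decided, so every constraint is an affine equation or inequality. -/
lemma FeasibleCvx.midpoint (h : FeasibleCvx net spec T N P lam₀ ω₀ Ωr z)
    (h' : FeasibleCvx net spec T N P lam₀ ω₀ Ωr z') :
    FeasibleCvx net spec T N P lam₀ ω₀ Ωr (z.midpoint z') := by
  obtain ⟨ha, hφ⟩ := h
  obtain ⟨ha', hφ'⟩ := h'
  refine ⟨⟨?_, ?_, ?_, ?_, ?_, ?_, ?_, ?_, ?_⟩, ?_⟩
  · intro k hk
    funext l
    have e := congrFun (ha.angle k hk) l
    have e' := congrFun (ha'.angle k hk) l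
    simp only [Pi.add_apply, Pi.smul_apply, smul_eq_mul, D_mulVec_apply, Plan.midpoint] at e e' ⊢
    rw [e, e']; ring
  · intro k hk i
    have e := ha.freq k hk i
    have e' := ha'.freq k hk i
    simp only [Plan.midpoint, residual_midpoint]
    linear_combination (e + e') / 2
  · funext l
    have e := congrFun ha.init_angle l
    have e' := congrFun ha'.init_angle l
    simp only [Plan.midpoint]
    rw [e, e']; ring
  · funext l
    have e := congrFun ha.init_freq l
    have e' := congrFun ha'.init_freq l
    simp only [Plan.midpoint]
    rw [e, e']; ring
  · intro k hk i hi
    simp [Plan.midpoint, ha.available k hk i hi, ha'.available k hk i hi]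
  · intro i hi k hk
    have e := ha.magnitude i hi k hk
    have e' := ha'.magnitude i hi k hk
    simp only [Plan.midpoint]
    constructor <;> linarith [e.1, e.2, e'.1, e'.2]
  · intro i hi k hk
    have e := ha.slack_B i hi k hk
    have e' := ha'.slack_B i hi k hk
    simp only [Plan.midpoint]
    linarith
  · intro i hi k hk
    have e := ha.safe i hi k hk
    have e' := ha'.safe i hi k hk
    simp only [Plan.midpoint]
    constructor <;> linarith [e.1, e.2, e'.1, e'.2]
  · intro i hi k hk
    have e := ha.slack_Γ i hi k hk
    have e' := ha'.slack_Γ i hi k hk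
    simp only [Plan.midpoint]
    linarith
  · intro i hi k hk
    obtain ⟨e1, e2, e3⟩ := hφ i hi k hk
    obtain ⟨e1', e2', e3'⟩ := hφ' i hi k hk
    simp only [Plan.midpoint]
    refine ⟨fun c => ?_, fun c => ?_, fun c => ?_⟩
    · constructor <;> linarith [(e1 c).1, (e1 c).2, (e1' c).1, (e1' c).2]
    · constructor <;> linarith [(e2 c).1, (e2 c).2, (e2' c).1, (e2' c).2]
    · rw [e3 c, e3' c]; simp

/-- The parallelogram identity for the quadratic cost. For two optimal plans it forces the cost of
half the difference to be zero. -/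
lemma cost_midpoint_add_cost_halfDiff (z z' : Plan V L) :
    cost spec N (z.midpoint z') + cost spec N (z.halfDiff z')
      = (cost spec N z + cost spec N z') / 2 := by
  have key : ∀ (s : Finset V) (t : Finset ℕ) (f g f' g' : V → ℕ → ℝ),
      (∀ i k, f i k + g i k = (f' i k + g' i k) / 2) →
      ∑ i ∈ s, ∑ k ∈ t, f i k + ∑ i ∈ s, ∑ k ∈ t, g i k
        = (∑ i ∈ s, ∑ k ∈ t, f' i k + ∑ i ∈ s, ∑ k ∈ t, g' i k) / 2 := by
    intro s t f g f' g' hfg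
    rw [← Finset.sum_add_distrib, ← Finset.sum_add_distrib, Finset.sum_div]
    refine Finset.sum_congr rfl fun i _ => ?_
    rw [← Finset.sum_add_distrib, ← Finset.sum_add_distrib, Finset.sum_div]
    exact Finset.sum_congr rfl fun k _ => hfg i k
  have h1 := key spec.Iu (Finset.range N)
    (fun i k => spec.c i * (z.midpoint z').U k i ^ 2 + spec.d i * (z.midpoint z').B k i ^ 2)
    (fun i k => spec.c i * (z.halfDiff z').U k i ^ 2 + spec.d i * (z.halfDiff z').B k i ^ 2)
    (fun i k => spec.c i * z.U k i ^ 2 + spec.d i * z.B k i ^ 2)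
    (fun i k => spec.c i * z'.U k i ^ 2 + spec.d i * z'.B k i ^ 2)
    (fun i k => by simp only [Plan.midpoint, Plan.halfDiff]; ring)
  have h2 := key spec.Iω (Finset.Icc 1 N)
    (fun i k => spec.e i * (z.midpoint z').Γ k i ^ 2)
    (fun i k => spec.e i * (z.halfDiff z').Γ k i ^ 2)
    (fun i k => spec.e i * z.Γ k i ^ 2) (fun i k => spec.e i * z'.Γ k i ^ 2)
    (fun i k => by simp only [Plan.midpoint, Plan.halfDiff]; ring)
  simp only [cost]
  linarith

lemma cost_term_nonneg (z : Plan V L) {i : V} (hi : i ∈ spec.Iu) (k : ℕ) :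
    0 ≤ spec.c i * z.U k i ^ 2 + spec.d i * z.B k i ^ 2 := by
  obtain ⟨h1, h2⟩ := spec.weights_pos i hi
  positivity

lemma cost_freq_term_nonneg (z : Plan V L) {i : V} (hi : i ∈ spec.Iω) (k : ℕ) :
    0 ≤ spec.e i * z.Γ k i ^ 2 := by
  have := spec.freq_weights_pos i hi
  positivity

lemma input_le_cost (z : Plan V L) {i : V} (hi : i ∈ spec.Iu) {k : ℕ} (hk : k < N) :
    spec.c i * z.U k i ^ 2 + spec.d i * z.B k i ^ 2 ≤ cost spec N z := by
  have h1 : spec.c i * z.U k i ^ 2 + spec.d i * z.B k i ^ 2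
      ≤ ∑ k ∈ Finset.range N, (spec.c i * z.U k i ^ 2 + spec.d i * z.B k i ^ 2) :=
    Finset.single_le_sum (f := fun k => spec.c i * z.U k i ^ 2 + spec.d i * z.B k i ^ 2)
      (fun k _ => cost_term_nonneg z hi k) (Finset.mem_range.2 hk)
  have h2 := Finset.single_le_sum
    (f := fun i => ∑ k ∈ Finset.range N, (spec.c i * z.U k i ^ 2 + spec.d i * z.B k i ^ 2))
    (fun i hi => Finset.sum_nonneg fun k _ => cost_term_nonneg z hi k) hi
  have h3 : 0 ≤ ∑ i ∈ spec.Iω, ∑ k ∈ Finset.Icc 1 N, spec.e i * z.Γ k i ^ 2 :=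
    Finset.sum_nonneg fun i hi => Finset.sum_nonneg fun k _ => cost_freq_term_nonneg z hi k
  simp only [cost]
  linarith

lemma slack_le_cost (z : Plan V L) {i : V} (hi : i ∈ spec.Iω) {k : ℕ} (hk : k ∈ Finset.Icc 1 N) :
    spec.e i * z.Γ k i ^ 2 ≤ cost spec N z := by
  have h1 : spec.e i * z.Γ k i ^ 2 ≤ ∑ k ∈ Finset.Icc 1 N, spec.e i * z.Γ k i ^ 2 :=
    Finset.single_le_sum (f := fun k => spec.e i * z.Γ k i ^ 2)
      (fun k _ => cost_freq_term_nonneg z hi k) hk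
  have h2 := Finset.single_le_sum
    (f := fun i => ∑ k ∈ Finset.Icc 1 N, spec.e i * z.Γ k i ^ 2)
    (fun i hi => Finset.sum_nonneg fun k _ => cost_freq_term_nonneg z hi k) hi
  have h3 : 0 ≤ ∑ i ∈ spec.Iu, ∑ k ∈ Finset.range N,
      (spec.c i * z.U k i ^ 2 + spec.d i * z.B k i ^ 2) :=
    Finset.sum_nonneg fun i hi => Finset.sum_nonneg fun k _ => cost_term_nonneg z hi k
  simp only [cost]
  linarith

lemma cost_nonneg (z : Plan V L) : 0 ≤ cost spec N z :=
  add_nonneg (Finset.sum_nonneg fun _ hi => Finset.sum_nonneg fun k _ => cost_term_nonneg z hi k)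
    (Finset.sum_nonneg fun _ hi => Finset.sum_nonneg fun k _ => cost_freq_term_nonneg z hi k)

/-- Optimal inputs are unique. -/
lemma OptimalCvx.input_unique (h : OptimalCvx net spec T N P lam₀ ω₀ Ωr z)
    (h' : OptimalCvx net spec T N P lam₀ ω₀ Ωr z') {k : ℕ} (hk : k < N) : z.U k = z'.U k := by
  funext i
  by_cases hi : i ∈ spec.Iu
  · have h1 := h.2 _ (h.1.midpoint h'.1)
    have h2 := h'.2 _ (h.1.midpoint h'.1)
    have h3 := cost_midpoint_add_cost_halfDiff (spec := spec) (N := N) z z'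
    have h4 := input_le_cost (z.halfDiff z') hi hk
    have hw := spec.weights_pos i hi
    have h5 : 0 ≤ spec.d i * (z.halfDiff z').B k i ^ 2 := by have := hw.2; positivity
    have h6 : spec.c i * ((z.U k i - z'.U k i) / 2) ^ 2 ≤ 0 := by
      have : spec.c i * (z.halfDiff z').U k i ^ 2 ≤ 0 := by linarith
      exact this
    have h7 : ((z.U k i - z'.U k i) / 2) ^ 2 ≤ 0 := nonpos_of_mul_nonpos_right h6 hw.1
    have h8 : (z.U k i - z'.U k i) / 2 = 0 := pow_eq_zero_iff (two_ne_zero) |>.1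
      (le_antisymm h7 (sq_nonneg _))
    linarith
  · rw [h.1.1.available k hk i hi, h'.1.1.available k hk i hi]

/-! Existence of an optimal plan -/

/-- The plan with the entries that do not enter the problem set to zero. -/
def Plan.truncate (net : PowerNetwork V L) (spec : ControlSpec V) (N : ℕ) (z : Plan V L) :
    Plan V L where
  Λ k l := if k ≤ N then z.Λ k l else 0
  -- A terminal frequency without inertia and without frequency requirement occurs in no constraint
  -- and would be unbounded on the feasible set.
  Ω k i := if k < N ∨ k = N ∧ (net.M i ≠ 0 ∨ i ∈ spec.Iω) then z.Ω k i else 0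
  U k i := if k < N then z.U k i else 0
  B k i := if k < N ∧ i ∈ spec.Iu then z.B k i else 0
  Γ k i := if k ∈ Finset.Icc 1 N ∧ i ∈ spec.Iω then z.Γ k i else 0

lemma truncate_Λ {k : ℕ} (hk : k ≤ N) : (z.truncate net spec N).Λ k = z.Λ k := by
  funext l; simp [Plan.truncate, hk]

lemma truncate_Ω {k : ℕ} (hk : k < N) : (z.truncate net spec N).Ω k = z.Ω k := by
  funext l; simp [Plan.truncate, hk]

lemma truncate_Ω_apply {k : ℕ} (hk : k ≤ N) {i : V} (hi : net.M i ≠ 0 ∨ i ∈ spec.Iω) :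
    (z.truncate net spec N).Ω k i = z.Ω k i := by
  simp only [Plan.truncate]
  rw [if_pos]
  rcases hk.lt_or_eq with h | h
  · exact Or.inl h
  · exact Or.inr ⟨h, hi⟩

lemma truncate_U {k : ℕ} (hk : k < N) : (z.truncate net spec N).U k = z.U k := by
  funext l; simp [Plan.truncate, hk]

lemma truncate_B {k : ℕ} (hk : k < N) {i : V} (hi : i ∈ spec.Iu) :
    (z.truncate net spec N).B k i = z.B k i := by
  simp [Plan.truncate, hk, hi]

lemma truncate_Γ {k : ℕ} (hk : k ∈ Finset.Icc 1 N) {i : V} (hi : i ∈ spec.Iω) :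
    (z.truncate net spec N).Γ k i = z.Γ k i := by
  simp only [Plan.truncate]; rw [if_pos ⟨hk, hi⟩]

lemma cost_truncate : cost spec N (z.truncate net spec N) = cost spec N z := by
  simp only [cost]
  congr 1
  · refine Finset.sum_congr rfl fun i hi => Finset.sum_congr rfl fun k hk => ?_
    rw [truncate_U (Finset.mem_range.1 hk), truncate_B (Finset.mem_range.1 hk) hi]
  · refine Finset.sum_congr rfl fun i hi => Finset.sum_congr rfl fun k hk => ?_
    rw [truncate_Γ hk hi]

lemma FeasibleCvx.truncate (hN : 0 < N) (h : FeasibleCvx net spec T N P lam₀ ω₀ Ωr z) :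
    FeasibleCvx net spec T N P lam₀ ω₀ Ωr (z.truncate net spec N) := by
  obtain ⟨ha, hφ⟩ := h
  refine ⟨⟨?_, ?_, ?_, ?_, ?_, ?_, ?_, ?_, ?_⟩, ?_⟩
  · intro k hk
    rw [truncate_Λ hk, truncate_Λ hk.le, truncate_Ω hk]
    exact ha.angle k hk
  · intro k hk i
    have := ha.freq k hk i
    rw [truncate_Λ hk.le, truncate_Ω hk, truncate_U hk, ← this]
    by_cases hM : net.M i = 0
    · simp [hM]
    · rw [truncate_Ω_apply hk (Or.inl hM)]
  · rw [truncate_Λ hN.le]; exact ha.init_angle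
  · rw [truncate_Ω hN]; exact ha.init_freq
  · intro k hk
    rw [truncate_U hk]; exact ha.available k hk
  · intro i hi k hk
    rw [truncate_U hk, truncate_B hk hi]; exact ha.magnitude i hi k hk
  · intro i hi k hk
    rw [truncate_B hk hi]; exact ha.slack_B i hi k hk
  · intro i hi k hk
    rw [truncate_Γ hk hi, truncate_Ω_apply (Finset.mem_Icc.1 hk).2 (Or.inr hi)]
    exact ha.safe i hi k hk
  · intro i hi k hk
    rw [truncate_Γ hk hi]; exact ha.slack_Γ i hi k hk
  · intro i hi k hk
    rw [truncate_U hk, truncate_Ω hk]; exact hφ i hi k hk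

/-- Bounded inputs lead to bounded states. -/
lemma exists_state_bound (hT : 0 < T) (C : ℝ) (hC : 0 ≤ C) (k : ℕ) : ∃ r, 0 ≤ r ∧
    ∀ z : Plan V L, Admissible net spec T N P lam₀ ω₀ z → (∀ k < N, ∀ i, |z.U k i| ≤ C) →
      (k ≤ N → ∀ l, |z.Λ k l| ≤ r) ∧ (k < N → ∀ i, |z.Ω k i| ≤ r) ∧
      (k ≤ N → ∀ i, net.M i ≠ 0 → |z.Ω k i| ≤ r) := by
  have hb := sum_b_nonneg net
  set S := ∑ l, net.b l
  induction k with
  | zero =>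
    have hs : 0 ≤ ∑ i, |ω₀ i| := Finset.sum_nonneg fun i _ => abs_nonneg _
    refine ⟨1 + ∑ i, |ω₀ i|, by positivity, fun z ha _ => ?_⟩
    have h2 : ∀ i, |z.Ω 0 i| ≤ 1 + ∑ i, |ω₀ i| := fun i => by
      rw [ha.init_freq]
      have := Finset.single_le_sum (f := fun i => |ω₀ i|) (fun i _ => abs_nonneg _)
        (Finset.mem_univ i)
      linarith
    refine ⟨fun _ l => ?_, fun _ => h2, fun _ i _ => h2 i⟩
    rw [ha.init_angle]
    exact (Real.abs_sin_le_one _).trans (by linarith)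
  | succ k ih =>
    obtain ⟨r, hr, hz⟩ := ih
    -- `r₁` bounds the next angles; `f` comes from solving the algebraic equation at buses without
    -- inertia, `g` from the Euler step at the others.
    set r₁ := r + T * (r + r) with hr₁
    have hr₁0 : 0 ≤ r₁ := by positivity
    set f := fun i => (|P (k + 1) i| + S * r₁ + C) / net.E i with hf
    set g := fun i => r + T / net.M i * (net.E i * r + S * r + |P k i| + C) with hg
    have hf0 : ∀ i ∈ Finset.univ, 0 ≤ f i := fun i _ => by
      have := net.E_pos i; positivity
    have hg0 : ∀ i ∈ Finset.univ, 0 ≤ g i := fun i _ => by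
      have := net.E_pos i; have := net.M_nonneg i; positivity
    have hfs := Finset.sum_nonneg hf0
    have hgs := Finset.sum_nonneg hg0
    refine ⟨r₁ + ∑ i, f i + ∑ i, g i, by positivity, fun z ha hU => ?_⟩
    obtain ⟨z1, z2, z3⟩ := hz z ha hU
    have c1 : k + 1 ≤ N → ∀ l, |z.Λ (k + 1) l| ≤ r₁ := by
      intro hk l
      have h1 := z1 (by omega) l
      have h2 := z2 (by omega) (net.pos l)
      have h3 := z2 (by omega) (net.neg l)
      rw [ha.angle k (by omega), Pi.add_apply, Pi.smul_apply, smul_eq_mul, D_mulVec_apply]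
      refine (abs_add_le _ _).trans ?_
      rw [abs_mul, abs_of_pos hT]
      have := abs_sub (z.Ω k (net.pos l)) (z.Ω k (net.neg l))
      have : T * |z.Ω k (net.pos l) - z.Ω k (net.neg l)| ≤ T * (r + r) := by
        gcongr; linarith
      linarith
    have c3 : k + 1 ≤ N → ∀ i, net.M i ≠ 0 → |z.Ω (k + 1) i| ≤ g i := by
      intro hk i hM
      have hM' := lt_of_le_of_ne (net.M_nonneg i) (Ne.symm hM)
      have e := ha.freq k (by omega) i
      have e1 := z2 (by omega) i
      have e2 := abs_residual_le net (z1 (by omega)) (z.Ω k) (P k) i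
      have e3 := hU k (by omega) i
      have e4 : z.Ω (k + 1) i = z.Ω k i
          + T / net.M i * (net.residual (z.Λ k) (z.Ω k) (P k) i + z.U k i) := by
        rw [← e]; field_simp; ring
      rw [e4]
      refine (abs_add_le _ _).trans ?_
      rw [abs_mul, abs_of_pos (div_pos hT hM'), hg]
      have e5 := abs_add_le (net.residual (z.Λ k) (z.Ω k) (P k) i) (z.U k i)
      have e6 : net.E i * |z.Ω k i| ≤ net.E i * r :=
        mul_le_mul_of_nonneg_left e1 (net.E_pos i).le
      have e7 : |net.residual (z.Λ k) (z.Ω k) (P k) i + z.U k i|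
        ≤ net.E i * r + S * r + |P k i| + C := by linarith
      exact add_le_add (z3 (by omega) i hM)
        (mul_le_mul_of_nonneg_left e7 (div_nonneg hT.le hM'.le))
    have c2 : k + 1 < N → ∀ i, net.M i = 0 → |z.Ω (k + 1) i| ≤ f i := by
      intro hk i hM
      have hE := net.E_pos i
      have e := ha.freq (k + 1) hk i
      rw [hM, zero_mul, zero_div, residual_eq] at e
      have e1 := abs_outflow_le net (c1 hk.le) i
      have e2 := hU (k + 1) hk i
      have e3 : z.Ω (k + 1) i
          = ((P (k + 1) i - net.outflow (z.Λ (k + 1)) i) + z.U (k + 1) i) / net.E i := by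
        field_simp; linarith
      rw [e3, abs_div, abs_of_pos hE, hf]
      have e4 := abs_add_le (P (k + 1) i - net.outflow (z.Λ (k + 1)) i) (z.U (k + 1) i)
      have e5 := abs_sub (P (k + 1) i) (net.outflow (z.Λ (k + 1)) i)
      simp only
      gcongr
      linarith
    have c3' : k + 1 ≤ N → ∀ i, net.M i ≠ 0 → |z.Ω (k + 1) i| ≤ r₁ + ∑ i, f i + ∑ i, g i := by
      intro hk i hM
      have := c3 hk i hM
      have := Finset.single_le_sum hg0 (Finset.mem_univ i)
      linarith
    refine ⟨fun hk l => (c1 hk l).trans (by linarith), fun hk i => ?_, c3'⟩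
    by_cases hM : net.M i = 0
    · have := c2 hk i hM
      have := Finset.single_le_sum hf0 (Finset.mem_univ i)
      linarith
    · exact c3' hk.le i hM

/-- From `|x| ≤ 1 + x²`. A crude bound without square roots is enough for compactness. -/
lemma abs_le_of_mul_sq_le {a x y : ℝ} (ha : 0 < a) (h : a * x ^ 2 ≤ y) : |x| ≤ 1 + y / a := by
  have h1 : x ^ 2 ≤ y / a := by rw [le_div_iff₀ ha]; linarith
  rw [← sq_abs] at h1
  nlinarith [sq_nonneg (|x| - 1), abs_nonneg x]

/-- Feasible plans of bounded cost can be truncated to plans in a fixed box. -/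
lemma exists_plan_bound (hT : 0 < T) (hN : 0 < N) (K : ℝ) (hK : 0 ≤ K) : ∃ R, 0 ≤ R ∧
    ∀ z : Plan V L, Admissible net spec T N P lam₀ ω₀ z → cost spec N z ≤ K →
      (∀ k l, |(z.truncate net spec N).Λ k l| ≤ R) ∧ (∀ k i, |(z.truncate net spec N).Ω k i| ≤ R) ∧
      (∀ k i, |(z.truncate net spec N).U k i| ≤ R) ∧ (∀ k i, |(z.truncate net spec N).B k i| ≤ R) ∧
      (∀ k i, |(z.truncate net spec N).Γ k i| ≤ R) := by
  set C := 1 + (∑ i ∈ spec.Iu, (K / spec.c i + K / spec.d i) + ∑ i ∈ spec.Iω, K / spec.e i) with hCdef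
  have hu0 : ∀ i ∈ spec.Iu, 0 ≤ K / spec.c i + K / spec.d i := fun i hi => by
    obtain ⟨h1, h2⟩ := spec.weights_pos i hi; positivity
  have he0 : ∀ i ∈ spec.Iω, 0 ≤ K / spec.e i := fun i hi => by
    have := spec.freq_weights_pos i hi; positivity
  have hus := Finset.sum_nonneg hu0
  have hes := Finset.sum_nonneg he0
  have hC : 0 ≤ C := by positivity
  choose r hr0 hr using fun k =>
    exists_state_bound (net := net) (spec := spec) (N := N) (P := P) (lam₀ := lam₀) (ω₀ := ω₀)
      hT C hC k
  set Rs := ∑ k ∈ Finset.range (N + 1), r k with hRs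
  have hRs0 : 0 ≤ Rs := Finset.sum_nonneg fun k _ => hr0 k
  have hRk : ∀ k ≤ N, r k ≤ Rs := fun k hk =>
    Finset.single_le_sum (fun k _ => hr0 k) (Finset.mem_range.2 (by omega))
  set W := ∑ i, (|spec.ωlo i| + |spec.ωhi i| + |spec.δ i|) with hW
  have hW0 : ∀ i ∈ Finset.univ, 0 ≤ |spec.ωlo i| + |spec.ωhi i| + |spec.δ i| :=
    fun i _ => by positivity
  have hWs := Finset.sum_nonneg hW0
  refine ⟨C + Rs + W, by positivity, fun z ha hz => ?_⟩
  have bU : ∀ k < N, ∀ i, |z.U k i| ≤ C := by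
    intro k hk i
    by_cases hi : i ∈ spec.Iu
    · have hw := spec.weights_pos i hi
      have h1 := input_le_cost z hi hk
      have h2 : 0 ≤ spec.d i * z.B k i ^ 2 := by have := hw.2; positivity
      have h3 := abs_le_of_mul_sq_le hw.1 (show spec.c i * z.U k i ^ 2 ≤ K by linarith)
      have h4 := Finset.single_le_sum hu0 hi
      have h5 : 0 ≤ K / spec.d i := div_nonneg hK hw.2.le
      linarith
    · rw [ha.available k hk i hi, abs_zero]; exact hC
  have bB : ∀ k < N, ∀ i ∈ spec.Iu, |z.B k i| ≤ C := by
    intro k hk i hi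
    have hw := spec.weights_pos i hi
    have h1 := input_le_cost z hi hk
    have h2 : 0 ≤ spec.c i * z.U k i ^ 2 := by have := hw.1; positivity
    have h3 := abs_le_of_mul_sq_le hw.2 (show spec.d i * z.B k i ^ 2 ≤ K by linarith)
    have h4 := Finset.single_le_sum hu0 hi
    have h5 : 0 ≤ K / spec.c i := div_nonneg hK hw.1.le
    linarith
  have bΓ : ∀ i ∈ spec.Iω, ∀ k ∈ Finset.Icc 1 N, |z.Γ k i| ≤ C := by
    intro i hi k hk
    have h3 := abs_le_of_mul_sq_le (spec.freq_weights_pos i hi) ((slack_le_cost z hi hk).trans hz)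
    have h4 := Finset.single_le_sum he0 hi
    linarith
  have hR : 0 ≤ C + Rs + W := by positivity
  refine ⟨fun k l => ?_, fun k i => ?_, fun k i => ?_, fun k i => ?_, fun k i => ?_⟩ <;>
    simp only [Plan.truncate] <;> split_ifs with hc <;> try (rw [abs_zero]; exact hR)
  · have h1 := (hr k z ha bU).1 hc l
    have h2 := hRk k hc
    linarith
  · rcases hc with hc | ⟨rfl, hc⟩
    · have h1 := (hr k z ha bU).2.1 hc i
      have h2 := hRk k hc.le
      linarith
    rcases hc with hc | hc
    · have h1 := (hr k z ha bU).2.2 le_rfl i hc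
      have h2 := hRk k le_rfl
      linarith
    -- The dynamics do not bound this terminal frequency; its safety constraint does, since the
    -- slack is bounded by the cost.
    · have hk : k ∈ Finset.Icc 1 k := Finset.mem_Icc.2 ⟨hN, le_rfl⟩
      have h1 := ha.safe i hc k hk
      have h2 := ha.slack_Γ i hc k hk
      have h3 := le_abs_self (z.Γ k i)
      have h4 := bΓ i hc k hk
      have h5 := Finset.single_le_sum hW0 (Finset.mem_univ i)
      have h6 := neg_abs_le (spec.ωlo i)
      have h7 := le_abs_self (spec.ωhi i)
      have h8 := neg_abs_le (spec.δ i)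
      have h9 := le_abs_self (spec.δ i)
      have h10 := abs_nonneg (spec.ωlo i)
      have h11 := abs_nonneg (spec.ωhi i)
      have h12 := abs_nonneg (spec.δ i)
      simp only [ControlSpec.kappa] at h1
      rw [abs_le]
      split_ifs at h1 <;> constructor <;> linarith [h1.1, h1.2]
  · have := bU k hc i
    linarith
  · have := bB k hc.1 i hc.2
    linarith
  · have := bΓ i hc.2 k hc.1
    linarith

/-- Assemble a plan from its components. -/
def Plan.ofTuple (x : (ℕ → L → ℝ) × (ℕ → V → ℝ) × (ℕ → V → ℝ) × (ℕ → V → ℝ) × (ℕ → V → ℝ)) :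
    Plan V L :=
  ⟨x.1, x.2.1, x.2.2.1, x.2.2.2.1, x.2.2.2.2⟩

/-- Coordinates are continuous in the product topology, and conditions on `Ωr` do not involve the
plan, so the set is an intersection of closed sets given by equations and weak inequalities. -/
lemma isClosed_feasibleCvx :
    IsClosed {x | FeasibleCvx net spec T N P lam₀ ω₀ Ωr (Plan.ofTuple (V := V) (L := L) x)} := by
  have key : ∀ z : Plan V L, FeasibleCvx net spec T N P lam₀ ω₀ Ωr z ↔
      (∀ k < N, ∀ l, z.Λ (k + 1) l = z.Λ k l + T * (z.Ω k (net.pos l) - z.Ω k (net.neg l))) ∧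
      (∀ k < N, ∀ i, net.M i * (z.Ω (k + 1) i - z.Ω k i) / T = -(net.E i * z.Ω k i)
        + (P k i - ∑ l, net.D l i * (net.b l * z.Λ k l)) + z.U k i) ∧
      z.Λ 0 = sinVec lam₀ ∧ z.Ω 0 = ω₀ ∧ (∀ k < N, ∀ i ∉ spec.Iu, z.U k i = 0) ∧
      (∀ i ∈ spec.Iu, ∀ k < N, spec.uMin i - spec.xi i * z.B k i ≤ z.U k i ∧
        z.U k i ≤ spec.uMax i + spec.xi i * z.B k i) ∧
      (∀ i ∈ spec.Iu, ∀ k < N, 0 ≤ z.B k i) ∧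
      (∀ i ∈ spec.Iω, ∀ k ∈ Finset.Icc 1 N,
        spec.ωlo i - spec.kappa ω₀ i * (z.Γ k i - spec.δ i) ≤ z.Ω k i ∧
          z.Ω k i ≤ spec.ωhi i + spec.kappa ω₀ i * (z.Γ k i - spec.δ i)) ∧
      (∀ i ∈ spec.Iω, ∀ k ∈ Finset.Icc 1 N, 0 ≤ z.Γ k i) ∧
      (∀ i ∈ spec.Iu, ∀ k < N,
        (spec.thrHi i ≤ Ωr k i → spec.thrHi i ≤ z.Ω k i ∧ z.U k i ≤ 0) ∧
        (Ωr k i ≤ spec.thrLo i → z.Ω k i ≤ spec.thrLo i ∧ 0 ≤ z.U k i) ∧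
        (spec.thrLo i < Ωr k i ∧ Ωr k i < spec.thrHi i → z.U k i = 0)) := by
    intro z
    have h1 : (∀ k < N, z.Λ (k + 1) = z.Λ k + T • net.D.mulVec (z.Ω k)) ↔
        ∀ k < N, ∀ l, z.Λ (k + 1) l = z.Λ k l + T * (z.Ω k (net.pos l) - z.Ω k (net.neg l)) := by
      simp [funext_iff, D_mulVec_apply]
    rw [← h1]
    simp only [← outflow_eq_sum, ← residual_eq]
    exact ⟨fun ⟨⟨a1, a2, a3, a4, a5, a6, a7, a8, a9⟩, a10⟩ =>
        ⟨a1, a2, a3, a4, a5, a6, a7, a8, a9, a10⟩,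
      fun ⟨a1, a2, a3, a4, a5, a6, a7, a8, a9, a10⟩ =>
        ⟨⟨a1, a2, a3, a4, a5, a6, a7, a8, a9⟩, a10⟩⟩
  simp only [key, Plan.ofTuple, Set.ofPred_and, Set.ofPred_forall]
  repeat' apply IsClosed.inter
  all_goals
    repeat' (first | apply IsClosed.inter | (apply isClosed_iInter; intro))
  all_goals first
    | exact isClosed_eq (by fun_prop) (by fun_prop)
    | exact isClosed_le (by fun_prop) (by fun_prop)

lemma continuous_cost_ofTuple :
    Continuous fun x => cost spec N (Plan.ofTuple (V := V) (L := L) x) := by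
  simp only [cost, Plan.ofTuple]
  fun_prop

/-- If the convexified problem is feasible, it has an optimal solution. -/
lemma exists_optimalCvx (hT : 0 < T) (hN : 0 < N)
    (h : ∃ z, FeasibleCvx net spec T N P lam₀ ω₀ Ωr z) :
    ∃ z, OptimalCvx net spec T N P lam₀ ω₀ Ωr z := by
  obtain ⟨z₀, hz₀⟩ := h
  obtain ⟨R, hR, hbox⟩ := exists_plan_bound (net := net) (spec := spec) (P := P) (lam₀ := lam₀)
    (ω₀ := ω₀) hT hN (cost spec N z₀) (cost_nonneg z₀)
  let BL : Set (ℕ → L → ℝ) := univ.pi fun _ => univ.pi fun _ => Icc (-R) R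
  let BV : Set (ℕ → V → ℝ) := univ.pi fun _ => univ.pi fun _ => Icc (-R) R
  -- The time index ranges over all of `ℕ`, yet the box is compact by Tychonoff. Truncation brings
  -- every plan at most as costly as `z₀` into it without changing the cost; costlier plans are
  -- compared with `z₀` itself.
  let S := (BL ×ˢ BV ×ˢ BV ×ˢ BV ×ˢ BV) ∩
    {x | FeasibleCvx net spec T N P lam₀ ω₀ Ωr (Plan.ofTuple x)}
  have hL : IsCompact BL := isCompact_univ_pi fun _ => isCompact_univ_pi fun _ => isCompact_Icc
  have hV : IsCompact BV := isCompact_univ_pi fun _ => isCompact_univ_pi fun _ => isCompact_Icc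
  have hc : IsCompact S :=
    (hL.prod (hV.prod (hV.prod (hV.prod hV)))).inter_right isClosed_feasibleCvx
  have hmem : ∀ z : Plan V L, FeasibleCvx net spec T N P lam₀ ω₀ Ωr z →
      cost spec N z ≤ cost spec N z₀ → ∃ x ∈ S, Plan.ofTuple x = z.truncate net spec N := by
    intro z hz hle
    obtain ⟨b1, b2, b3, b4, b5⟩ := hbox z hz.1 hle
    refine ⟨((z.truncate net spec N).Λ, (z.truncate net spec N).Ω, (z.truncate net spec N).U,
      (z.truncate net spec N).B, (z.truncate net spec N).Γ), ⟨⟨?_, ?_, ?_, ?_, ?_⟩,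
      hz.truncate hN⟩, rfl⟩
    · exact fun k _ l _ => abs_le.1 (b1 k l)
    · exact fun k _ i _ => abs_le.1 (b2 k i)
    · exact fun k _ i _ => abs_le.1 (b3 k i)
    · exact fun k _ i _ => abs_le.1 (b4 k i)
    · exact fun k _ i _ => abs_le.1 (b5 k i)
  obtain ⟨x₀, hx₀, hx₀z⟩ := hmem z₀ hz₀ le_rfl
  obtain ⟨x, hx, hmin⟩ := hc.exists_isMinOn ⟨x₀, hx₀⟩
    (continuous_cost_ofTuple (spec := spec) (N := N)).continuousOn
  refine ⟨Plan.ofTuple x, hx.2, fun z hz => ?_⟩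
  rcases le_total (cost spec N z) (cost spec N z₀) with hle | hle
  · obtain ⟨y, hy, hyz⟩ := hmem z hz hle
    have : cost spec N (Plan.ofTuple x) ≤ cost spec N (Plan.ofTuple y) := hmin hy
    rwa [hyz, cost_truncate] at this
  · have : cost spec N (Plan.ofTuple x) ≤ cost spec N (Plan.ofTuple x₀) := hmin hx₀
    rw [hx₀z, cost_truncate] at this
    exact this.trans hle

lemma PhiCvx.congr {Ωr Ωr' Ω U : ℕ → V → ℝ} (hΩ : ∀ k < N, Ωr k = Ωr' k)
    (h : PhiCvx spec N Ωr Ω U) : PhiCvx spec N Ωr' Ω U := by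
  intro i hi k hk
  rw [← hΩ k hk]
  exact h i hi k hk

/-- Only reference frequencies before the terminal step enter the problem, and these are unique; so
the first input does not depend on the choice of the reference. -/
lemma OptimalCvx.congr {Ωr Ωr' : ℕ → V → ℝ} (hΩ : ∀ k < N, Ωr k = Ωr' k)
    (h : OptimalCvx net spec T N P lam₀ ω₀ Ωr z) : OptimalCvx net spec T N P lam₀ ω₀ Ωr' z :=
  ⟨⟨h.1.1, h.1.2.congr hΩ⟩, fun z' hz' => h.2 z' ⟨hz'.1, hz'.2.congr fun k hk => (hΩ k hk).symm⟩⟩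

/-- If a generated reference trajectory exists, the first input is well defined. -/
lemma existsUnique_isFirstInput (hT : 0 < T) (hN : 0 < N)
    (h : ∃ Λr Ωr Ur, IsGeneratedReference net spec T N P lam₀ ω₀ Λr Ωr Ur) :
    ∃! u₀, IsFirstInput net spec T N P lam₀ ω₀ u₀ := by
  obtain ⟨Λr, Ωr, Ur, href⟩ := h
  obtain ⟨z, hz⟩ := exists_optimalCvx hT hN href.1.exists_feasibleCvx
  refine ⟨z.U 0, ⟨Λr, Ωr, Ur, href, z, hz, rfl⟩, ?_⟩
  rintro u ⟨Λr', Ωr', Ur', href', z', hz', rfl⟩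
  exact (hz'.congr (href'.unique hT href)).input_unique hz hN

end Optimization

/-! ### From a region to the full network. -/

section Regions

variable {V L : Type*} [Fintype V] [DecidableEq V] [Fintype L] [DecidableEq L]

variable (net : PowerNetwork V L) (spec : ControlSpec V)

lemma sum_subtype_eq_sum_ite (q : L → Prop) [DecidablePred q] (f : L → ℝ) :
    ∑ l : {l // q l}, f l = ∑ l, if q l then f l else 0 := by
  rw [← Finset.sum_filter]
  exact (Finset.sum_subtype (Finset.univ.filter q) (fun l => by simp) f).symm

/-- Lines inside the region contribute equally to both outflows; the lines that leave the region are
missing in the induced network, and the boundary flow supplies them. Hence at the current instant a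
region sees the true power balance of its buses. -/
lemma induce_outflow (S : Finset V) (lam : L → ℝ) {i : V} (hi : i ∈ S) :
    (net.induce S).outflow (sinVec fun l => lam l.1) ⟨i, hi⟩ - net.boundaryFlow S lam i
      = net.outflow (sinVec lam) i := by
  have hD : ∀ l : {l // net.pos l ∈ S ∧ net.neg l ∈ S},
      (net.induce S).D l ⟨i, hi⟩ = net.D l.1 i := by
    intro l
    simp [PowerNetwork.D, PowerNetwork.induce, Subtype.ext_iff]
  have h1 : (net.induce S).outflow (sinVec fun l => lam l.1) ⟨i, hi⟩
      = ∑ l, if net.pos l ∈ S ∧ net.neg l ∈ S then net.D l i * (net.b l * Real.sin (lam l)) else 0 := by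
    rw [outflow_eq_sum, ← sum_subtype_eq_sum_ite (fun l => net.pos l ∈ S ∧ net.neg l ∈ S)
      (fun l => net.D l i * (net.b l * Real.sin (lam l)))]
    exact Finset.sum_congr rfl fun l _ => by rw [hD]; rfl
  rw [h1, outflow_eq_sum, PowerNetwork.boundaryFlow, Finset.sum_filter, Finset.sum_filter,
    ← Finset.sum_sub_distrib, ← Finset.sum_sub_distrib]
  refine Finset.sum_congr rfl fun l _ => ?_
  have hne := net.pos_ne_neg l
  simp only [PowerNetwork.D, Matrix.of_apply, sinVec]
  by_cases h1 : net.pos l = i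
  · have h2 : net.neg l ≠ i := fun h => hne (h1.trans h.symm)
    by_cases h3 : net.neg l ∈ S <;> simp [h1, h2, h3, hi]
  · by_cases h2 : net.neg l = i
    · by_cases h3 : net.pos l ∈ S <;> simp [h1, Ne.symm h1, h2, h3, hi]
    · simp [h1, h2, Ne.symm h1, Ne.symm h2]

lemma induce_residual (S : Finset V) (lam : L → ℝ) (w q : V → ℝ) {i : V} (hi : i ∈ S) :
    (net.induce S).residual (sinVec fun l => lam l.1) (fun j => w j.1)
      (fun j => net.boundaryFlow S lam j.1 + q j.1) ⟨i, hi⟩ = net.residual (sinVec lam) w q i := by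
  rw [residual_eq, residual_eq, ← induce_outflow net S lam hi]
  simp only [PowerNetwork.induce]
  ring

lemma restrict_refInput (S : Finset V) (lam : L → ℝ) (w q : V → ℝ) {i : V} (hi : i ∈ S) :
    refInput (net.induce S) (spec.restrict S) (sinVec fun l => lam l.1) (fun j => w j.1)
      (fun j => net.boundaryFlow S lam j.1 + q j.1) ⟨i, hi⟩
      = refInput net spec (sinVec lam) w q i := by
  simp only [refInput, induce_residual, ControlSpec.rawRef, ControlSpec.restrict,
    Finset.mem_subtype]

lemma regionForecast_zero (S : Finset V) {fc : ℝ → ℝ → V → ℝ} {p : ℝ → V → ℝ} {t : ℝ}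
    (hfc : fc t t = p t) (T : ℝ) (lam : L → ℝ) :
    regionForecast net S fc T t lam 0 = fun j => net.boundaryFlow S lam j.1 + p t j.1 := by
  funext j
  simp [regionForecast, hfc]

lemma abs_boundaryFlow_le (S : Finset V) (lam : L → ℝ) (i : V) :
    |net.boundaryFlow S lam i| ≤ 2 * ∑ l, net.b l := by
  have key : ∀ s : Finset L, |∑ l ∈ s, net.b l * Real.sin (lam l)| ≤ ∑ l, net.b l := by
    intro s
    refine (Finset.abs_sum_le_sum_abs _ _).trans ?_
    refine (Finset.sum_le_univ_sum_of_nonneg fun l => abs_nonneg _).trans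
      (Finset.sum_le_sum fun l _ => ?_)
    rw [abs_mul, abs_of_pos (net.b_pos l)]
    exact mul_le_of_le_one_right (net.b_pos l).le (Real.abs_sin_le_one _)
  refine (abs_sub _ _).trans ?_
  rw [two_mul]
  exact add_le_add (key _) (key _)

lemma horizon_pos {h T : ℝ} (hh : 0 < h) (hT : 0 < T) : 0 < ⌈h / T⌉₊ :=
  Nat.ceil_pos.2 (div_pos hh hT)

/-- The controller is well defined for short sampling lengths. -/
theorem eventually_existsUnique_isRegionInput {p : ℝ → V → ℝ} {fc : ℝ → ℝ → V → ℝ}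
    (hfc : ∀ t, 0 ≤ t → fc t t = p t) {h : ℝ} (hh : 0 < h) (S : Finset V) (ρ : ℝ) :
    ∀ᶠ T in 𝓝[>] (0 : ℝ), ∀ t, 0 ≤ t → (∀ τ ∈ Icc t (t + h), ∀ i, |fc t τ i| ≤ ρ) →
      ∀ (lam : L → ℝ) (w : V → ℝ), (∀ i, |w i| ≤ ρ) → IsConsistent net spec (p t) lam w →
      ∃! u₀, IsRegionInput net spec fc h T S t lam w u₀ := by
  -- The injection seen by a region is the forecast plus the boundary flow, and the latter is at
  -- most `2 * ∑ b`.
  filter_upwards [eventually_isGeneratedReference (net.induce S) (spec.restrict S)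
    (2 * (∑ l, net.b l) + ρ) h, self_mem_nhdsWithin] with T hT hT0 t ht hρ lam w hw hcons
  replace hT0 : 0 < T := hT0
  refine existsUnique_isFirstInput hT0 (horizon_pos hh hT0) (hT _ _ _ ?_ ?_ ?_)
  · intro i
    have := hw i.1
    have := sum_b_nonneg net
    linarith
  · intro k hk i
    have h1 : (k : ℝ) * T < h := by rw [← lt_div_iff₀ hT0]; exact Nat.lt_ceil.1 hk
    have h2 : 0 ≤ (k : ℝ) * T := by positivity
    exact (abs_add_le _ _).trans (add_le_add (abs_boundaryFlow_le net S lam i.1)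
      (hρ _ ⟨by linarith, by linarith⟩ i.1))
  · rintro ⟨i, hi⟩ hM
    rw [regionForecast_zero net S (hfc t ht), induce_residual, restrict_refInput]
    exact hcons i hM

variable {net spec} {S : Finset V} {fc : ℝ → ℝ → V → ℝ} {p : ℝ → V → ℝ} {h T t : ℝ}
  {lam : L → ℝ} {w : V → ℝ} {u₀ : {i // i ∈ S} → ℝ}

/-- The sign and threshold conditions on the input of a region. -/
lemma IsRegionInput.sign (hN : 0 < ⌈h / T⌉₊)
    (hu : IsRegionInput net spec fc h T S t lam w u₀) {i : V} (hi : i ∈ S) (hiu : i ∈ spec.Iu) :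
    (spec.thrHi i ≤ w i → u₀ ⟨i, hi⟩ ≤ 0) ∧ (w i ≤ spec.thrLo i → 0 ≤ u₀ ⟨i, hi⟩) ∧
      (spec.thrLo i < w i ∧ w i < spec.thrHi i → u₀ ⟨i, hi⟩ = 0) := by
  obtain ⟨Λr, Ωr, Ur, ⟨⟨B, Γ, hr, -⟩, -⟩, z, hz, rfl⟩ := hu
  have h0 : Ωr 0 ⟨i, hi⟩ = w i := congrFun hr.init_freq ⟨i, hi⟩
  obtain ⟨c1, c2, c3⟩ := hz.1.2 ⟨i, hi⟩ (Finset.mem_subtype.2 hiu) 0 hN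
  rw [h0] at c1 c2 c3
  exact ⟨fun c => (c1 c).2, fun c => (c2 c).2, c3⟩

/-- Where a region computes an input, the state satisfies the algebraic equations under the
reference feedback. -/
lemma IsRegionInput.balance (hN : 0 < ⌈h / T⌉₊) (hfc : fc t t = p t)
    (hu : IsRegionInput net spec fc h T S t lam w u₀) {i : V} (hi : i ∈ S) (hM : net.M i = 0) :
    net.residual (sinVec lam) w (p t) i + refInput net spec (sinVec lam) w (p t) i = 0 := by
  obtain ⟨Λr, Ωr, Ur, ⟨⟨B, Γ, hr, -⟩, hU⟩, -⟩ := hu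
  have e := hr.freq 0 hN ⟨i, hi⟩
  have hM' : (net.induce S).M ⟨i, hi⟩ = 0 := hM
  simp only [hM', zero_mul, zero_div] at e
  rw [hU 0 hN] at e
  have h1 : Λr 0 = _ := hr.init_angle
  have h2 : Ωr 0 = _ := hr.init_freq
  rw [h1, h2, regionForecast_zero net S hfc, induce_residual, restrict_refInput] at e
  exact e.symm

/-- Inside the safe interval of a soft bus, the input keeps the Euler step in the interval. -/
lemma IsRegionInput.rate_mem (hN : 0 < ⌈h / T⌉₊) (hT : 0 < T) (hfc : fc t t = p t)
    (hu : IsRegionInput net spec fc h T S t lam w u₀) {i : V} (hi : i ∈ S) (hiω : i ∈ spec.Iω)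
    (hs : spec.ξ i = true) (hw : w i ∈ Icc (spec.ωlo i) (spec.ωhi i)) :
    net.M i * (spec.ωlo i - w i) / T ≤ net.residual (sinVec lam) w (p t) i + u₀ ⟨i, hi⟩ ∧
      net.residual (sinVec lam) w (p t) i + u₀ ⟨i, hi⟩ ≤ net.M i * (spec.ωhi i - w i) / T := by
  obtain ⟨Λr, Ωr, Ur, -, z, ⟨⟨hz, -⟩, -⟩, rfl⟩ := hu
  have e := hz.freq 0 hN ⟨i, hi⟩
  rw [hz.init_angle, hz.init_freq, regionForecast_zero net S hfc, induce_residual] at e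
  -- With the switch off, the constraint at step `1` allows no slack; as `N` is positive, this step
  -- belongs to the horizon.
  have hk : (spec.restrict S).kappa (fun j => w j.1) ⟨i, hi⟩ = 0 := if_pos ⟨hw, hs⟩
  have hsafe := hz.safe ⟨i, hi⟩ (Finset.mem_subtype.2 hiω) 1 (Finset.mem_Icc.2 ⟨le_rfl, hN⟩)
  rw [hk, zero_mul, sub_zero, add_zero] at hsafe
  have h1 : spec.ωlo i ≤ z.Ω (0 + 1) ⟨i, hi⟩ := hsafe.1
  have h2 : z.Ω (0 + 1) ⟨i, hi⟩ ≤ spec.ωhi i := hsafe.2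
  have hM := net.M_nonneg i
  have e' : net.M i * (z.Ω (0 + 1) ⟨i, hi⟩ - w i) / T
    = net.residual (sinVec lam) w (p t) i + z.U 0 ⟨i, hi⟩ := e
  rw [← e']
  constructor <;> gcongr

end Regions

/-! ### Calculus of indefinite integrals and Barbalat-type lemmas. -/

section Integral

/-- Energy identity for the square of an indefinite integral. -/
lemma sq_sub_sq_eq_integral {x g : ℝ → ℝ} {a b : ℝ} (hab : a ≤ b)
    (hg : IntervalIntegrable g volume a b) (hx : ∀ t ∈ Icc a b, x t = x a + ∫ s in a..t, g s) :
    x b ^ 2 - x a ^ 2 = 2 * ∫ s in a..b, x s * g s := by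
  set G : ℝ → ℝ := fun t => ∫ s in a..t, g s with hG
  have hac : AbsolutelyContinuousOnInterval G a b :=
    hg.absolutelyContinuousOnInterval_intervalIntegral left_mem_uIcc
  have hGa : G a = 0 := intervalIntegral.integral_same
  -- `g` is merely integrable, so the product rule is the one for absolutely continuous functions,
  -- with derivatives almost everywhere.
  have h1 : ∫ s in a..b, 2 * (G s * g s) = G b * G b - G a * G a := by
    rw [← hac.integral_deriv_mul_eq_sub hac]
    apply intervalIntegral.integral_congr_ae
    filter_upwards [hg.ae_hasDerivAt_integral] with t ht hmem
    rw [(ht (uIoc_subset_uIcc hmem) a left_mem_uIcc).deriv]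
    ring
  have h2 : IntervalIntegrable (fun s => G s * g s) volume a b :=
    hg.continuousOn_mul hac.continuousOn
  have h3 : ∫ s in a..b, x s * g s = ∫ s in a..b, (x a * g s + G s * g s) := by
    apply intervalIntegral.integral_congr
    intro t ht
    rw [uIcc_of_le hab] at ht
    simp only [hx t ht]
    rw [add_mul]
  rw [h3, intervalIntegral.integral_add (hg.const_mul _) h2, intervalIntegral.integral_const_mul,
    hx b ⟨hab, le_rfl⟩]
  rw [intervalIntegral.integral_const_mul, hGa] at h1
  have : ∫ s in a..b, g s = G b := rfl
  rw [this]
  linarith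

/-- A nonnegative function with bounded integral that grows at most linearly tends to zero. -/
lemma tendsto_zero_of_integral_bounded {f : ℝ → ℝ} {C K : ℝ} (h0 : ∀ t, 0 ≤ t → 0 ≤ f t)
    (hcont : ContinuousOn f (Ici 0)) (hgrowth : ∀ s t, 0 ≤ s → s ≤ t → f t - f s ≤ C * (t - s))
    (hK : ∀ t, 0 ≤ t → ∫ s in (0 : ℝ)..t, f s ≤ K) : Tendsto f atTop (𝓝 0) := by
  have hint : ∀ s t, 0 ≤ s → 0 ≤ t → IntervalIntegrable f volume s t := fun s t hs ht =>
    (hcont.mono fun _ hr => (le_min hs ht).trans hr.1).intervalIntegrable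
  set I : ℝ → ℝ := fun t => ∫ s in (0 : ℝ)..t, f s with hI
  have hsub : ∀ s t, 0 ≤ s → 0 ≤ t → I t - I s = ∫ r in s..t, f r := fun s t hs ht =>
    intervalIntegral.integral_interval_sub_left (hint 0 t le_rfl ht) (hint 0 s le_rfl hs)
  have hbdd : BddAbove (I '' Ici 0) := ⟨K, by rintro _ ⟨t, ht, rfl⟩; exact hK t ht⟩
  have hne : (I '' Ici 0).Nonempty := ⟨_, 0, self_mem_Ici, rfl⟩
  rw [Metric.tendsto_atTop]
  intro ε hε
  set δ := ε / (2 * (|C| + 1)) with hδ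
  have hC := abs_nonneg C
  have hδ0 : 0 < δ := by positivity
  have hCδ : |C| * δ ≤ ε / 2 := by
    have : (|C| + 1) * δ = ε / 2 := by rw [hδ]; field_simp
    nlinarith
  -- After `t₀` less than `δ * ε / 2` of the integral remains. A later value `f t ≥ ε` would force
  -- `f ≥ ε / 2` on `[t - δ, t]` and use up that amount; one looks backwards because only the growth
  -- of `f` is bounded.
  obtain ⟨_, ⟨t₀, ht₀, rfl⟩, hlt⟩ := exists_lt_of_lt_csSup hne
    (show sSup (I '' Ici 0) - δ * (ε / 2) < sSup (I '' Ici 0) by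
      have : 0 < δ * (ε / 2) := by positivity
      linarith)
  replace ht₀ : 0 ≤ t₀ := ht₀
  refine ⟨t₀ + δ, fun t ht => ?_⟩
  have ht0 : 0 ≤ t := by linarith
  rw [Real.dist_eq, sub_zero, abs_of_nonneg (h0 t ht0)]
  by_contra hge
  push Not at hge
  have h1 : I t ≤ sSup (I '' Ici 0) := le_csSup hbdd ⟨t, ht0, rfl⟩
  have h2 : 0 ≤ I (t - δ) - I t₀ := by
    rw [hsub _ _ ht₀ (by linarith)]
    exact intervalIntegral.integral_nonneg (by linarith) fun r hr => h0 r (ht₀.trans hr.1)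
  have h3 : δ * (ε / 2) ≤ I t - I (t - δ) := by
    rw [hsub _ _ (by linarith) ht0]
    have : ∫ _ in (t - δ)..t, ε / 2 = δ * (ε / 2) := by
      rw [intervalIntegral.integral_const, smul_eq_mul]; ring
    rw [← this]
    refine intervalIntegral.integral_mono_on (by linarith) intervalIntegrable_const
      (hint _ _ (by linarith) ht0) fun r hr => ?_
    have h4 := hgrowth r t (by linarith [hr.1]) hr.2
    have h5 : C * (t - r) ≤ |C| * δ :=
      mul_le_mul (le_abs_self C) (by linarith [hr.1]) (by linarith [hr.2]) hC
    linarith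
  linarith

/-- Barbalat's lemma, with a vanishing perturbation of a Lipschitz derivative. -/
lemma tendsto_zero_of_integral_tendsto {x g β : ℝ → ℝ} {K c : ℝ}
    (hint : ∀ s t, 0 ≤ s → s ≤ t → IntervalIntegrable g volume s t)
    (hx : ∀ s t, 0 ≤ s → s ≤ t → x t - x s = ∫ r in s..t, g r)
    (hlim : Tendsto x atTop (𝓝 c)) (hα : Tendsto (fun t => g t - β t) atTop (𝓝 0))
    (hβ : ∀ s t, 0 ≤ s → s ≤ t → |β t - β s| ≤ K * (t - s)) : Tendsto β atTop (𝓝 0) := by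
  rw [Metric.tendsto_atTop]
  intro ε hε
  -- On `[t, t + δ]` the integrand stays within `ε / 2` of `β t`: a quarter for the perturbation and
  -- a quarter for the variation of `β`. The increment of `x` is at most `δ * ε / 4`, which leaves
  -- `|β t| ≤ 3 ε / 4`.
  set δ := ε / (4 * (|K| + 1)) with hδ
  have hK := abs_nonneg K
  have hδ0 : 0 < δ := by positivity
  have hKδ : |K| * δ ≤ ε / 4 := by
    have : (|K| + 1) * δ = ε / 4 := by rw [hδ]; field_simp
    nlinarith
  obtain ⟨t₁, h1⟩ := Metric.tendsto_atTop.1 hα (ε / 4) (by positivity)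
  obtain ⟨t₂, h2⟩ := Metric.tendsto_atTop.1 hlim (δ * (ε / 8)) (by positivity)
  refine ⟨max 0 (max t₁ t₂), fun t ht => ?_⟩
  have ht0 : 0 ≤ t := (le_max_left _ _).trans ht
  have ht1 : t₁ ≤ t := (le_max_left _ _).trans ((le_max_right _ _).trans ht)
  have ht2 : t₂ ≤ t := (le_max_right _ _).trans ((le_max_right _ _).trans ht)
  rw [Real.dist_eq, sub_zero]
  have e1 : ∫ r in t..(t + δ), (g r - β t) = x (t + δ) - x t - δ * β t := by
    rw [intervalIntegral.integral_sub (hint _ _ ht0 (by linarith)) intervalIntegrable_const,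
      ← hx _ _ ht0 (by linarith), intervalIntegral.integral_const, smul_eq_mul]
    ring
  have e2 : ‖∫ r in t..(t + δ), (g r - β t)‖ ≤ (ε / 2) * |t + δ - t| := by
    refine intervalIntegral.norm_integral_le_of_norm_le_const fun r hr => ?_
    rw [uIoc_of_le (by linarith)] at hr
    have f1 := h1 r (ht1.trans hr.1.le)
    rw [Real.dist_eq, sub_zero] at f1
    have f2 := hβ t r ht0 hr.1.le
    have f3 : K * (r - t) ≤ |K| * δ :=
      mul_le_mul (le_abs_self K) (by linarith [hr.2]) (by linarith [hr.1]) hK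
    have f4 := abs_add_le (g r - β r) (β r - β t)
    rw [sub_add_sub_cancel] at f4
    rw [Real.norm_eq_abs]
    linarith
  have e3 := h2 t ht2
  have e4 := h2 (t + δ) (by linarith)
  rw [Real.dist_eq] at e3 e4
  have e5 := abs_sub (x (t + δ) - c) (x t - c)
  rw [sub_sub_sub_cancel_right] at e5
  rw [e1, Real.norm_eq_abs, add_sub_cancel_left, abs_of_pos hδ0] at e2
  have e6 := abs_sub (x (t + δ) - x t) (x (t + δ) - x t - δ * β t)
  rw [sub_sub_cancel, abs_mul, abs_of_pos hδ0] at e6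
  have e7 : δ * |β t| ≤ δ * (3 * ε / 4) := by nlinarith
  have := le_of_mul_le_mul_left e7 hδ0
  linarith

/-- A function that decreases at most at a rate proportional to itself stays positive. -/
lemma pos_of_sub_le_integral {y : ℝ → ℝ} {a b T : ℝ} (hab : a < b) (hT : 0 < T)
    (hcont : ContinuousOn y (Icc a b)) (hpos : ∀ t ∈ Ico a b, 0 < y t)
    (h : ∀ s ∈ Icc a b, y s - y b ≤ ∫ r in s..b, y r / T) : 0 < y b := by
  -- On a window of length at most `T / 2`, a function starting from its maximum `y τ` loses at most
  -- `y τ / 2` until `b`.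
  set s := max a (b - T / 2) with hs
  have hsb : s < b := max_lt hab (by linarith)
  have hcs : ContinuousOn y (Icc s b) := hcont.mono (Icc_subset_Icc_left (le_max_left _ _))
  obtain ⟨τ, hτ, hmax⟩ := isCompact_Icc.exists_isMaxOn (nonempty_Icc.2 hsb.le) hcs
  have hm : 0 < y τ := (hpos s ⟨le_max_left _ _, hsb⟩).trans_le (hmax ⟨le_rfl, hsb.le⟩)
  have h1 := h τ ⟨(le_max_left _ _).trans hτ.1, hτ.2⟩
  have h2 : ∫ r in τ..b, y r / T ≤ ∫ _ in τ..b, y τ / T := by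
    refine intervalIntegral.integral_mono_on hτ.2 ?_ intervalIntegrable_const fun r hr => ?_
    · apply ContinuousOn.intervalIntegrable
      rw [uIcc_of_le hτ.2]
      exact (hcs.mono (Icc_subset_Icc_left hτ.1)).div_const T
    · have : y r ≤ y τ := hmax ⟨hτ.1.trans hr.1, hr.2⟩
      gcongr
  rw [intervalIntegral.integral_const, smul_eq_mul] at h2
  have h3 : (b - τ) * (y τ / T) ≤ y τ / 2 := by
    have : b - τ ≤ T / 2 := by linarith [(le_max_right a (b - T / 2)).trans hτ.1]
    calc (b - τ) * (y τ / T) ≤ T / 2 * (y τ / T) := by gcongr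
      _ = y τ / 2 := by field_simp
  linarith

/-- An indefinite integral on the half-line is continuous. -/
lemma continuousOn_of_eq_integral {x g : ℝ → ℝ}
    (hg : ∀ t, 0 ≤ t → IntervalIntegrable g volume 0 t)
    (hx : ∀ t, 0 ≤ t → x t = x 0 + ∫ s in (0 : ℝ)..t, g s) : ContinuousOn x (Ici 0) := by
  intro t ht
  replace ht : 0 ≤ t := ht
  have h1 : ContinuousOn x (Icc 0 (t + 1)) := by
    have := intervalIntegral.continuousOn_primitive_interval' (hg (t + 1) (by linarith))
      (left_mem_uIcc)
    rw [uIcc_of_le (by linarith)] at this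
    exact (continuousOn_const.add this).congr fun s hs => hx s hs.1
  refine (h1 t ⟨ht, by linarith⟩).mono_of_mem_nhdsWithin ?_
  rw [mem_nhdsWithin]
  exact ⟨Iio (t + 1), isOpen_Iio, by simp, fun s hs => ⟨hs.2, hs.1.le⟩⟩

end Integral

/-! ### Closed-loop solutions and invariance of the safe interval. -/

section ClosedLoop

variable {V L : Type*} [Fintype V] [DecidableEq V] [Fintype L] [DecidableEq L]

variable {net : PowerNetwork V L} {spec : ControlSpec V} {d : ℕ} {R : Fin d → Finset V}
  {p : ℝ → V → ℝ} {fc : ℝ → ℝ → V → ℝ} {h T : ℝ} {lam : ℝ → L → ℝ} {om u : ℝ → V → ℝ}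

/-- The sign and threshold conditions on the input of the closed loop. -/
lemma IsClosedLoop.sign (hcl : IsClosedLoop net spec R p fc h T lam om u)
    (hcover : ∀ i ∈ spec.Iu, ∃ β, i ∈ R β) (hh : 0 < h) (hT : 0 < T) {t : ℝ} (ht : 0 ≤ t) {i : V}
    (hi : i ∈ spec.Iu) :
    (spec.thrHi i ≤ om t i → u t i ≤ 0) ∧ (om t i ≤ spec.thrLo i → 0 ≤ u t i) ∧
      (spec.thrLo i < om t i ∧ om t i < spec.thrHi i → u t i = 0) := by
  obtain ⟨β, hβ⟩ := hcover i hi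
  obtain ⟨u₀, hu₀, hu⟩ := hcl.feedback t ht β
  rw [hu i hβ hi]
  exact hu₀.sign (horizon_pos hh hT) hβ hi

/-- At buses without inertia the frequency is a function of the power mismatch. -/
lemma IsClosedLoop.om_eq_balance (hcl : IsClosedLoop net spec R p fc h T lam om u)
    (hcover : ∀ i ∈ spec.Iu, ∃ β, i ∈ R β) (hh : 0 < h) (hT : 0 < T)
    (hfc : ∀ t, 0 ≤ t → fc t t = p t) {t : ℝ} (ht : 0 ≤ t) {i : V} (hM : net.M i = 0) :
    om t i = spec.balance (net.E i) i (p t i - net.outflow (sinVec (lam t)) i) := by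
  rw [← residual_add_refInput_eq_zero_iff]
  -- At a controlled bus the mere existence of the region's reference trajectory forces the balance
  -- under the reference input. At the other buses both inputs are zero and the algebraic equation
  -- is the balance.
  by_cases hi : i ∈ spec.Iu
  · obtain ⟨β, hβ⟩ := hcover i hi
    obtain ⟨u₀, hu₀, -⟩ := hcl.feedback t ht β
    exact hu₀.balance (horizon_pos hh hT) (hfc t ht) hβ hM
  · have h1 := hcl.algebraic i hM t ht
    rw [hcl.uncontrolled t ht i hi] at h1
    rwa [refInput, if_neg fun hω => hi (spec.Iω_subset hω)]

lemma IsClosedLoop.om_sub (hcl : IsClosedLoop net spec R p fc h T lam om u) {i : V}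
    (hM : 0 < net.M i) {s t : ℝ} (hs : 0 ≤ s) (hst : s ≤ t) :
    IntervalIntegrable (fun r => (net.residual (sinVec (lam r)) (om r) (p r) i + u r i) / net.M i)
      volume s t ∧
    om t i - om s i
      = ∫ r in s..t, (net.residual (sinVec (lam r)) (om r) (p r) i + u r i) / net.M i := by
  obtain ⟨i1, e1⟩ := hcl.freq i hM t (hs.trans hst)
  obtain ⟨i2, e2⟩ := hcl.freq i hM s hs
  refine ⟨(i2.symm.trans i1).div_const _, ?_⟩
  rw [intervalIntegral.integral_div, ← intervalIntegral.integral_interval_sub_left i1 i2]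
  field_simp
  linarith

lemma IsClosedLoop.continuousOn_om (hcl : IsClosedLoop net spec R p fc h T lam om u) {i : V}
    (hM : 0 < net.M i) : ContinuousOn (fun t => om t i) (Ici 0) :=
  continuousOn_of_eq_integral (fun _ ht => (hcl.om_sub hM le_rfl ht).1)
    fun t ht => by linarith [(hcl.om_sub hM le_rfl ht).2]

lemma IsClosedLoop.lam_sub (hcl : IsClosedLoop net spec R p fc h T lam om u) (l : L) {s t : ℝ}
    (hs : 0 ≤ s) (hst : s ≤ t) :
    IntervalIntegrable (fun r => net.D.mulVec (om r) l) volume s t ∧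
      lam t l - lam s l = ∫ r in s..t, net.D.mulVec (om r) l := by
  obtain ⟨i1, e1⟩ := hcl.angle l t (hs.trans hst)
  obtain ⟨i2, e2⟩ := hcl.angle l s hs
  refine ⟨i2.symm.trans i1, ?_⟩
  rw [← intervalIntegral.integral_interval_sub_left i1 i2]
  linarith

lemma IsClosedLoop.continuousOn_lam (hcl : IsClosedLoop net spec R p fc h T lam om u) (l : L) :
    ContinuousOn (fun t => lam t l) (Ici 0) :=
  continuousOn_of_eq_integral (fun t ht => (hcl.angle l t ht).1) fun t ht => (hcl.angle l t ht).2

/-- The rate bound at a soft bus inside its safe interval. -/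
lemma IsClosedLoop.rate_mem (hcl : IsClosedLoop net spec R p fc h T lam om u)
    (hcover : ∀ i ∈ spec.Iu, ∃ β, i ∈ R β) (hh : 0 < h) (hT : 0 < T)
    (hfc : ∀ t, 0 ≤ t → fc t t = p t) {t : ℝ} (ht : 0 ≤ t) {i : V} (hi : i ∈ spec.Iω)
    (hs : spec.ξ i = true) (hM : 0 < net.M i) (hw : om t i ∈ Icc (spec.ωlo i) (spec.ωhi i)) :
    -((om t i - spec.ωlo i) / T)
        ≤ (net.residual (sinVec (lam t)) (om t) (p t) i + u t i) / net.M i ∧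
      (net.residual (sinVec (lam t)) (om t) (p t) i + u t i) / net.M i
        ≤ (spec.ωhi i - om t i) / T := by
  obtain ⟨β, hβ⟩ := hcover i (spec.Iω_subset hi)
  obtain ⟨u₀, hu₀, hu⟩ := hcl.feedback t ht β
  obtain ⟨h1, h2⟩ := hu₀.rate_mem (horizon_pos hh hT) hT (hfc t ht) hβ hi hs hw
  rw [hu i hβ (spec.Iω_subset hi)]
  constructor
  · rw [le_div_iff₀ hM]
    refine le_of_eq_of_le ?_ h1
    ring
  · rw [div_le_iff₀ hM]
    refine h2.trans_eq ?_
    ring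

/-- A soft bus that starts inside its safe interval stays there. -/
theorem IsClosedLoop.mem_Ioo (hcl : IsClosedLoop net spec R p fc h T lam om u)
    (hcover : ∀ i ∈ spec.Iu, ∃ β, i ∈ R β) (hh : 0 < h) (hT : 0 < T)
    (hfc : ∀ t, 0 ≤ t → fc t t = p t) {i : V} (hi : i ∈ spec.Iω) (hs' : spec.ξ i = true)
    (hM : 0 < net.M i) (h0 : om 0 i ∈ Ioo (spec.ωlo i) (spec.ωhi i)) {t : ℝ} (ht : 0 ≤ t) :
    om t i ∈ Ioo (spec.ωlo i) (spec.ωhi i) := by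
  by_contra hnot
  have hcont := hcl.continuousOn_om hM
  -- The infimum `b` of this closed set is the first exit time. The rate bounds hold on all of `[0,
  -- b]`, since by continuity the frequency at `b` is still in the closed interval, and they keep
  -- both distances to the endpoints positive at `b`.
  set A : Set ℝ := Ici 0 ∩ (fun t => om t i) ⁻¹' (Ioo (spec.ωlo i) (spec.ωhi i))ᶜ with hA
  have hAc : IsClosed A := hcont.preimage_isClosed_of_isClosed isClosed_Ici isOpen_Ioo.isClosed_compl
  have hAbdd : BddBelow A := ⟨0, fun s hs => hs.1⟩
  have hbA : sInf A ∈ A := hAc.csInf_mem ⟨t, ht, hnot⟩ hAbdd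
  set b := sInf A with hb
  have hb0 : 0 < b := by
    refine lt_of_le_of_ne hbA.1 fun h => hbA.2 ?_
    change om b i ∈ _
    rw [← h]; exact h0
  have hin : ∀ s ∈ Ico 0 b, om s i ∈ Ioo (spec.ωlo i) (spec.ωhi i) := by
    intro s hs
    by_contra hc
    exact absurd (csInf_le hAbdd (show s ∈ A from ⟨hs.1, hc⟩)) (not_le.2 hs.2)
  have hcb : ContinuousOn (fun t => om t i) (Icc 0 b) := hcont.mono fun s hs => hs.1
  have hIcc : ∀ s ∈ Icc 0 b, om s i ∈ Icc (spec.ωlo i) (spec.ωhi i) := by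
    have hcl' : Icc 0 b = closure (Ico 0 b) := (closure_Ico hb0.ne).symm
    intro s hs
    rw [hcl'] at hs hcb
    have hsub : (fun t => om t i) '' Ico 0 b ⊆ Icc (spec.ωlo i) (spec.ωhi i) := by
      rintro _ ⟨r, hr, rfl⟩
      exact Ioo_subset_Icc_self (hin r hr)
    exact closure_minimal hsub isClosed_Icc (hcb.image_closure ⟨s, hs, rfl⟩)
  have hy : ∀ f : ℝ → ℝ, ContinuousOn f (Icc 0 b) → ∀ s ∈ Icc 0 b,
      IntervalIntegrable (fun r => f r / T) volume s b := by
    intro f hf s hs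
    apply ContinuousOn.intervalIntegrable
    rw [uIcc_of_le hs.2]
    exact (hf.mono (Icc_subset_Icc_left hs.1)).div_const T
  refine hbA.2 ⟨?_, ?_⟩
  · have hc1 : ContinuousOn (fun r => om r i - spec.ωlo i) (Icc 0 b) := hcb.sub continuousOn_const
    refine sub_pos.1 (pos_of_sub_le_integral (y := fun r => om r i - spec.ωlo i) hb0 hT hc1
      (fun s hs => sub_pos.2 (hin s hs).1) fun s hs => ?_)
    obtain ⟨e1, e2⟩ := hcl.om_sub hM hs.1 hs.2
    have := intervalIntegral.integral_mono_on hs.2 (hy _ hc1 s hs).neg e1 fun r hr =>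
      (hcl.rate_mem hcover hh hT hfc (hs.1.trans hr.1) hi hs' hM
        (hIcc r ⟨hs.1.trans hr.1, hr.2⟩)).1
    simp only [Pi.neg_apply, intervalIntegral.integral_neg] at this
    linarith
  · have hc1 : ContinuousOn (fun r => spec.ωhi i - om r i) (Icc 0 b) := continuousOn_const.sub hcb
    refine sub_pos.1 (pos_of_sub_le_integral (y := fun r => spec.ωhi i - om r i) hb0 hT hc1
      (fun s hs => sub_pos.2 (hin s hs).2) fun s hs => ?_)
    obtain ⟨e1, e2⟩ := hcl.om_sub hM hs.1 hs.2
    have := intervalIntegral.integral_mono_on hs.2 e1 (hy _ hc1 s hs) fun r hr =>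
      (hcl.rate_mem hcover hh hT hfc (hs.1.trans hr.1) hi hs' hM
        (hIcc r ⟨hs.1.trans hr.1, hr.2⟩)).2
    linarith

/-- Invariance of the safe interval of a soft bus. -/
theorem IsClosedLoop.mem_Icc (hcl : IsClosedLoop net spec R p fc h T lam om u)
    (hcover : ∀ i ∈ spec.Iu, ∃ β, i ∈ R β) (hh : 0 < h) (hT : 0 < T)
    (hfc : ∀ t, 0 ≤ t → fc t t = p t) {i : V} (hi : i ∈ spec.Iω) (hs : spec.ξ i = true)
    (h0 : om 0 i ∈ Ioo (spec.ωlo i) (spec.ωhi i) ∨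
      IsLimitFromInside spec (closedLoopStates net spec R p fc h T) i (fun t => (lam t, om t)))
    {t : ℝ} (ht : 0 ≤ t) : om t i ∈ Icc (spec.ωlo i) (spec.ωhi i) := by
  rcases (net.M_nonneg i).eq_or_lt with hM | hM
  · rw [hcl.om_eq_balance hcover hh hT hfc ht hM.symm]
    exact balance_mem_safe spec hi hs _ _
  rcases h0 with h0 | ⟨Y, hY, hlim⟩
  · exact Ioo_subset_Icc_self (hcl.mem_Ioo hcover hh hT hfc hi hs hM h0 ht)
  · have h1 : Tendsto (fun n => (Y n t).2 i) atTop (𝓝 (om t i)) :=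
      ((continuous_apply i).comp continuous_snd).continuousAt.tendsto.comp (hlim t ht)
    refine isClosed_Icc.mem_of_tendsto h1 (Eventually.of_forall fun n => ?_)
    obtain ⟨⟨v, hv⟩, hn⟩ := hY n
    exact Ioo_subset_Icc_self (hv.mem_Ioo hcover hh hT hfc hi hs hM hn ht)

end ClosedLoop

/-! ### The energy function and its dissipation identity. -/

section Energy

variable {V L : Type*} [Fintype V] [DecidableEq V] [Fintype L] [DecidableEq L]

lemma outflow_sub (net : PowerNetwork V L) (s s' : L → ℝ) (i : V) :
    net.outflow (fun l => s l - s' l) i = net.outflow s i - net.outflow s' i := by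
  simp only [outflow_eq_sum, ← Finset.sum_sub_distrib]
  exact Finset.sum_congr rfl fun l _ => by ring

/-- Summation by parts: `Dᵀ` is the adjoint of `D`. It turns bus sums in the energy balance into
line sums. -/
lemma sum_mul_outflow (net : PowerNetwork V L) (x : V → ℝ) (s : L → ℝ) :
    ∑ i, x i * net.outflow s i = ∑ l, net.b l * s l * net.D.mulVec x l := by
  simp only [outflow_eq_sum, Finset.mul_sum, Matrix.mulVec, dotProduct]
  rw [Finset.sum_comm]
  exact Finset.sum_congr rfl fun l _ => Finset.sum_congr rfl fun i _ => by ring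

lemma D_mulVec_sub_const (net : PowerNetwork V L) (w : V → ℝ) (c : ℝ) (l : L) :
    net.D.mulVec (fun i => w i - c) l = net.D.mulVec w l := by
  simp [D_mulVec_apply]

lemma continuous_outflow (net : PowerNetwork V L) (i : V) :
    Continuous fun s => net.outflow s i := by
  simp only [outflow_eq_sum]
  fun_prop

lemma continuous_balance (spec : ControlSpec V) {E : ℝ} (hE : 0 < E) (i : V) :
    Continuous (spec.balance E i) := by
  refine LipschitzWith.continuous (K := Real.toNNReal (1 / E)) (LipschitzWith.of_dist_le_mul ?_)
  intro a a'
  rw [Real.dist_eq, Real.dist_eq, Real.coe_toNNReal _ (by positivity)]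
  refine (abs_balance_sub_le spec hE a a').trans_eq ?_
  ring

/-- The potential energy of a line. -/
def linePotential (a x : ℝ) : ℝ := Real.cos a - Real.cos x - x * Real.sin a + a * Real.sin a

/-- The potential is the gap between `-cos` and its tangent at `a`, and `-cos` is strictly convex on
the interval because the sine is strictly increasing there. The mean value theorem makes this
explicit. -/
lemma linePotential_pos {a x : ℝ} (ha : |a| < Real.pi / 2) (hx : |x| ≤ Real.pi / 2) (hne : x ≠ a) :
    0 < linePotential a x := by
  obtain ⟨a1, a2⟩ := abs_lt.1 ha
  obtain ⟨x1, x2⟩ := abs_le.1 hx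
  have hder : ∀ y, HasDerivAt (fun y => -Real.cos y) (Real.sin y) y := fun y =>
    (Real.hasDerivAt_cos y).fun_neg.congr_deriv (neg_neg _)
  have hc : Continuous fun y => -Real.cos y := Real.continuous_cos.neg
  rcases lt_or_gt_of_ne hne with hlt | hlt
  · obtain ⟨ξ, hξ, e⟩ := exists_hasDerivAt_eq_slope (fun y => -Real.cos y) Real.sin hlt
      hc.continuousOn fun y _ => hder y
    have hs : Real.sin ξ < Real.sin a :=
      Real.strictMonoOn_sin ⟨by linarith [hξ.1], by linarith [hξ.2]⟩ ⟨a1.le, a2.le⟩ hξ.2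
    rw [eq_div_iff (by linarith)] at e
    unfold linePotential
    nlinarith
  · obtain ⟨ξ, hξ, e⟩ := exists_hasDerivAt_eq_slope (fun y => -Real.cos y) Real.sin hlt
      hc.continuousOn fun y _ => hder y
    have hs : Real.sin a < Real.sin ξ :=
      Real.strictMonoOn_sin ⟨a1.le, a2.le⟩ ⟨by linarith [hξ.1], by linarith [hξ.2]⟩ hξ.1
    rw [eq_div_iff (by linarith)] at e
    unfold linePotential
    nlinarith

lemma linePotential_self (a : ℝ) : linePotential a a = 0 := by
  unfold linePotential; ring

lemma linePotential_nonneg {a x : ℝ} (ha : |a| < Real.pi / 2) (hx : |x| ≤ Real.pi / 2) :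
    0 ≤ linePotential a x := by
  rcases eq_or_ne x a with rfl | hne
  · rw [linePotential_self]
  · exact (linePotential_pos ha hx hne).le

lemma continuous_linePotential (a : ℝ) : Continuous (linePotential a) := by
  unfold linePotential
  fun_prop

lemma exists_linePotential_lower {a ε : ℝ} (ha : |a| < Real.pi / 2) (hε : 0 < ε) :
    ∃ c > 0, ∀ x, |x| ≤ Real.pi / 2 → linePotential a x < c → |x - a| < ε := by
  set S : Set ℝ := {x | |x| ≤ Real.pi / 2} ∩ {x | ε ≤ |x - a|} with hS
  have hSc : IsCompact S := by
    refine IsCompact.inter_right ?_ (isClosed_le (by fun_prop) (by fun_prop))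
    have : {x : ℝ | |x| ≤ Real.pi / 2} = Icc (-(Real.pi / 2)) (Real.pi / 2) := by
      ext x; simp only [Set.mem_ofPred_eq, mem_Icc, abs_le]
    rw [this]
    exact isCompact_Icc
  rcases S.eq_empty_or_nonempty with he | hne
  · refine ⟨1, one_pos, fun x hx _ => ?_⟩
    by_contra hge
    have : x ∈ S := ⟨hx, not_lt.1 hge⟩
    rw [he] at this
    exact this
  · obtain ⟨y, hy, hmin⟩ := hSc.exists_isMinOn hne (continuous_linePotential a).continuousOn
    refine ⟨linePotential a y, linePotential_pos ha hy.1 ?_, fun x hx hlt => ?_⟩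
    · rintro rfl
      have : ε ≤ |y - y| := hy.2
      simp at this
      linarith
    · by_contra hge
      exact absurd (hmin (show x ∈ S from ⟨hx, not_lt.1 hge⟩)) (not_le.2 hlt)

lemma hasDerivAt_linePotential (a x : ℝ) :
    HasDerivAt (linePotential a) (Real.sin x - Real.sin a) x := by
  have h1 := ((((Real.hasDerivAt_cos x).const_sub (Real.cos a)).sub
    ((hasDerivAt_id x).mul_const (Real.sin a))).add_const (a * Real.sin a))
  refine h1.congr_deriv ?_
  ring

lemma abs_le_of_mem_closure {lam : L → ℝ} (h : lam ∈ closure (Upsilon L)) (l : L) :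
    |lam l| ≤ Real.pi / 2 := by
  have hc : IsClosed {lam : L → ℝ | |lam l| ≤ Real.pi / 2} := isClosed_le (by fun_prop) (by fun_prop)
  exact closure_minimal (fun x hx => (hx l).le) hc h

lemma isOpen_Upsilon : IsOpen (Upsilon L) := by
  simp only [Upsilon, Set.ofPred_forall]
  exact isOpen_iInter_of_finite fun l => isOpen_lt (by fun_prop) (by fun_prop)

lemma isCompact_closure_Upsilon : IsCompact (closure (Upsilon L)) := by
  have h1 : IsCompact (univ.pi fun _ : L => Icc (-(Real.pi / 2)) (Real.pi / 2)) :=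
    isCompact_univ_pi fun _ => isCompact_Icc
  exact h1.of_isClosed_subset isClosed_closure
    fun lam h l _ => abs_le.1 (abs_le_of_mem_closure h l)

variable {net : PowerNetwork V L} {q : V → ℝ} {a : L → ℝ}

lemma energy_eq (lam : L → ℝ) (w : V → ℝ) : net.energy q a lam w
    = (∑ i with 0 < net.M i, net.M i / 2 * (w i - net.syncFreq q) ^ 2)
      + ∑ l, net.b l * linePotential (a l) (lam l) := by
  simp only [PowerNetwork.energy, linePotential, Finset.mul_sum]
  congr 1
  exact Finset.sum_congr rfl fun i _ => by ring

lemma kinetic_term_nonneg (w : V → ℝ) (i : V) :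
    0 ≤ net.M i / 2 * (w i - net.syncFreq q) ^ 2 := by
  have := net.M_nonneg i
  positivity

lemma line_term_nonneg (ha : a ∈ Upsilon L) {lam : L → ℝ} (hlam : lam ∈ closure (Upsilon L))
    (l : L) : 0 ≤ net.b l * linePotential (a l) (lam l) :=
  mul_nonneg (net.b_pos l).le (linePotential_nonneg (ha l) (abs_le_of_mem_closure hlam l))

lemma kinetic_le_energy (ha : a ∈ Upsilon L) {lam : L → ℝ} (hlam : lam ∈ closure (Upsilon L))
    (w : V → ℝ) {i : V} (hM : 0 < net.M i) :
    net.M i / 2 * (w i - net.syncFreq q) ^ 2 ≤ net.energy q a lam w := by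
  have h1 := Finset.single_le_sum (f := fun i => net.M i / 2 * (w i - net.syncFreq q) ^ 2)
    (fun i _ => kinetic_term_nonneg (net := net) (q := q) w i)
    (show i ∈ Finset.univ.filter (fun i => 0 < net.M i) by simpa using hM)
  have h2 := Finset.sum_nonneg fun l (_ : l ∈ Finset.univ) =>
    line_term_nonneg (net := net) ha hlam l
  rw [energy_eq]
  linarith

lemma line_le_energy (ha : a ∈ Upsilon L) {lam : L → ℝ} (hlam : lam ∈ closure (Upsilon L))
    (w : V → ℝ) (l : L) : net.b l * linePotential (a l) (lam l) ≤ net.energy q a lam w := by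
  have h1 := Finset.single_le_sum (f := fun l => net.b l * linePotential (a l) (lam l))
    (fun l _ => line_term_nonneg (net := net) ha hlam l) (Finset.mem_univ l)
  have h2 := Finset.sum_nonneg fun i (_ : i ∈ Finset.univ.filter (fun i => 0 < net.M i)) =>
    kinetic_term_nonneg (net := net) (q := q) w i
  rw [energy_eq]
  linarith

lemma energy_nonneg (ha : a ∈ Upsilon L) {lam : L → ℝ} (hlam : lam ∈ closure (Upsilon L))
    (w : V → ℝ) : 0 ≤ net.energy q a lam w := by
  rw [energy_eq]
  exact add_nonneg (Finset.sum_nonneg fun i _ => kinetic_term_nonneg w i)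
    (Finset.sum_nonneg fun l _ => line_term_nonneg ha hlam l)

lemma energy_sync_le (lam : L → ℝ) (w : V → ℝ) :
    net.energy q a lam (fun _ => net.syncFreq q) ≤ net.energy q a lam w := by
  rw [energy_eq, energy_eq]
  have h2 := Finset.sum_nonneg fun i (_ : i ∈ Finset.univ.filter (fun i => 0 < net.M i)) =>
    kinetic_term_nonneg (net := net) (q := q) w i
  simp
  exact h2

lemma energy_equilibrium : net.energy q a a (fun _ => net.syncFreq q) = 0 := by
  simp [energy_eq, linePotential_self]

lemma continuous_energy :
    Continuous fun x : (L → ℝ) × (V → ℝ) => net.energy q a x.1 x.2 := by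
  simp only [PowerNetwork.energy]
  fun_prop

/-- The energy threshold is positive. -/
lemma exists_pos_le_rbar (ha : a ∈ Upsilon L) : ∃ r > 0, ((r : ℝ) : EReal) ≤ net.rbar q a := by
  -- At a boundary point of the cube some angle has modulus at least `π / 2`, so it is at distance
  -- at least `π / 2 - |a l|` from the equilibrium.
  choose c hc0 hc using fun l => exists_linePotential_lower (ha l) (sub_pos.2 (ha l))
  have hev : ∀ᶠ r in 𝓝[>] (0 : ℝ), ∀ l, r < net.b l * c l := by
    rw [eventually_all]
    intro l
    exact nhdsWithin_le_nhds (eventually_lt_nhds (mul_pos (net.b_pos l) (hc0 l)))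
  obtain ⟨r, hr, hr0⟩ := (hev.and self_mem_nhdsWithin).exists
  refine ⟨r, hr0, le_iInf₂ fun lam hlam => ?_⟩
  rw [EReal.coe_le_coe_iff]
  have hK : lam ∈ closure (Upsilon L) := isClosed_closure.frontier_subset hlam
  have hnot : lam ∉ Upsilon L := fun hin =>
    hlam.2 (interior_maximal subset_closure isOpen_Upsilon hin)
  obtain ⟨l, hl⟩ : ∃ l, Real.pi / 2 ≤ |lam l| := by
    by_contra hcon
    push Not at hcon
    exact hnot hcon
  have h1 : c l ≤ linePotential (a l) (lam l) := by
    by_contra hlt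
    have h2 := hc l (lam l) (abs_le_of_mem_closure hK l) (not_le.1 hlt)
    have h3 := abs_sub_abs_le_abs_sub (lam l) (a l)
    linarith
  calc r ≤ net.b l * c l := (hr l).le
    _ ≤ net.b l * linePotential (a l) (lam l) := mul_le_mul_of_nonneg_left h1 (net.b_pos l).le
    _ ≤ _ := line_le_energy ha hK _ l

lemma rbar_le {lam : L → ℝ} (hlam : lam ∈ frontier (closure (Upsilon L))) :
    net.rbar q a ≤ ((net.energy q a lam (fun _ => net.syncFreq q) : ℝ) : EReal) :=
  iInf₂_le lam hlam

/-- The power balance relative to an equilibrium. -/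
lemma IsEquilibrium.residual_eq (heq : net.IsEquilibrium q a) (s : L → ℝ) (w : V → ℝ) (i : V) :
    net.residual s w q i = -(net.E i * (w i - net.syncFreq q))
      - net.outflow (fun l => s l - sinVec a l) i := by
  have h := heq.2.2 i
  rw [PowerControl.residual_eq] at h ⊢
  rw [outflow_sub]
  linarith

/-- The dissipation identity. -/
lemma IsEquilibrium.dissipation (heq : net.IsEquilibrium q a) (s : L → ℝ) (w u : V → ℝ)
    (halg : ∀ i, net.M i = 0 → net.residual s w q i + u i = 0) :
    (∑ i with 0 < net.M i, (w i - net.syncFreq q) * (net.residual s w q i + u i))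
      + ∑ l, net.b l * ((s l - sinVec a l) * net.D.mulVec w l)
      = (∑ i, u i * (w i - net.syncFreq q)) - ∑ i, net.E i * (w i - net.syncFreq q) ^ 2 := by
  -- Terms without inertia vanish by the algebraic equations, so the sum may run over all buses, as
  -- the summation by parts requires.
  have h1 : ∑ i with 0 < net.M i, (w i - net.syncFreq q) * (net.residual s w q i + u i)
      = ∑ i, (w i - net.syncFreq q) * (net.residual s w q i + u i) := by
    refine Finset.sum_subset (Finset.subset_univ _) fun i _ hi => ?_
    have hM : net.M i = 0 :=
      le_antisymm (not_lt.1 fun h => hi (by simpa using h)) (net.M_nonneg i)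
    rw [halg i hM, mul_zero]
  have h2 := sum_mul_outflow net (fun i => w i - net.syncFreq q) (fun l => s l - sinVec a l)
  have h3 : ∑ l, net.b l * ((s l - sinVec a l) * net.D.mulVec w l)
      = ∑ i, (w i - net.syncFreq q) * net.outflow (fun l => s l - sinVec a l) i := by
    rw [h2]
    refine Finset.sum_congr rfl fun l _ => ?_
    rw [D_mulVec_sub_const]; ring
  rw [h1, h3, ← Finset.sum_add_distrib, ← Finset.sum_sub_distrib]
  refine Finset.sum_congr rfl fun i _ => ?_
  rw [IsEquilibrium.residual_eq heq]
  ring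

end Energy

/-! ### Energy decay and invariance of the sublevel regions. -/

section Convergence

variable {V L : Type*} [Fintype V] [DecidableEq V] [Fintype L] [DecidableEq L]

/-- The standing assumptions for the stability analysis: the injection is constant and `a` is an
equilibrium whose frequency lies in the threshold bands. -/
structure ConstantInjection (net : PowerNetwork V L) (spec : ControlSpec V) {d : ℕ}
    (R : Fin d → Finset V) (p : ℝ → V → ℝ) (fc : ℝ → ℝ → V → ℝ) (h T : ℝ) (q : V → ℝ)
    (a : L → ℝ) : Prop where
  cover : ∀ i ∈ spec.Iu, ∃ β, i ∈ R β
  horizon : 0 < h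
  step : 0 < T
  forecast : ∀ t, 0 ≤ t → fc t t = p t
  const : ∀ t, 0 ≤ t → p t = q
  band : ∀ i ∈ spec.Iu, spec.thrLo i < net.syncFreq q ∧ net.syncFreq q < spec.thrHi i
  equilibrium : net.IsEquilibrium q a

variable {net : PowerNetwork V L} {spec : ControlSpec V} {d : ℕ} {R : Fin d → Finset V}
  {p : ℝ → V → ℝ} {fc : ℝ → ℝ → V → ℝ} {h T : ℝ} {q : V → ℝ} {a : L → ℝ}
  {lam : ℝ → L → ℝ} {om u : ℝ → V → ℝ}

namespace ConstantInjection

lemma om_eq_balance (S : ConstantInjection net spec R p fc h T q a)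
    (hcl : IsClosedLoop net spec R p fc h T lam om u) {t : ℝ} (ht : 0 ≤ t) {i : V}
    (hM : net.M i = 0) :
    om t i = spec.balance (net.E i) i (q i - net.outflow (sinVec (lam t)) i) := by
  rw [hcl.om_eq_balance S.cover S.horizon S.step S.forecast ht hM, S.const t ht]

/-- At the equilibrium the mismatch divided by `E i` is the synchronous frequency, which lies in the
threshold band and hence in the safe interval, so no clamp is active. Deviations at buses without
inertia thus become differences of two values of a Lipschitz function. -/
lemma syncFreq_eq_balance (S : ConstantInjection net spec R p fc h T q a) (i : V) :
    net.syncFreq q = spec.balance (net.E i) i (q i - net.outflow (sinVec a) i) := by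
  have hE := net.E_pos i
  have e := S.equilibrium.2.2 i
  rw [residual_eq] at e
  have h1 : (q i - net.outflow (sinVec a) i) / net.E i = net.syncFreq q := by
    field_simp; linarith
  rw [balance_eq_div spec hE, h1]
  intro hi
  have := S.band i (spec.Iω_subset hi)
  have := spec.safe_thr i hi
  rw [h1]
  constructor <;> linarith

lemma abs_om_sub_syncFreq_le (S : ConstantInjection net spec R p fc h T q a)
    (hcl : IsClosedLoop net spec R p fc h T lam om u) {t : ℝ} (ht : 0 ≤ t) {i : V}
    (hM : net.M i = 0) {X : ℝ} (hX : ∀ l, |lam t l - a l| ≤ X) :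
    |om t i - net.syncFreq q| ≤ (∑ l, net.b l) * X / net.E i := by
  have hE := net.E_pos i
  rw [S.syncFreq_eq_balance i, S.om_eq_balance hcl ht hM]
  refine (abs_balance_sub_le spec hE _ _).trans ?_
  rw [sub_sub_sub_cancel_left, ← outflow_sub]
  gcongr
  refine abs_outflow_le net (fun l => ?_) i
  rw [abs_sub_comm]
  exact (Real.abs_sin_sub_sin_le _ _).trans (hX l)

lemma abs_om_sub_om_le (S : ConstantInjection net spec R p fc h T q a)
    (hcl : IsClosedLoop net spec R p fc h T lam om u) {s t : ℝ} (hs : 0 ≤ s) (ht : 0 ≤ t) {i : V}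
    (hM : net.M i = 0) {X : ℝ} (hX : ∀ l, |lam t l - lam s l| ≤ X) :
    |om t i - om s i| ≤ (∑ l, net.b l) * X / net.E i := by
  have hE := net.E_pos i
  rw [S.om_eq_balance hcl hs hM, S.om_eq_balance hcl ht hM]
  refine (abs_balance_sub_le spec hE _ _).trans ?_
  rw [sub_sub_sub_cancel_left, ← outflow_sub]
  gcongr
  refine abs_outflow_le net (fun l => ?_) i
  rw [abs_sub_comm]
  exact (Real.abs_sin_sub_sin_le _ _).trans (hX l)

lemma continuousOn_lam (hcl : IsClosedLoop net spec R p fc h T lam om u) :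
    ContinuousOn lam (Ici 0) :=
  continuousOn_pi.2 fun l => hcl.continuousOn_lam l

/-- Even without inertia, although the input may jump elsewhere: the frequency is then `balance` of
a continuous function of the angles. Hence the angles are continuously differentiable for positive
times. -/
lemma continuousOn_om (S : ConstantInjection net spec R p fc h T q a)
    (hcl : IsClosedLoop net spec R p fc h T lam om u) (i : V) :
    ContinuousOn (fun t => om t i) (Ici 0) := by
  rcases (net.M_nonneg i).eq_or_lt with hM | hM
  · have h1 : Continuous fun y : L → ℝ =>
        spec.balance (net.E i) i (q i - net.outflow (sinVec y) i) := by
      refine (continuous_balance spec (net.E_pos i) i).comp (continuous_const.sub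
        ((continuous_outflow net i).comp ?_))
      unfold sinVec
      fun_prop
    exact (h1.comp_continuousOn (continuousOn_lam hcl)).congr
      fun t ht => S.om_eq_balance hcl ht hM.symm
  · exact hcl.continuousOn_om hM

/-- The synchronous frequency lies inside the band, so beyond a threshold the deviation from it has
the sign that the input must oppose; inside the band the input is zero. -/
lemma input_mul_nonpos (S : ConstantInjection net spec R p fc h T q a)
    (hcl : IsClosedLoop net spec R p fc h T lam om u) {t : ℝ} (ht : 0 ≤ t) (i : V) :
    u t i * (om t i - net.syncFreq q) ≤ 0 := by
  by_cases hi : i ∈ spec.Iu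
  · obtain ⟨c1, c2, c3⟩ := hcl.sign S.cover S.horizon S.step ht hi
    have hb := S.band i hi
    rcases le_or_gt (spec.thrHi i) (om t i) with h1 | h1
    · exact mul_nonpos_of_nonpos_of_nonneg (c1 h1) (by linarith)
    rcases le_or_gt (om t i) (spec.thrLo i) with h2 | h2
    · exact mul_nonpos_of_nonneg_of_nonpos (c2 h2) (by linarith)
    · rw [c3 ⟨h2, h1⟩, zero_mul]
  · rw [hcl.uncontrolled t ht i hi, zero_mul]

lemma freq_eq (S : ConstantInjection net spec R p fc h T q a) {t : ℝ} (ht : 0 ≤ t) (i : V) :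
    net.residual (sinVec (lam t)) (om t) (p t) i = -(net.E i * (om t i - net.syncFreq q))
      - net.outflow (fun l => sinVec (lam t) l - sinVec a l) i := by
  rw [S.const t ht, IsEquilibrium.residual_eq S.equilibrium]

/-- The input is only integrable, so the kinetic energy needs the integral form of the chain rule;
for the potential energy the classical one suffices. -/
lemma kinetic_sub (hcl : IsClosedLoop net spec R p fc h T lam om u) (c : ℝ) {i : V}
    (hM : 0 < net.M i) {s t : ℝ} (hs : 0 ≤ s) (hst : s ≤ t) :
    IntervalIntegrable (fun r => (om r i - c)
      * (net.residual (sinVec (lam r)) (om r) (p r) i + u r i)) volume s t ∧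
    net.M i / 2 * (om t i - c) ^ 2 - net.M i / 2 * (om s i - c) ^ 2
      = ∫ r in s..t, (om r i - c) * (net.residual (sinVec (lam r)) (om r) (p r) i + u r i) := by
  obtain ⟨i1, -⟩ := hcl.om_sub hM hs hst
  have hcont : ContinuousOn (fun r => om r i - c) (uIcc s t) :=
    ((hcl.continuousOn_om hM).mono fun r hr =>
      (hs.trans (by rw [uIcc_of_le hst] at hr; exact hr.1))).sub continuousOn_const
  have e := sq_sub_sq_eq_integral (x := fun r => om r i - c) hst i1 fun r hr => by
    have := (hcl.om_sub hM hs hr.1).2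
    linarith
  have hi := (i1.continuousOn_mul hcont).const_mul (net.M i)
  have hfun : (fun r => net.M i * ((om r i - c)
      * ((net.residual (sinVec (lam r)) (om r) (p r) i + u r i) / net.M i)))
      = fun r => (om r i - c) * (net.residual (sinVec (lam r)) (om r) (p r) i + u r i) := by
    funext r; field_simp
  rw [hfun] at hi
  refine ⟨hi, ?_⟩
  rw [← hfun, intervalIntegral.integral_const_mul]
  linear_combination (net.M i / 2) * e

lemma continuousOn_D (S : ConstantInjection net spec R p fc h T q a)
    (hcl : IsClosedLoop net spec R p fc h T lam om u) (l : L) :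
    ContinuousOn (fun t => net.D.mulVec (om t) l) (Ici 0) := by
  simp only [D_mulVec_apply]
  exact (S.continuousOn_om hcl _).sub (S.continuousOn_om hcl _)

lemma potential_sub (S : ConstantInjection net spec R p fc h T q a)
    (hcl : IsClosedLoop net spec R p fc h T lam om u) (l : L) {s t : ℝ} (hs : 0 ≤ s) (hst : s ≤ t) :
    IntervalIntegrable (fun r => net.b l * ((sinVec (lam r) l - sinVec a l)
      * net.D.mulVec (om r) l)) volume s t ∧
    net.b l * linePotential (a l) (lam t l) - net.b l * linePotential (a l) (lam s l)
      = ∫ r in s..t, net.b l * ((sinVec (lam r) l - sinVec a l) * net.D.mulVec (om r) l) := by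
  have hD := S.continuousOn_D hcl l
  have hl := hcl.continuousOn_lam l
  have hint : IntervalIntegrable (fun r => net.b l * ((sinVec (lam r) l - sinVec a l)
      * net.D.mulVec (om r) l)) volume s t := by
    apply ContinuousOn.intervalIntegrable
    rw [uIcc_of_le hst]
    have hsub : Icc s t ⊆ Ici 0 := fun r hr => hs.trans hr.1
    exact continuousOn_const.mul
      (((Real.continuous_sin.comp_continuousOn (hl.mono hsub)).sub continuousOn_const).mul
        (hD.mono hsub))
  refine ⟨hint, (intervalIntegral.integral_eq_sub_of_hasDerivAt_of_le
    (f := fun r => net.b l * linePotential (a l) (lam r l)) hst ?_ ?_ hint).symm⟩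
  · exact continuousOn_const.mul ((continuous_linePotential (a l)).comp_continuousOn
      (hl.mono fun r hr => hs.trans hr.1))
  · intro r hr
    have hr0 : 0 < r := hs.trans_lt hr.1
    have h1 : HasDerivAt (fun t => ∫ τ in (0 : ℝ)..t, net.D.mulVec (om τ) l)
        (net.D.mulVec (om r) l) r :=
      intervalIntegral.integral_hasDerivAt_right (hcl.angle l r hr0.le).1
        ((hD.mono Ioi_subset_Ici_self).stronglyMeasurableAtFilter isOpen_Ioi r hr0)
        (hD.continuousAt (Ici_mem_nhds hr0))
    have h2 : HasDerivAt (fun t => lam t l) (net.D.mulVec (om r) l) r := by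
      refine (h1.const_add (lam 0 l)).congr_of_eventuallyEq ?_
      filter_upwards [Ici_mem_nhds hr0] with t ht
      exact (hcl.angle l t ht).2
    exact ((hasDerivAt_linePotential (a l) (lam r l)).comp r h2).const_mul (net.b l)

lemma continuousOn_dissipation (S : ConstantInjection net spec R p fc h T q a)
    (hcl : IsClosedLoop net spec R p fc h T lam om u) (i : V) :
    ContinuousOn (fun t => net.E i * (om t i - net.syncFreq q) ^ 2) (Ici 0) :=
  continuousOn_const.mul (((S.continuousOn_om hcl i).sub continuousOn_const).pow 2)

/-- The energy dissipates along closed-loop trajectories. -/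
theorem energy_add_le (S : ConstantInjection net spec R p fc h T q a)
    (hcl : IsClosedLoop net spec R p fc h T lam om u) {s t : ℝ} (hs : 0 ≤ s) (hst : s ≤ t) :
    net.energy q a (lam t) (om t) + ∫ r in s..t, ∑ i, net.E i * (om r i - net.syncFreq q) ^ 2
      ≤ net.energy q a (lam s) (om s) := by
  have hk := fun i (hi : i ∈ Finset.univ.filter fun i => 0 < net.M i) =>
    kinetic_sub hcl (net.syncFreq q) (Finset.mem_filter.1 hi).2 hs hst
  have hp := fun l (_ : l ∈ (Finset.univ : Finset L)) => S.potential_sub hcl l hs hst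
  have hK := IntervalIntegrable.sum _ fun i hi => (hk i hi).1
  have hP := IntervalIntegrable.sum _ fun l hl => (hp l hl).1
  rw [Finset.sum_fn] at hK hP
  have e1 : net.energy q a (lam t) (om t) - net.energy q a (lam s) (om s)
      = ∫ r in s..t, ((∑ i with 0 < net.M i, (om r i - net.syncFreq q)
          * (net.residual (sinVec (lam r)) (om r) (p r) i + u r i))
        + ∑ l, net.b l * ((sinVec (lam r) l - sinVec a l) * net.D.mulVec (om r) l)) := by
    rw [intervalIntegral.integral_add hK hP,
      intervalIntegral.integral_finsetSum fun i hi => (hk i hi).1,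
      intervalIntegral.integral_finsetSum fun l hl => (hp l hl).1, energy_eq, energy_eq,
      ← Finset.sum_congr rfl fun i hi => (hk i hi).2,
      ← Finset.sum_congr rfl fun l hl => (hp l hl).2, Finset.sum_sub_distrib,
      Finset.sum_sub_distrib]
    ring
  have hdis : IntervalIntegrable (fun r => -∑ i, net.E i * (om r i - net.syncFreq q) ^ 2)
      volume s t := by
    apply ContinuousOn.intervalIntegrable
    rw [uIcc_of_le hst]
    exact ((continuousOn_finsetSum _ fun i _ => S.continuousOn_dissipation hcl i).mono
      fun r hr => hs.trans hr.1).neg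
  have e2 := intervalIntegral.integral_mono_on hst (hK.add hP) hdis fun r hr => by
    have hr0 := hs.trans hr.1
    have := IsEquilibrium.dissipation S.equilibrium (sinVec (lam r)) (om r) (u r) fun i hM => by
      have := hcl.algebraic i hM r hr0
      rwa [S.const r hr0] at this
    have h2 : ∑ i, u r i * (om r i - net.syncFreq q) ≤ 0 :=
      Finset.sum_nonpos fun i _ => S.input_mul_nonpos hcl hr0 i
    rw [S.const r hr0, this]
    linarith
  rw [intervalIntegral.integral_neg] at e2
  linarith

lemma energy_antitone (S : ConstantInjection net spec R p fc h T q a)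
    (hcl : IsClosedLoop net spec R p fc h T lam om u) {s t : ℝ} (hs : 0 ≤ s) (hst : s ≤ t) :
    net.energy q a (lam t) (om t) ≤ net.energy q a (lam s) (om s) := by
  have h1 := S.energy_add_le hcl hs hst
  have h2 : 0 ≤ ∫ r in s..t, ∑ i, net.E i * (om r i - net.syncFreq q) ^ 2 :=
    intervalIntegral.integral_nonneg hst fun r _ => Finset.sum_nonneg fun i _ => by
      have := net.E_pos i; positivity
  linarith

/-- Sublevel regions below the energy threshold are invariant. -/
theorem mem_Phi (S : ConstantInjection net spec R p fc h T q a)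
    (hcl : IsClosedLoop net spec R p fc h T lam om u) {r : ℝ} (hr : (r : EReal) < net.rbar q a)
    (h0 : (lam 0, om 0) ∈ net.Phi q a r) {t : ℝ} (ht : 0 ≤ t) :
    (lam t, om t) ∈ net.Phi q a r := by
  have hE : ∀ τ, 0 ≤ τ → net.energy q a (lam τ) (om τ) ≤ r := fun τ hτ =>
    (S.energy_antitone hcl le_rfl hτ).trans h0.2
  -- On the boundary the energy is at least `rbar > r`. The angle path is connected and avoids the
  -- boundary, so it cannot leave the interior.
  have hfr : ∀ τ, 0 ≤ τ → lam τ ∉ frontier (closure (Upsilon L)) := by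
    intro τ hτ hmem
    have h1 := hr.trans_le (rbar_le (net := net) (q := q) (a := a) hmem)
    rw [EReal.coe_lt_coe_iff] at h1
    have h2 := energy_sync_le (net := net) (q := q) (a := a) (lam τ) (om τ)
    linarith [hE τ hτ]
  refine ⟨?_, hE t ht⟩
  set J := lam '' Icc 0 t with hJ
  have hJc : IsPreconnected J :=
    isPreconnected_Icc.image _ ((continuousOn_lam hcl).mono fun τ hτ => hτ.1)
  have hJsub : J ⊆ interior (closure (Upsilon L)) ∪ (closure (Upsilon L))ᶜ := by
    rintro _ ⟨τ, hτ, rfl⟩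
    by_cases hin : lam τ ∈ closure (Upsilon L)
    · left
      by_contra hint
      refine hfr τ hτ.1 ⟨subset_closure hin, hint⟩
    · exact Or.inr hin
  have h00 : lam 0 ∈ interior (closure (Upsilon L)) := by
    rcases hJsub ⟨0, ⟨le_rfl, ht⟩, rfl⟩ with h | h
    · exact h
    · exact absurd h0.1 h
  have hsub := hJc.subset_left_of_subset_union isOpen_interior isClosed_closure.isOpen_compl
    (disjoint_compl_right.mono_left interior_subset) hJsub ⟨_, ⟨0, ⟨le_rfl, ht⟩, rfl⟩, h00⟩
  exact interior_subset (hsub ⟨t, ⟨ht, le_rfl⟩, rfl⟩)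

end ConstantInjection

end Convergence

/-! ### Convergence to the equilibrium and local asymptotic stability. -/

section Attraction

variable {V L : Type*} [Fintype V] [DecidableEq V] [Fintype L] [DecidableEq L]

variable {net : PowerNetwork V L} {spec : ControlSpec V} {d : ℕ} {R : Fin d → Finset V}
  {p : ℝ → V → ℝ} {fc : ℝ → ℝ → V → ℝ} {h T : ℝ} {q : V → ℝ} {a : L → ℝ}
  {lam : ℝ → L → ℝ} {om u : ℝ → V → ℝ}

namespace ConstantInjection

/-- With inertia the bound comes from the kinetic energy; without it, from the angles, which stay
within `π` of the equilibrium. -/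
lemma exists_deviation_bound (S : ConstantInjection net spec R p fc h T q a)
    (hcl : IsClosedLoop net spec R p fc h T lam om u) {r : ℝ}
    (hΦ : ∀ t, 0 ≤ t → (lam t, om t) ∈ net.Phi q a r) :
    ∃ X, 0 ≤ X ∧ ∀ t, 0 ≤ t → ∀ i, |om t i - net.syncFreq q| ≤ X := by
  have hr : 0 ≤ r :=
    (energy_nonneg S.equilibrium.2.1 (hΦ 0 le_rfl).1 (om 0)).trans (hΦ 0 le_rfl).2
  have hb := sum_b_nonneg net
  have hpi := Real.pi_pos
  have h0 : ∀ i ∈ Finset.univ,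
      0 ≤ 1 + r / (net.M i / 2) + (∑ l, net.b l) * Real.pi / net.E i := fun i _ => by
    have := net.M_nonneg i
    have := net.E_pos i
    positivity
  refine ⟨∑ i, (1 + r / (net.M i / 2) + (∑ l, net.b l) * Real.pi / net.E i),
    Finset.sum_nonneg h0, fun t ht i => ?_⟩
  refine le_trans ?_ (Finset.single_le_sum h0 (Finset.mem_univ i))
  have hE := net.E_pos i
  have hM0 := net.M_nonneg i
  have hΦt := hΦ t ht
  rcases hM0.eq_or_lt with hM | hM
  · have h1 := S.abs_om_sub_syncFreq_le hcl ht hM.symm (X := Real.pi) fun l => by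
      have h2 := abs_le_of_mem_closure hΦt.1 l
      have h3 := S.equilibrium.2.1 l
      have h4 := abs_sub (lam t l) (a l)
      simp only at h2
      linarith
    have : 0 ≤ r / (net.M i / 2) := by positivity
    linarith
  · have h1 := abs_le_of_mul_sq_le (half_pos hM)
      ((kinetic_le_energy S.equilibrium.2.1 hΦt.1 (om t) hM).trans hΦt.2)
    have : 0 ≤ (∑ l, net.b l) * Real.pi / net.E i := by positivity
    linarith

lemma abs_outflow_mismatch_le (s s' : L → ℝ) (i : V) :
    |net.outflow (fun l => sinVec s l - sinVec s' l) i| ≤ (∑ l, net.b l) * 2 := by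
  refine abs_outflow_le net (fun l => (abs_sub _ _).trans ?_) i
  have h1 := Real.abs_sin_le_one (s l)
  have h2 := Real.abs_sin_le_one (s' l)
  simp only [sinVec]
  linarith

lemma abs_residual_le_of_deviation (S : ConstantInjection net spec R p fc h T q a) {X : ℝ}
    {t : ℝ} (ht : 0 ≤ t) (hX : ∀ i, |om t i - net.syncFreq q| ≤ X) (i : V) :
    |net.residual (sinVec (lam t)) (om t) (p t) i| ≤ net.E i * X + (∑ l, net.b l) * 2 := by
  rw [S.freq_eq ht]
  refine (abs_sub _ _).trans (add_le_add ?_ (abs_outflow_mismatch_le _ _ i))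
  rw [abs_neg, abs_mul, abs_of_pos (net.E_pos i)]
  exact mul_le_mul_of_nonneg_left (hX i) (net.E_pos i).le

lemma abs_lam_sub_le (hcl : IsClosedLoop net spec R p fc h T lam om u) {X : ℝ}
    (hX : ∀ t, 0 ≤ t → ∀ i, |om t i - net.syncFreq q| ≤ X) {s t : ℝ} (hs : 0 ≤ s) (hst : s ≤ t)
    (l : L) : |lam t l - lam s l| ≤ 2 * X * (t - s) := by
  rw [(hcl.lam_sub l hs hst).2, ← Real.norm_eq_abs, ← abs_of_nonneg (sub_nonneg.2 hst)]
  refine intervalIntegral.norm_integral_le_of_norm_le_const fun r hr => ?_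
  rw [uIoc_of_le hst] at hr
  have hr0 : 0 ≤ r := hs.trans hr.1.le
  rw [← D_mulVec_sub_const net (om r) (net.syncFreq q), D_mulVec_apply, Real.norm_eq_abs]
  have h1 := hX r hr0 (net.pos l)
  have h2 := hX r hr0 (net.neg l)
  exact (abs_sub _ _).trans (by linarith)

lemma abs_outflow_sub_le (hcl : IsClosedLoop net spec R p fc h T lam om u) {X : ℝ}
    (hX : ∀ t, 0 ≤ t → ∀ i, |om t i - net.syncFreq q| ≤ X) {s t : ℝ} (hs : 0 ≤ s) (hst : s ≤ t)
    (i : V) : |net.outflow (sinVec (lam t)) i - net.outflow (sinVec (lam s)) i|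
      ≤ (∑ l, net.b l) * (2 * X) * (t - s) := by
  rw [← outflow_sub, mul_assoc]
  exact abs_outflow_le net (fun l => (Real.abs_sin_sub_sin_le _ _).trans
    (abs_lam_sub_le hcl hX hs hst l)) i

/-- Only an upper bound on the growth is available: no bound on the input is known, but its
contribution to the squared deviation is nonpositive and can be dropped. -/
lemma exists_sq_growth (S : ConstantInjection net spec R p fc h T q a)
    (hcl : IsClosedLoop net spec R p fc h T lam om u) {X : ℝ} (hX0 : 0 ≤ X)
    (hX : ∀ t, 0 ≤ t → ∀ i, |om t i - net.syncFreq q| ≤ X) (i : V) :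
    ∃ C, ∀ s t, 0 ≤ s → s ≤ t →
      (om t i - net.syncFreq q) ^ 2 - (om s i - net.syncFreq q) ^ 2 ≤ C * (t - s) := by
  have hE := net.E_pos i
  rcases (net.M_nonneg i).eq_or_lt with hM | hM
  · refine ⟨(∑ l, net.b l) * (2 * X) / net.E i * (2 * X), fun s t hs hst => ?_⟩
    have ht := hs.trans hst
    have h1 := S.abs_om_sub_om_le hcl hs ht hM.symm (abs_lam_sub_le hcl hX hs hst)
    have h2 := hX s hs i
    have h3 := hX t ht i
    have h4 : |(om t i - net.syncFreq q) + (om s i - net.syncFreq q)| ≤ 2 * X :=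
      (abs_add_le _ _).trans (by linarith)
    calc (om t i - net.syncFreq q) ^ 2 - (om s i - net.syncFreq q) ^ 2
        = (om t i - om s i) * ((om t i - net.syncFreq q) + (om s i - net.syncFreq q)) := by ring
      _ ≤ |om t i - om s i| * |(om t i - net.syncFreq q) + (om s i - net.syncFreq q)| := by
          rw [← abs_mul]; exact le_abs_self _
      _ ≤ ((∑ l, net.b l) * (2 * X * (t - s)) / net.E i) * (2 * X) :=
          mul_le_mul h1 h4 (abs_nonneg _) ((abs_nonneg _).trans h1)
      _ = _ := by ring
  · set K := net.E i * X + (∑ l, net.b l) * 2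
    refine ⟨X * K / (net.M i / 2), fun s t hs hst => ?_⟩
    obtain ⟨i1, e1⟩ := kinetic_sub hcl (net.syncFreq q) hM hs hst
    have h1 : ∫ r in s..t, (om r i - net.syncFreq q)
        * (net.residual (sinVec (lam r)) (om r) (p r) i + u r i) ≤ ∫ _ in s..t, X * K := by
      refine intervalIntegral.integral_mono_on hst i1 intervalIntegrable_const fun r hr => ?_
      have hr0 := hs.trans hr.1
      have h2 := S.input_mul_nonpos hcl hr0 i
      have h3 : (om r i - net.syncFreq q) * net.residual (sinVec (lam r)) (om r) (p r) i
          ≤ X * K := by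
        refine (le_abs_self _).trans ?_
        rw [abs_mul]
        exact mul_le_mul (hX r hr0 i) (S.abs_residual_le_of_deviation hr0 (hX r hr0) i)
          (abs_nonneg _) hX0
      linarith
    rw [intervalIntegral.integral_const, smul_eq_mul, ← e1] at h1
    have hM2 := half_pos hM
    rw [div_mul_eq_mul_div, le_div_iff₀ hM2]
    linarith

/-- Frequencies synchronize. -/
theorem tendsto_om (S : ConstantInjection net spec R p fc h T q a)
    (hcl : IsClosedLoop net spec R p fc h T lam om u) {r : ℝ}
    (hΦ : ∀ t, 0 ≤ t → (lam t, om t) ∈ net.Phi q a r) (i : V) :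
    Tendsto (fun t => om t i) atTop (𝓝 (net.syncFreq q)) := by
  obtain ⟨X, hX0, hX⟩ := S.exists_deviation_bound hcl hΦ
  obtain ⟨C, hC⟩ := S.exists_sq_growth hcl hX0 hX i
  have hE := net.E_pos i
  have hcont : ContinuousOn (fun t => (om t i - net.syncFreq q) ^ 2) (Ici 0) :=
    ((S.continuousOn_om hcl i).sub continuousOn_const).pow 2
  have hlim : Tendsto (fun t => (om t i - net.syncFreq q) ^ 2) atTop (𝓝 0) := by
    refine tendsto_zero_of_integral_bounded (C := C) (K := r / net.E i)
      (fun t _ => sq_nonneg _) hcont hC fun t ht => ?_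
    have h1 := S.energy_add_le hcl le_rfl ht
    have h2 := energy_nonneg (net := net) (q := q) S.equilibrium.2.1 (hΦ t ht).1 (om t)
    have h3 := (hΦ 0 le_rfl).2
    have hsub : uIcc 0 t ⊆ Ici 0 := fun τ hτ => by rw [uIcc_of_le ht] at hτ; exact hτ.1
    have h4 : ∫ τ in (0 : ℝ)..t, net.E i * (om τ i - net.syncFreq q) ^ 2
        ≤ ∫ τ in (0 : ℝ)..t, ∑ i, net.E i * (om τ i - net.syncFreq q) ^ 2 := by
      refine intervalIntegral.integral_mono_on ht
        ((S.continuousOn_dissipation hcl i).mono hsub).intervalIntegrable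
        ((continuousOn_finsetSum _ fun i _ =>
          S.continuousOn_dissipation hcl i).mono hsub).intervalIntegrable fun τ _ => ?_
      exact Finset.single_le_sum (f := fun i => net.E i * (om τ i - net.syncFreq q) ^ 2)
        (fun j _ => by have := net.E_pos j; positivity) (Finset.mem_univ i)
    rw [intervalIntegral.integral_const_mul] at h4
    rw [le_div_iff₀ hE]
    simp only at h3
    linarith
  have habs : Tendsto (fun t => |om t i - net.syncFreq q|) atTop (𝓝 0) := by
    have := (Real.continuous_sqrt.tendsto 0).comp hlim
    rw [Real.sqrt_zero] at this
    exact this.congr fun t => Real.sqrt_sq_eq_abs _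
  have := (tendsto_zero_iff_abs_tendsto_zero _).2 habs
  simpa using this.add_const (net.syncFreq q)

/-- The controller switches off. -/
theorem eventually_input_eq_zero (S : ConstantInjection net spec R p fc h T q a)
    (hcl : IsClosedLoop net spec R p fc h T lam om u) {r : ℝ}
    (hΦ : ∀ t, 0 ≤ t → (lam t, om t) ∈ net.Phi q a r) (i : V) : ∀ᶠ t in atTop, u t i = 0 := by
  by_cases hi : i ∈ spec.Iu
  · have hb := S.band i hi
    filter_upwards [(S.tendsto_om hcl hΦ i).eventually (Ioo_mem_nhds hb.1 hb.2),
      eventually_ge_atTop 0] with t ht ht0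
    exact (hcl.sign S.cover S.horizon S.step ht0 hi).2.2 ht
  · filter_upwards [eventually_ge_atTop 0] with t ht
    exact hcl.uncontrolled t ht i hi

/-- Damping and input tend to zero. Without inertia the algebraic equation gives the claim at once.
With inertia the acceleration is a vanishing term plus the mismatch, which is Lipschitz in time, and
the frequency converges; so the perturbed Barbalat lemma applies. -/
lemma tendsto_outflow_mismatch (S : ConstantInjection net spec R p fc h T q a)
    (hcl : IsClosedLoop net spec R p fc h T lam om u) {r : ℝ}
    (hΦ : ∀ t, 0 ≤ t → (lam t, om t) ∈ net.Phi q a r) (i : V) :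
    Tendsto (fun t => net.outflow (fun l => sinVec (lam t) l - sinVec a l) i) atTop (𝓝 0) := by
  have hom : Tendsto (fun t => -(net.E i * (om t i - net.syncFreq q)) + u t i) atTop (𝓝 0) := by
    have h1 : Tendsto (fun t => om t i - net.syncFreq q) atTop (𝓝 0) := by
      simpa using (S.tendsto_om hcl hΦ i).sub_const (net.syncFreq q)
    have h2 : Tendsto (fun t => u t i) atTop (𝓝 0) :=
      tendsto_const_nhds.congr' ((S.eventually_input_eq_zero hcl hΦ i).mono fun t ht => ht.symm)
    simpa using ((h1.const_mul (net.E i)).neg).add h2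
  rcases (net.M_nonneg i).eq_or_lt with hM | hM
  · refine hom.congr' ?_
    filter_upwards [eventually_ge_atTop 0] with t ht
    have e := hcl.algebraic i hM.symm t ht
    rw [S.freq_eq ht] at e
    linarith
  · obtain ⟨X, hX0, hX⟩ := S.exists_deviation_bound hcl hΦ
    have key := tendsto_zero_of_integral_tendsto (x := fun t => om t i)
      (β := fun t => -(net.outflow (fun l => sinVec (lam t) l - sinVec a l) i) / net.M i)
      (K := (∑ l, net.b l) * (2 * X) / net.M i)
      (fun s t hs hst => (hcl.om_sub hM hs hst).1) (fun s t hs hst => (hcl.om_sub hM hs hst).2)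
      (S.tendsto_om hcl hΦ i) ?_ ?_
    · have := key.const_mul (-net.M i)
      rw [mul_zero] at this
      refine this.congr fun t => ?_
      field_simp
    · have := hom.div_const (net.M i)
      rw [zero_div] at this
      refine this.congr' ?_
      filter_upwards [eventually_ge_atTop 0] with t ht
      rw [S.freq_eq ht]
      ring
    · intro s t hs hst
      have h1 := abs_outflow_sub_le hcl hX hs hst i
      rw [← sub_div, abs_div, abs_of_pos hM, outflow_sub, outflow_sub, div_mul_eq_mul_div]
      gcongr
      refine le_of_eq_of_le ?_ h1
      rw [abs_sub_comm]
      congr 1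
      ring

/-- The bus angles `θ` evolve by integrating the frequencies. Membership in the range of `D` passes
to cluster points and is needed for their uniqueness. -/
lemma isAngleDifference_lam (S : ConstantInjection net spec R p fc h T q a)
    (hcl : IsClosedLoop net spec R p fc h T lam om u) {t : ℝ} (ht : 0 ≤ t) :
    net.IsAngleDifference (lam t) := by
  obtain ⟨θ, hθ⟩ := hcl.init
  refine ⟨fun i => θ i + ∫ s in (0 : ℝ)..t, om s i, funext fun l => ?_⟩
  have hint : ∀ i, IntervalIntegrable (fun s => om s i) volume 0 t := fun i =>
    ((S.continuousOn_om hcl i).mono fun τ hτ => by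
      rw [uIcc_of_le ht] at hτ; exact hτ.1).intervalIntegrable
  rw [(hcl.angle l t ht).2, hθ]
  simp only [D_mulVec_apply]
  rw [intervalIntegral.integral_sub (hint _) (hint _)]
  ring

lemma isClosed_isAngleDifference (net : PowerNetwork V L) :
    IsClosed {y | net.IsAngleDifference y} := by
  have : {y | net.IsAngleDifference y} = (LinearMap.range net.D.mulVecLin : Set (L → ℝ)) := by
    ext y
    simp [PowerNetwork.IsAngleDifference, eq_comm]
  rw [this]
  exact Submodule.closed_of_finiteDimensional _

/-- In the closed cube, an equilibrium of the uncontrolled network is unique. -/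
lemma eq_of_outflow_eq (heq : net.IsEquilibrium q a) {y : L → ℝ}
    (hy : y ∈ closure (Upsilon L)) (hr : net.IsAngleDifference y)
    (h0 : ∀ i, net.outflow (fun l => sinVec y l - sinVec a l) i = 0) : y = a := by
  obtain ⟨θ, hθ⟩ := hr
  obtain ⟨θ', hθ'⟩ := heq.1
  -- Pairing the vanishing mismatch with the difference of bus angles gives `∑ b (sin y - sin a) (y
  -- - a) = 0`, whose terms are positive wherever `y` and `a` differ.
  have h1 := sum_mul_outflow net (fun i => θ i - θ' i) (fun l => sinVec y l - sinVec a l)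
  simp only [h0, mul_zero, Finset.sum_const_zero] at h1
  have h2 : ∀ l, net.D.mulVec (fun i => θ i - θ' i) l = y l - a l := by
    intro l
    rw [hθ, hθ']
    simp only [D_mulVec_apply]
    ring
  have hmem : ∀ l, y l ∈ Icc (-(Real.pi / 2)) (Real.pi / 2) := fun l =>
    abs_le.1 (abs_le_of_mem_closure hy l)
  have hmem' : ∀ l, a l ∈ Icc (-(Real.pi / 2)) (Real.pi / 2) := fun l =>
    abs_le.1 (heq.2.1 l).le
  have h3 : ∀ l, y l ≠ a l →
      0 < net.b l * (sinVec y l - sinVec a l) * net.D.mulVec (fun i => θ i - θ' i) l := by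
    intro l hne
    rw [h2, mul_assoc]
    refine mul_pos (net.b_pos l) ?_
    rcases lt_or_gt_of_ne hne with hlt | hlt
    · exact mul_pos_of_neg_of_neg (sub_neg.2 (Real.strictMonoOn_sin (hmem l) (hmem' l) hlt))
        (sub_neg.2 hlt)
    · exact mul_pos (sub_pos.2 (Real.strictMonoOn_sin (hmem' l) (hmem l) hlt)) (sub_pos.2 hlt)
  have h4 : ∀ l ∈ Finset.univ,
      0 ≤ net.b l * (sinVec y l - sinVec a l) * net.D.mulVec (fun i => θ i - θ' i) l := by
    intro l _
    by_cases hne : y l = a l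
    · rw [h2, hne, sub_self, mul_zero]
    · exact (h3 l hne).le
  funext l
  by_contra hne
  have := (Finset.sum_eq_zero_iff_of_nonneg h4).1 h1.symm l (Finset.mem_univ l)
  exact (h3 l hne).ne' this

/-- Angle differences converge to the equilibrium. -/
theorem tendsto_lam (S : ConstantInjection net spec R p fc h T q a)
    (hcl : IsClosedLoop net spec R p fc h T lam om u) {r : ℝ}
    (hΦ : ∀ t, 0 ≤ t → (lam t, om t) ∈ net.Phi q a r) : Tendsto lam atTop (𝓝 a) := by
  refine isCompact_closure_Upsilon.tendsto_nhds_of_unique_mapClusterPt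
    ((eventually_ge_atTop 0).mono fun t ht => (hΦ t ht).1) fun y hy hcluster => ?_
  obtain ⟨U, hU, hlim⟩ := mapClusterPt_iff_ultrafilter.1 hcluster
  refine eq_of_outflow_eq S.equilibrium hy ?_ fun i => ?_
  · exact (isClosed_isAngleDifference net).mem_of_tendsto hlim
      (hU ((eventually_ge_atTop 0).mono fun t ht => S.isAngleDifference_lam hcl ht))
  · have hc : Continuous fun y : L → ℝ => net.outflow (fun l => sinVec y l - sinVec a l) i := by
      refine (continuous_outflow net i).comp ?_
      unfold sinVec
      fun_prop
    exact tendsto_nhds_unique ((hc.tendsto y).comp hlim)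
      ((S.tendsto_outflow_mismatch hcl hΦ i).mono_left hU)

theorem tendsto_state (S : ConstantInjection net spec R p fc h T q a)
    (hcl : IsClosedLoop net spec R p fc h T lam om u) {r : ℝ}
    (hΦ : ∀ t, 0 ≤ t → (lam t, om t) ∈ net.Phi q a r) :
    Tendsto (fun t => (lam t, om t)) atTop (𝓝 (a, fun _ => net.syncFreq q)) :=
  (S.tendsto_lam hcl hΦ).prodMk_nhds (tendsto_pi_nhds.2 fun i => S.tendsto_om hcl hΦ i)

lemma eventually_mem_Phi (ha : a ∈ Upsilon L) {r : ℝ} (hr : 0 < r) :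
    ∀ᶠ x in 𝓝 ((a, fun _ => net.syncFreq q) : (L → ℝ) × (V → ℝ)), x ∈ net.Phi q a r := by
  have h1 : ∀ᶠ x in 𝓝 ((a, fun _ => net.syncFreq q) : (L → ℝ) × (V → ℝ)), x.1 ∈ Upsilon L :=
    continuous_fst.continuousAt.eventually (isOpen_Upsilon.mem_nhds ha)
  have h2 : ∀ᶠ x in 𝓝 ((a, fun _ => net.syncFreq q) : (L → ℝ) × (V → ℝ)),
      net.energy q a x.1 x.2 < r := by
    refine (continuous_energy (net := net) (q := q) (a := a)).continuousAt.eventually_lt_const ?_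
    simpa only [energy_equilibrium] using hr
  filter_upwards [h1, h2] with x h1 h2
  exact ⟨subset_closure h1, h2.le⟩

/-- Small sublevel regions are close to the equilibrium. -/
lemma exists_Phi_subset (S : ConstantInjection net spec R p fc h T q a) {ε : ℝ} (hε : 0 < ε) :
    ∃ r : ℝ, 0 < r ∧ (r : EReal) < net.rbar q a ∧ ∀ (lam : ℝ → L → ℝ) (om u : ℝ → V → ℝ),
      IsClosedLoop net spec R p fc h T lam om u → ∀ t, 0 ≤ t →
      (lam t, om t) ∈ net.Phi q a r → dist (lam t, om t) (a, fun _ => net.syncFreq q) < ε := by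
  have ha := S.equilibrium.2.1
  have hb := sum_b_nonneg net
  have hpos : ∀ i ∈ Finset.univ, 0 ≤ (∑ l, net.b l) / net.E i := fun i _ => by
    have := net.E_pos i; positivity
  have hsum := Finset.sum_nonneg hpos
  -- The energy does not see frequencies without inertia, which is why closeness is claimed only
  -- along closed-loop solutions. There these deviations are at most `A` times that of the angles,
  -- so the angles are kept within `ε / (2 * A)`.
  set A := 1 + ∑ i, (∑ l, net.b l) / net.E i with hA
  have hA0 : 0 < A := by positivity
  set ε' := ε / (2 * A) with hε'
  have hε'0 : 0 < ε' := by positivity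
  have hAε : A * ε' = ε / 2 := by rw [hε']; field_simp
  choose c hc0 hc using fun l => exists_linePotential_lower (ha l) hε'0
  obtain ⟨r₀, hr₀, hrbar⟩ := exists_pos_le_rbar (net := net) (q := q) ha
  have hev1 : ∀ᶠ r in 𝓝[>] (0 : ℝ), ∀ l, r < net.b l * c l := by
    rw [eventually_all]
    intro l
    exact nhdsWithin_le_nhds (eventually_lt_nhds (mul_pos (net.b_pos l) (hc0 l)))
  have hev2 : ∀ᶠ r in 𝓝[>] (0 : ℝ), ∀ i, 0 < net.M i → r < net.M i / 2 * ε ^ 2 := by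
    rw [eventually_all]
    intro i
    by_cases hM : 0 < net.M i
    · filter_upwards [nhdsWithin_le_nhds (eventually_lt_nhds
        (show 0 < net.M i / 2 * ε ^ 2 by positivity))] with r hr _ using hr
    · exact Eventually.of_forall fun r h => absurd h hM
  obtain ⟨r, ⟨⟨hr1, hr2⟩, hr3⟩, hr0⟩ := ((hev1.and hev2).and
    (nhdsWithin_le_nhds (eventually_lt_nhds hr₀))).and self_mem_nhdsWithin |>.exists
  refine ⟨r, hr0, (EReal.coe_lt_coe_iff.2 hr3).trans_le hrbar, fun lam om u hcl t ht hΦ => ?_⟩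
  have hl : ∀ l, |lam t l - a l| < ε' := by
    intro l
    refine hc l _ (abs_le_of_mem_closure hΦ.1 l) ?_
    have h1 := (line_le_energy ha hΦ.1 (om t) l).trans hΦ.2
    exact lt_of_mul_lt_mul_left (h1.trans_lt (hr1 l)) (net.b_pos l).le
  have hε'ε : ε' < ε := by nlinarith
  rw [Prod.dist_eq, max_lt_iff]
  constructor
  · rw [dist_pi_lt_iff hε]
    exact fun l => (hl l).trans hε'ε
  · rw [dist_pi_lt_iff hε]
    intro i
    rw [Real.dist_eq]
    rcases (net.M_nonneg i).eq_or_lt with hM | hM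
    · have h1 := S.abs_om_sub_syncFreq_le hcl ht hM.symm fun l => (hl l).le
      have h2 := Finset.single_le_sum hpos (Finset.mem_univ i)
      have h3 : (∑ l, net.b l) * ε' / net.E i ≤ A * ε' := by
        rw [mul_div_right_comm]
        gcongr
        linarith
      simp only
      linarith
    · have h1 := (kinetic_le_energy ha hΦ.1 (om t) hM).trans hΦ.2
      have h2 := lt_of_mul_lt_mul_left (h1.trans_lt (hr2 i hM)) (half_pos hM).le
      exact abs_lt_of_sq_lt_sq h2 hε.le

/-- Local asymptotic stability of the closed loop. -/
theorem isLocallyAsymptoticallyStable (S : ConstantInjection net spec R p fc h T q a) :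
    IsLocallyAsymptoticallyStable (closedLoopStates net spec R p fc h T)
      (a, fun _ => net.syncFreq q) := by
  have ha := S.equilibrium.2.1
  constructor
  · intro ε hε
    obtain ⟨r, hr0, hr, hsub⟩ := S.exists_Phi_subset hε
    obtain ⟨η, hη, hball⟩ := Metric.eventually_nhds_iff.1
      (eventually_mem_Phi (net := net) (q := q) ha hr0)
    refine ⟨η, hη, ?_⟩
    rintro y ⟨u, hcl⟩ hy t ht
    exact hsub _ _ _ hcl t ht (S.mem_Phi hcl hr (hball hy) ht)
  · obtain ⟨r, hr0, hr, -⟩ := S.exists_Phi_subset one_pos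
    obtain ⟨η, hη, hball⟩ := Metric.eventually_nhds_iff.1
      (eventually_mem_Phi (net := net) (q := q) ha hr0)
    refine ⟨η, hη, ?_⟩
    rintro y ⟨u, hcl⟩ hy
    exact S.tendsto_state hcl fun t ht => S.mem_Phi hcl hr (hball hy) ht

end ConstantInjection

end Attraction

end PowerControl

end

/-! ### Assembly of the main theorem. -/

theorem mainTheorem2 {V L : Type*} [Fintype V] [DecidableEq V] [Fintype L] [DecidableEq L]
    (net : PowerControl.PowerNetwork V L) (hconn : net.graph.Connected) (hM : ∃ i, 0 < net.M i)
    (spec : PowerControl.ControlSpec V)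
    {d : ℕ} (R : Fin d → Finset V)
    (hcover : ∀ i ∈ spec.Iu, ∃ β, i ∈ R β)
    (hdisj : ∀ α β, α ≠ β → R α ∩ R β ∩ spec.Iu = ∅)
    (h : ℝ) (hh : 0 < h)
    (p : ℝ → V → ℝ) (fc : ℝ → ℝ → V → ℝ) (hfc : ∀ t, 0 ≤ t → fc t t = p t) :
    ∀ ρ : ℝ, ∃ Tbar > 0, ∀ T, 0 < T → T ≤ Tbar →
      -- the controller is well defined
      (∀ t, 0 ≤ t → (∀ τ ∈ Set.Icc t (t + h), ∀ i, |fc t τ i| ≤ ρ) →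
        ∀ (lam : L → ℝ) (w : V → ℝ), (∀ i, |w i| ≤ ρ) →
          PowerControl.IsConsistent net spec (p t) lam w →
          ∀ β, ∃! u₀, PowerControl.IsRegionInput net spec fc h T (R β) t lam w u₀) ∧
      -- zero input in the threshold band, invariance of the safe interval
      (∀ (lam : ℝ → L → ℝ) (om u : ℝ → V → ℝ),
        PowerControl.IsClosedLoop net spec R p fc h T lam om u →
        (∀ i ∈ spec.Iu, ∀ t, 0 ≤ t → om t i ∈ Set.Ioo (spec.thrLo i) (spec.thrHi i) →
          u t i = 0) ∧
        (∀ i ∈ spec.Iω, spec.ξ i = true →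
          om 0 i ∈ Set.Icc (spec.ωlo i) (spec.ωhi i) →
          (om 0 i ∈ Set.Ioo (spec.ωlo i) (spec.ωhi i) ∨
            PowerControl.IsLimitFromInside spec
              (PowerControl.closedLoopStates net spec R p fc h T) i (fun t => (lam t, om t))) →
          ∀ t, 0 ≤ t → om t i ∈ Set.Icc (spec.ωlo i) (spec.ωhi i))) ∧
      -- constant power injection
      (∀ pstar : V → ℝ, (∀ t, 0 ≤ t → p t = pstar) →
        (∀ i ∈ spec.Iu, spec.thrLo i < net.syncFreq pstar ∧ net.syncFreq pstar < spec.thrHi i) →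
        ∀ Ldag : Matrix V V ℝ, PowerControl.IsMoorePenrose net.laplacian Ldag →
        net.edgeNorm (Ldag.mulVec (fun i => pstar i - net.syncFreq pstar * net.E i)) < 1 →
        ∀ laminf : L → ℝ, net.IsEquilibrium pstar laminf →
        PowerControl.IsLocallyAsymptoticallyStable
          (PowerControl.closedLoopStates net spec R p fc h T)
          (laminf, fun _ => net.syncFreq pstar) ∧
        ∀ r : ℝ, 0 ≤ r → (r : EReal) < net.rbar pstar laminf →
        ∀ (lam : ℝ → L → ℝ) (om u : ℝ → V → ℝ),
          PowerControl.IsClosedLoop net spec R p fc h T lam om u →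
          (lam 0, om 0) ∈ net.Phi pstar laminf r →
          (∀ t, 0 ≤ t → (lam t, om t) ∈ net.Phi pstar laminf r) ∧
          Filter.Tendsto (fun t => (lam t, om t)) Filter.atTop
            (nhds (laminf, fun _ => net.syncFreq pstar)) ∧
          (∀ i ∈ spec.Iu, ∃ t₁, 0 ≤ t₁ ∧ ∀ t, t₁ ≤ t → u t i = 0) ∧
          (∀ i ∈ spec.Iω, spec.ξ i = true → om 0 i ∉ Set.Icc (spec.ωlo i) (spec.ωhi i) →
            ∃ t₁, 0 ≤ t₁ ∧ ∀ t, t₁ ≤ t → om t i ∈ Set.Icc (spec.ωlo i) (spec.ωhi i))) := by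
  intro ρ
  -- There are finitely many regions, so one bound on `T` serves all of them. Only this part of the
  -- claim restricts `T`; solutions carry the solvability of the region problems with them.
  have hev : ∀ᶠ T in nhdsWithin (0 : ℝ) (Set.Ioi 0), ∀ β t, 0 ≤ t →
      (∀ τ ∈ Set.Icc t (t + h), ∀ i, |fc t τ i| ≤ ρ) →
      ∀ (lam : L → ℝ) (w : V → ℝ), (∀ i, |w i| ≤ ρ) →
        PowerControl.IsConsistent net spec (p t) lam w →
        ∃! u₀, PowerControl.IsRegionInput net spec fc h T (R β) t lam w u₀ :=
    Filter.eventually_all.2 fun β =>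
      PowerControl.eventually_existsUnique_isRegionInput net spec hfc hh (R β) ρ
  obtain ⟨Tbar, hTbar, hsub⟩ := mem_nhdsGT_iff_exists_Ioc_subset.1 hev
  refine ⟨Tbar, hTbar, fun T hT hTle => ⟨?_, ?_, ?_⟩⟩
  · intro t ht hρ lam w hw hcons β
    exact hsub ⟨hT, hTle⟩ β t ht hρ lam w hw hcons
  · intro lam om u hcl
    exact ⟨fun i hi t ht hin => (hcl.sign hcover hh hT ht hi).2.2 hin,
      fun i hi hs _ h0 t ht => hcl.mem_Icc hcover hh hT hfc hi hs h0 ht⟩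
  · intro pstar hp hband Ldag _ _ laminf heq
    have S : PowerControl.ConstantInjection net spec R p fc h T pstar laminf :=
      ⟨hcover, hh, hT, hfc, hp, hband, heq⟩
    refine ⟨S.isLocallyAsymptoticallyStable, fun r _ hr lam om u hcl h0 => ?_⟩
    have hΦ : ∀ t, 0 ≤ t → (lam t, om t) ∈ net.Phi pstar laminf r :=
      fun t ht => S.mem_Phi hcl hr h0 ht
    refine ⟨hΦ, S.tendsto_state hcl hΦ, fun i _ => ?_, fun i hi _ _ => ?_⟩
    · obtain ⟨t₁, ht₁⟩ := Filter.eventually_atTop.1 (S.eventually_input_eq_zero hcl hΦ i)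
      exact ⟨max t₁ 0, le_max_right _ _, fun t ht => ht₁ t ((le_max_left _ _).trans ht)⟩
    · have hb := hband i (spec.Iω_subset hi)
      have hst := spec.safe_thr i hi
      -- The limit frequency lies in the threshold band, hence in the interior of the safe interval.
      obtain ⟨t₁, ht₁⟩ := Filter.eventually_atTop.1 ((S.tendsto_om hcl hΦ i).eventually
        (Icc_mem_nhds (hst.1.trans hb.1) (hb.2.trans hst.2)))
      exact ⟨max t₁ 0, le_max_right _ _, fun t ht => ht₁ t ((le_max_left _ _).trans ht)⟩
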